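/- Let $K$ be a number field with ring of integers $\mathcal O_K$. For a nonzero prime ideal $\mathfrak q$ of $\mathcal O_K$ write $q=N(\mathfrak q)$ for its norm, $K_{\mathfrak q}$ for the completion and $\mathcal O_{K_{\mathfrak q}}$ for its ring of integers. For an integer $k\ge 0$ let $f_{\mathfrak q,k}$ be the indicator function, on $\mathrm{GL}(2,K_{\mathfrak q})$, of the set of $X\in \mathrm{Mat}(2,\mathcal O_{K_{\mathfrak q}})$ with $|\det X|_{\mathfrak q}=q^{-k}$. For $\gamma\in\mathrm{GL}(2,K)$ put $$\mathcal O(\gamma,f_{\mathfrak q,k})=\int_{G_\gamma\backslash \mathrm{GL}(2,K_{\mathfrak q})}f_{\mathfrak q,k}(x^{-1}\gamma x)\,dx,$$ where $G_\gamma$ is the centralizer of $\gamma$ in $\mathrm{GL}(2,K_{\mathfrak q})$ and $dx$ is the quotient of the Haar measures that give volume $1$ to $\mathrm{GL}(2,\mathcal O_{K_{\mathfrak q}})$ and to the maximal compact subgroup of $G_\gamma$. Let $k_{\mathfrak q}\ge 0$ be integers, almost all of them $0$, and let $f=\prod_{\mathfrak q}f_{\mathfrak q,k_{\mathfrak q}}$.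 Let $\gamma\in \mathrm{GL}(2,K)$ be regular elliptic (its characteristic polynomial is irreducible over $K$) and contributing to $f$, that is, $\prod_{\mathfrak q}\mathcal O(\gamma,f_{\mathfrak q,k_{\mathfrak q}})\ne 0$. Let $K_\gamma=K(\gamma)$ be the quadratic extension generated by a root, again called $\gamma$, of the characteristic polynomial; let $S_\gamma$ be the ideal of $\mathcal O_K$ with $S_\gamma^2\,\mathrm{Disc}(K_\gamma/K)=(\mathrm{Disc}_{K_\gamma/K}(\gamma))$; and let $\chi_\gamma(\mathfrak p)$ be $1$, $-1$ or $0$ according to whether the prime $\mathfrak p$ of $K$ splits, is inert or ramifies in $K_\gamma$. For each $\mathfrak q$ let $L=K_\gamma\otimes_K K_{\mathfrak q}=L_1\times\cdots\times L_g$ be the decomposition into fields, $q^{f_i}$ the cardinality of the residue field of $L_i$, $\mathcal O_L$ the integral closure of $\mathcal O_{K_{\mathfrak q}}$ in $L$, $\mathcal O=\mathcal O_{K_{\mathfrak q}}[\gamma]$, $n=\mathrm{length}_{\mathcal O_{K_{\mathfrak q}}}(\mathcal O_L/\mathcal O)$, $V(s)=\prod_{i}(1-q^{-f_is})$ and $\zeta_{\mathcal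 O}(s)=\sum_{I}[\mathcal O:I]^{-s}$, the sum being over the ideals $I$ of finite index in $\mathcal O$. Let $\tilde J_{\mathcal O_{K_{\mathfrak q}}[\gamma]}(s)$ be the entire function that equals $q^{ns}V(s)\zeta_{\mathcal O}(s)$ for $\Re s>0$. Then the ideal $S_\gamma$ and the functions $\tilde J_{\mathcal O_{K_{\mathfrak q}}[\gamma]}$ exist (the series $\zeta_{\mathcal O}(s)$ converges absolutely for $\Re s>0$), for almost all $\mathfrak q$ one has $\tilde J_{\mathcal O_{K_{\mathfrak q}}[\gamma]}=1$ and $\mathcal O(\gamma,f_{\mathfrak q,k_{\mathfrak q}})=1$, and for all $s\in\mathbb C$ $$\mathcal O(s,\gamma,f):=\prod_{\mathfrak q}\tilde J_{\mathcal O_{K_{\mathfrak q}}[\gamma]}(s)=N(S_\gamma)^s\sum_{\mathfrak d\mid S_\gamma}N(\mathfrak d)^{1-2s}\prod_{\mathfrak p\mid S_\gamma/\mathfrak d}\left(1-\frac{\chi_\gamma(\mathfrak p)}{N(\mathfrak p)^s}\right).$$ This function of $s$ is entire and satisfies $\mathcal O(1-s,\gamma,f)=\mathcal O(s,\gamma,f)$.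 Its value at $s=1$ is $$\prod_{\mathfrak q}\mathcal O(\gamma,f_{\mathfrak q,k_{\mathfrak q}})=\prod_{\mathfrak q\mid S_\gamma}\mathcal O(\gamma,f_{\mathfrak q,k_{\mathfrak q}})=\sum_{\mathfrak d\mid S_\gamma}N(\mathfrak d)\prod_{\mathfrak p\mid \mathfrak d}\left(1-\frac{\chi_\gamma(\mathfrak p)}{N(\mathfrak p)}\right).$$ -/

import Mathlib

open NumberField IsDedekindDomain Matrix MeasureTheory
open scoped TensorProduct ENNReal

noncomputable section

namespace OrbitalGL2

/-! ### Zeta functions of orders in a local algebra -/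

section LocalOrder

variable {R L : Type*} [CommRing R] [CommRing L] [Algebra R L]

/-- The Dirichlet series `ζ_O(s) = ∑ [O : I]^(-s)` over the ideals `I` of finite index of `O`. -/
def orderZeta (O : Subalgebra R L) (s : ℂ) : ℂ :=
  ∑' I : {I : Ideal O // Finite (O ⧸ I)}, (Nat.card (O ⧸ I.1) : ℂ) ^ (-s)

/-- Absolute convergence of the series `ζ_O(s)`. -/
def OrderZetaConverges (O : Subalgebra R L) (s : ℂ) : Prop :=
  Summable fun I : {I : Ideal O // Finite (O ⧸ I)} => (Nat.card (O ⧸ I.1) : ℂ) ^ (-s)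

variable (R L) in
/-- `V(s) = ∏ᵢ (1 - Qᵢ^(-s))`, where `L = L₁ × ⋯ × L_g` is a product of local fields and `Qᵢ = q^(fᵢ)`
is the cardinality of the residue field of `Lᵢ`. The integral closure of `R` in `L` is the product
of the discrete valuation rings `O_{Lᵢ}`, so its maximal ideals `m` correspond to the
factors, and the residue ring at `m` is the residue field of the corresponding factor. -/
def vFactor (s : ℂ) : ℂ :=
  ∏ᶠ m : MaximalSpectrum (integralClosure R L),
    (1 - (Nat.card (integralClosure R L ⧸ m.asIdeal) : ℂ) ^ (-s))

/-- `n = length_R (O_L / O)`, where `O_L` is the integral closure of `R` in `L`. -/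
def colength (O : Subalgebra R L) : ℕ :=
  (Module.length R (Subalgebra.toSubmodule (integralClosure R L) ⧸
    (Subalgebra.toSubmodule O).submoduleOf
      (Subalgebra.toSubmodule (integralClosure R L)))).toNat

/-- `J` is the entire function that is given by `q^(ns) V(s) ζ_O(s)` on the half-plane of absolute
convergence `Re s > 0` of the local zeta function `ζ_O`. By the identity theorem there is at most
one such `J`. -/
def IsNormalizedZeta (q : ℕ) (O : Subalgebra R L) (J : ℂ → ℂ) : Prop :=
  Differentiable ℂ J ∧ ∀ s : ℂ, 0 < s.re →
    OrderZetaConverges O s ∧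
      J s = (q : ℂ) ^ ((colength O : ℂ) * s) * vFactor R L s * orderZeta O s

open Classical in
/-- The normalised zeta function `J̃_O(s) = q^(ns) V(s) ζ_O(s)`, continued to all of `ℂ`. -/
def normalizedZeta (q : ℕ) (O : Subalgebra R L) : ℂ → ℂ :=
  if h : ∃ J, IsNormalizedZeta q O J then h.choose else 0

end LocalOrder

/-! ### Orbital integrals -/

section Quotient

variable {G : Type*} [Group G] [TopologicalSpace G] [MeasurableSpace G]

/-- `ν` is the measure on `H \ G` that results from the Haar measures on `G` and on `H` which give
volume `1` to `C ⊆ G` and to `U ⊆ H`: integrating over `G` is the same as integrating first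
over the fibres `H x`, and then over `H \ G`. (For unimodular `H` the fibre integral does not depend
on the representative `x` of `H x`, and `ν` is invariant under right translation.) -/
def IsQuotientMeasure (H : Subgroup G) (C : Set G) (U : Set H)
    (ν : Measure (Quotient (QuotientGroup.rightRel H))) : Prop :=
  ∃ (μG : Measure G) (μH : Measure H),
    μG.IsHaarMeasure ∧ μG C = 1 ∧ μH.IsHaarMeasure ∧ μH U = 1 ∧
      ∀ φ : G → ℝ≥0∞, Measurable φ →
        ∫⁻ x, φ x ∂μG = ∫⁻ y, ∫⁻ h : H, φ ((h : G) * y.out) ∂μH ∂ν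

open Classical in
/-- The quotient measure on `H \ G`. -/
def quotientMeasure (H : Subgroup G) (C : Set G) (U : Set H) :
    Measure (Quotient (QuotientGroup.rightRel H)) :=
  if h : ∃ ν, IsQuotientMeasure H C U ν then h.choose else 0

end Quotient

/-- The function `x ↦ f (x⁻¹ g x)` on `G_g \ G`, where `G_g` is the centralizer of `g`. -/
def orbitFunction {G : Type*} [Group G] (g : G) (f : G → ℝ) :
    Quotient (QuotientGroup.rightRel (Subgroup.centralizer {g})) → ℝ :=
  Quotient.lift (fun x => f (x⁻¹ * g * x)) (by
    intro x y hxy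
    have h : y * x⁻¹ ∈ Subgroup.centralizer {g} := QuotientGroup.rightRel_apply.mp hxy
    have h' : g * (y * x⁻¹) = y * x⁻¹ * g :=
      Subgroup.mem_centralizer_iff.mp h g (Set.mem_singleton g)
    have key : x⁻¹ * g * x = y⁻¹ * g * y := by
      calc x⁻¹ * g * x = y⁻¹ * (y * x⁻¹ * g) * x := by group
        _ = y⁻¹ * (g * (y * x⁻¹)) * x := by rw [h']
        _ = y⁻¹ * g * y := by group
    exact congrArg f key)

section Global

variable {K : Type*} [Field K] [NumberField K]

instance instMeasurableSpaceGL (v : HeightOneSpectrum (𝓞 K)) :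
    MeasurableSpace (GL (Fin 2) (v.adicCompletion K)) :=
  borel _

instance instBorelSpaceGL (v : HeightOneSpectrum (𝓞 K)) :
    BorelSpace (GL (Fin 2) (v.adicCompletion K)) :=
  ⟨rfl⟩

/-- The test function `f_{v,k}` on `GL(2, K_v)`: the indicator function of the integral matrices
`X` with `|det X|_v = N(v)^(-k)`. -/
def testFunction (v : HeightOneSpectrum (𝓞 K)) (k : ℕ) : GL (Fin 2) (v.adicCompletion K) → ℝ :=
  Set.indicator {X | (∀ i j, X.1 i j ∈ v.adicCompletionIntegers K) ∧
    Valued.v X.1.det = WithZero.exp (-(k : ℤ))} 1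

/-- The standard maximal compact subgroup `GL(2, O_v)` of `GL(2, K_v)`. -/
def maxCompactGL (v : HeightOneSpectrum (𝓞 K)) : Subgroup (GL (Fin 2) (v.adicCompletion K)) :=
  (GeneralLinearGroup.map (n := Fin 2)
    (algebraMap (v.adicCompletionIntegers K) (v.adicCompletion K))).range

/-- The maximal compact subgroup of the centralizer of `g`. For regular semisimple `g` the
centralizer is `L^×` with `L = K_v[g]`, and the subgroup is `O_L^×`. -/
def maxCompactCentralizer (v : HeightOneSpectrum (𝓞 K)) (g : GL (Fin 2) (v.adicCompletion K)) :
    Set (Subgroup.centralizer {g}) :=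
  {h | IsIntegral (v.adicCompletionIntegers K) h.1.1 ∧
    IsIntegral (v.adicCompletionIntegers K) (h⁻¹).1.1}

/-- The orbital integral of `f` at `g`, the integral of `f (x⁻¹ g x)` over `G_g \ GL(2, K_v)`. -/
def orbitalIntegral (v : HeightOneSpectrum (𝓞 K)) (g : GL (Fin 2) (v.adicCompletion K))
    (f : GL (Fin 2) (v.adicCompletion K) → ℝ) : ℝ :=
  ∫ y, orbitFunction g f y ∂(quotientMeasure (Subgroup.centralizer {g})
    (maxCompactGL v : Set (GL (Fin 2) (v.adicCompletion K))) (maxCompactCentralizer v g))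

/-- `γ` regarded as an element of `GL(2, K_v)`. -/
def toLocal (v : HeightOneSpectrum (𝓞 K)) (γ : GL (Fin 2) K) :
    GL (Fin 2) (v.adicCompletion K) :=
  GeneralLinearGroup.map (algebraMap K (v.adicCompletion K)) γ

/-- The local factor `O(γ, f_{v,k})`. -/
def localOrbital (γ : GL (Fin 2) K) (k : HeightOneSpectrum (𝓞 K) → ℕ)
    (v : HeightOneSpectrum (𝓞 K)) : ℝ :=
  orbitalIntegral v (toLocal v γ) (testFunction v (k v))

/-- `γ` is regular elliptic: its characteristic polynomial is irreducible over `K`. -/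
def IsRegularElliptic (γ : GL (Fin 2) K) : Prop :=
  Irreducible γ.1.charpoly

/-- `γ` contributes to `f = ∏ f_{v,k_v}`: the orbital integral `O(γ, f) = ∏ O(γ, f_{v,k_v})` is not
zero. -/
def IsContributing (γ : GL (Fin 2) K) (k : HeightOneSpectrum (𝓞 K) → ℕ) : Prop :=
  ∏ᶠ v, localOrbital γ k v ≠ 0

/-! ### The quadratic extension generated by `γ` -/

/-- The quadratic extension `K_γ`, obtained by adjoining a root of the characteristic polynomial. -/
abbrev quadExt (γ : GL (Fin 2) K) : Type _ :=
  AdjoinRoot γ.1.charpoly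

/-- The ring of integers of `K_γ`. -/
abbrev quadInt (γ : GL (Fin 2) K) : Subalgebra (𝓞 K) (quadExt γ) :=
  integralClosure (𝓞 K) (quadExt γ)

/-- The local algebra `K_v ⊗_K K_γ`. -/
abbrev localExt (γ : GL (Fin 2) K) (v : HeightOneSpectrum (𝓞 K)) : Type _ :=
  v.adicCompletion K ⊗[K] quadExt γ

/-- The local order `O_v[γ]` in `K_v ⊗_K K_γ`. -/
def localOrder (γ : GL (Fin 2) K) (v : HeightOneSpectrum (𝓞 K)) :
    Subalgebra (v.adicCompletionIntegers K) (localExt γ v) :=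
  Algebra.adjoin (v.adicCompletionIntegers K)
    {(1 : v.adicCompletion K) ⊗ₜ[K] AdjoinRoot.root γ.1.charpoly}

/-- The function `J̃` of the local order `O_v[γ]`. -/
def localJ (γ : GL (Fin 2) K) (v : HeightOneSpectrum (𝓞 K)) : ℂ → ℂ :=
  normalizedZeta (Ideal.absNorm v.asIdeal) (localOrder γ v)

/-- The product `O(s, γ, f)` of the functions `J̃` over all primes. -/
def globalJ (γ : GL (Fin 2) K) (s : ℂ) : ℂ :=
  ∏ᶠ v : HeightOneSpectrum (𝓞 K), localJ γ v s

/-- The relative discriminant of `K_γ / K`: the ideal generated by the discriminants of the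
`K`-bases of `K_γ` that consist of integral elements. -/
def relDiscr (γ : GL (Fin 2) K) : Ideal (𝓞 K) :=
  Ideal.span {d | ∃ b : Module.Basis (Fin 2) K (quadExt γ),
    (∀ i, IsIntegral (𝓞 K) (b i)) ∧ algebraMap (𝓞 K) K d = Algebra.discr K b}

/-- The discriminant of the element `γ` of `K_γ`, that is, of the family `1, γ`. -/
def elemDiscr (γ : GL (Fin 2) K) : K :=
  Algebra.discr K ![(1 : quadExt γ), AdjoinRoot.root γ.1.charpoly]

/-- `S² Disc(K_γ / K) = (Disc(γ))`, an equation of fractional ideals. -/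
def IsIndexIdeal (γ : GL (Fin 2) K) (S : Ideal (𝓞 K)) : Prop :=
  ((S ^ 2 * relDiscr γ : Ideal (𝓞 K)) : FractionalIdeal (nonZeroDivisors (𝓞 K)) K) =
    FractionalIdeal.spanSingleton (nonZeroDivisors (𝓞 K)) (elemDiscr γ)

/-- The ideal `S_γ` with `S_γ² = Disc(γ) / Disc(K_γ / K)`. -/
def indexIdeal (γ : GL (Fin 2) K) : Ideal (𝓞 K) :=
  Classical.epsilon (IsIndexIdeal γ)

open Classical in
/-- The quadratic character `χ_γ` of `K_γ / K` at a prime `v`: it is `1` if `v` splits (two primes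
lie over it), `-1` if `v` is inert (it generates a prime ideal), and `0` if `v` ramifies. -/
def quadChar (γ : GL (Fin 2) K) (v : HeightOneSpectrum (𝓞 K)) : ℤ :=
  if (v.asIdeal.primesOver (quadInt γ)).ncard = 2 then 1
  else if (v.asIdeal.map (algebraMap (𝓞 K) (quadInt γ))).IsPrime then -1
  else 0

/-- `∏_{p ∣ I} (1 - χ_γ(p) N(p)^(-s))`, over the prime divisors `p` of `I`. -/
def eulerProd (γ : GL (Fin 2) K) (I : Ideal (𝓞 K)) (s : ℂ) : ℂ :=
  ∏ᶠ (p : HeightOneSpectrum (𝓞 K)) (_ : p.asIdeal ∣ I),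
    (1 - (quadChar γ p : ℂ) * (Ideal.absNorm p.asIdeal : ℂ) ^ (-s))

/-- `N(S_γ)^s ∑_{d ∣ S_γ} N(d)^(1 - 2 s) ∏_{p ∣ d'} (1 - χ_γ(p) N(p)^(-s))` with `d d' = S_γ`; the sum
is written as a sum over the pairs `(d, d')`. -/
def divisorSum (γ : GL (Fin 2) K) (s : ℂ) : ℂ :=
  (Ideal.absNorm (indexIdeal γ) : ℂ) ^ s *
    ∑ᶠ (d : Ideal (𝓞 K) × Ideal (𝓞 K)) (_ : d.1 * d.2 = indexIdeal γ),
      (Ideal.absNorm d.1 : ℂ) ^ (1 - 2 * s) * eulerProd γ d.2 s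

end Global

end OrbitalGL2

end

open OrbitalGL2

set_option linter.unusedSectionVars false

namespace OrbitalGL2

/-! The statement is local at heart. Let π be a uniformizer of R = 𝓞_v, q the size of the residue
field, and R + Rθ the maximal order of E = K_v ⊗ K_γ. Put O_i = R + πⁱRθ. The fact that carries
everything is `QuadCoord.exists_eq_smul_order`: a lattice of E has the form z O_i, where i is unique
and z ∈ Eˣ is unique modulo O_iˣ (`QuadCoord.eq_of_smul_order_eq`). Indeed, dividing a lattice by an
element whose norm has least valuation gives a lattice that contains 1 and lies in R + Rθ, so it is
R + Jθ for an ideal J of R. With χ = r - 1, where r is the number of roots of the minimal polynomial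
of θ in the residue field, a count of points on the projective line gives [O_0ˣ : O_1ˣ] = q - χ, and
[O_iˣ : O_{i+1}ˣ] = q for i ≥ 1.

The classification is used twice. For the zeta function of O_n, the ideals of finite index are
π^(n-i) x O_i with i ≤ n and x ∈ O_i ∩ Eˣ, of index q^(n-i) times the index of x. If P_i denotes the
sum over the classes of x modulo O_iˣ, then P_0 = 1 / V(s), and since the non-units of O_{i+1} ∩ Eˣ
are the elements of π O_i, one has P_{i+1} = 1 + [O_iˣ : O_{i+1}ˣ] q^(-2s) P_i. Solving this
recursion (`sum_recursion_eq`) gives the explicit entire function `localFactor`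
(`QuadCoord.isNormalizedZeta_order`).

For the orbital integral, cosets of GL(2, R) are lattices and the centralizer of γ is Eˣ, so the
double cosets are numbered by i. The i-th one has volume [O_0ˣ : O_iˣ], and the integrand is 1 on it
exactly when γ ∈ O_i, that is i ≤ n for R[γ] = O_n. Hence the integral is the sum of these indices
over i ≤ n (`localOrbital_eq_sum`), which is the value of `localFactor` at s = 1.

To return to K, θ is chosen in K_γ as an integral element whose discriminant has the largest
absolute value at v. Then disc(γ) is the square of the θ-coordinate of γ times disc(θ), and disc(θ)
generates the relative discriminant at v, so n is the exponent of v in S_γ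
(`multiplicity_indexIdeal`); the roots in the residue field correspond to the decomposition of v, so
χ = χ_γ(v) (`quadChar_eq`). That γ contributes makes it integral at all v. The divisor sums factor
over the primes into the same local factors. The functional equation holds factor by factor, because
for n ≥ 1 `localFactor` is a combination of complete homogeneous polynomials in q^s and q^(1-s),
which are symmetric. -/

/-- Coordinates `x = re x + im x • θ` on a quadratic algebra `E` over the fraction field `F` of `R`,
such that the integral closure of `R` in `E` is `R + R θ`. -/
structure QuadCoord (R F E : Type*) [CommRing R] [Field F] [Algebra R F] [CommRing E] [Algebra F E]
    [Algebra R E] where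
  θ : E
  t : R
  m : R
  re : E →ₗ[F] F
  im : E →ₗ[F] F
  eq_add : ∀ x, algebraMap F E (re x) + im x • θ = x
  re_one : re 1 = 1
  im_one : im 1 = 0
  re_θ : re θ = 0
  im_θ : im θ = 1
  θ_mul : θ * θ = algebraMap R E t * θ - algebraMap R E m
  integral : ∀ x, IsIntegral R x →
    (∃ a, algebraMap R F a = re x) ∧ ∃ b, algebraMap R F b = im x

lemma isIntegral_of_quadratic {R E : Type*} [CommRing R] [CommRing E] [Algebra R E] {x : E}
    (T n : R) (h : x * x = algebraMap R E T * x - algebraMap R E n) : IsIntegral R x := by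
  nontriviality R
  refine ⟨Polynomial.X ^ 2 + (-Polynomial.C T * Polynomial.X + Polynomial.C n), ?_, ?_⟩
  · apply Polynomial.monic_X_pow_add
    compute_degree!
  · simp only [Polynomial.eval₂_add, Polynomial.eval₂_mul, Polynomial.eval₂_neg,
      Polynomial.eval₂_C, Polynomial.eval₂_X, Polynomial.eval₂_X_pow]
    rw [pow_two, h]; ring

/-! ### Quadratic algebras in coordinates: norm, orders, classification of lattices -/

namespace QuadCoord

variable {R F E : Type*} [CommRing R] [Field F] [Algebra R F]
  [CommRing E] [Algebra F E] [Algebra R E] [IsScalarTower R F E]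
  (c : QuadCoord R F E)

/-- The element `a + b θ`. -/
def elt (a b : F) : E := algebraMap F E a + b • c.θ

lemma re_algebraMap (a : F) : c.re (algebraMap F E a) = a := by
  rw [Algebra.algebraMap_eq_smul_one, map_smul, c.re_one, smul_eq_mul, mul_one]

lemma im_algebraMap (a : F) : c.im (algebraMap F E a) = 0 := by
  rw [Algebra.algebraMap_eq_smul_one, map_smul, c.im_one, smul_zero]

@[simp] lemma re_elt (a b : F) : c.re (c.elt a b) = a := by
  simp [elt, re_algebraMap, c.re_θ]

@[simp] lemma im_elt (a b : F) : c.im (c.elt a b) = b := by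
  simp [elt, im_algebraMap, c.im_θ]

@[simp] lemma elt_re_im (x : E) : c.elt (c.re x) (c.im x) = x := c.eq_add x

lemma ext_re_im {x y : E} (h : c.re x = c.re y) (h' : c.im x = c.im y) : x = y := by
  rw [← c.elt_re_im x, ← c.elt_re_im y, h, h']

lemma elt_mul_elt (a b a' b' : F) : c.elt a b * c.elt a' b' =
    c.elt (a * a' - b * b' * algebraMap R F c.m)
      (a * b' + b * a' + b * b' * algebraMap R F c.t) := by
  have h := c.θ_mul
  rw [IsScalarTower.algebraMap_apply R F E, IsScalarTower.algebraMap_apply R F E] at h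
  simp only [elt, Algebra.smul_def, map_sub, map_add, map_mul]
  linear_combination (algebraMap F E b * algebraMap F E b') * h

lemma re_mul (x y : E) : c.re (x * y) =
    c.re x * c.re y - c.im x * c.im y * algebraMap R F c.m := by
  conv_lhs => rw [← c.elt_re_im x, ← c.elt_re_im y, elt_mul_elt, re_elt]

lemma im_mul (x y : E) : c.im (x * y) =
    c.re x * c.im y + c.im x * c.re y + c.im x * c.im y * algebraMap R F c.t := by
  conv_lhs => rw [← c.elt_re_im x, ← c.elt_re_im y, elt_mul_elt, im_elt]

lemma re_algebraMap_R (a : R) : c.re (algebraMap R E a) = algebraMap R F a := by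
  rw [IsScalarTower.algebraMap_apply R F E, re_algebraMap]

lemma im_algebraMap_R (a : R) : c.im (algebraMap R E a) = 0 := by
  rw [IsScalarTower.algebraMap_apply R F E, im_algebraMap]

lemma re_algebraMap_mul (a : R) (x : E) :
    c.re (algebraMap R E a * x) = algebraMap R F a * c.re x := by
  simp [re_mul, re_algebraMap_R, im_algebraMap_R]

lemma im_algebraMap_mul (a : R) (x : E) :
    c.im (algebraMap R E a * x) = algebraMap R F a * c.im x := by
  simp [im_mul, re_algebraMap_R, im_algebraMap_R]

lemma smul_eq (a : R) (x : E) : a • x = algebraMap R E a * x := Algebra.smul_def a x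

/-- The norm form. -/
def norm (x : E) : F :=
  c.re x ^ 2 + algebraMap R F c.t * c.re x * c.im x + algebraMap R F c.m * c.im x ^ 2

/-- The conjugate of an element. -/
def conj (x : E) : E := c.elt (c.re x + algebraMap R F c.t * c.im x) (-c.im x)

lemma mul_conj (x : E) : x * c.conj x = algebraMap F E (c.norm x) := by
  apply c.ext_re_im
  · simp only [re_mul, conj, re_elt, im_elt, re_algebraMap, norm]; ring
  · simp only [im_mul, conj, re_elt, im_elt, im_algebraMap]; ring

@[simp] lemma norm_one : c.norm 1 = 1 := by simp [norm, c.re_one, c.im_one]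

lemma norm_mul (x y : E) : c.norm (x * y) = c.norm x * c.norm y := by
  simp only [norm, re_mul, im_mul]; ring

lemma norm_algebraMap_R (a : R) : c.norm (algebraMap R E a) = algebraMap R F a ^ 2 := by
  simp [norm, re_algebraMap_R, im_algebraMap_R]

lemma norm_units_ne_zero (x : Eˣ) : c.norm x ≠ 0 := by
  intro h
  have := c.norm_mul x (x⁻¹ : Eˣ)
  simp [h] at this

lemma isUnit_of_norm_ne_zero {x : E} (h : c.norm x ≠ 0) : IsUnit x := by
  refine IsUnit.of_mul_eq_one (c.conj x * algebraMap F E (c.norm x)⁻¹) ?_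
  rw [← mul_assoc, mul_conj, ← map_mul, mul_inv_cancel₀ h, map_one]

lemma mul_self_eq (x : E) : x * x =
    algebraMap F E (2 * c.re x + algebraMap R F c.t * c.im x) * x - algebraMap F E (c.norm x) := by
  apply c.ext_re_im
  · simp only [map_sub, re_mul, re_algebraMap, im_algebraMap, norm]; ring
  · simp only [map_sub, im_mul, re_algebraMap, im_algebraMap]; ring

lemma norm_one_add (x : E) : c.norm (1 + x) =
    1 + (2 * c.re x + algebraMap R F c.t * c.im x) + c.norm x := by
  simp only [norm, map_add, c.re_one, c.im_one]; ring

/-- The order `R + πⁱ (R + R θ)`. -/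
def order (π : R) (i : ℕ) : Subalgebra R E where
  carrier := {x | (∃ a, algebraMap R F a = c.re x) ∧ ∃ b, algebraMap R F (π ^ i * b) = c.im x}
  mul_mem' := by
    rintro x y ⟨⟨a, ha⟩, b, hb⟩ ⟨⟨a', ha'⟩, b', hb'⟩
    refine ⟨⟨a * a' - π ^ i * b * (π ^ i * b') * c.m, ?_⟩,
      a * b' + b * a' + b * (π ^ i * b') * c.t, ?_⟩
    · rw [re_mul, ← ha, ← ha', ← hb, ← hb']; simp only [map_mul, map_sub]
    · rw [im_mul, ← ha, ← ha', ← hb, ← hb']; simp only [map_mul, map_add]; ring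
  add_mem' := by
    rintro x y ⟨⟨a, ha⟩, b, hb⟩ ⟨⟨a', ha'⟩, b', hb'⟩
    refine ⟨⟨a + a', by rw [map_add, map_add, ha, ha']⟩, b + b', ?_⟩
    rw [mul_add, map_add, map_add, hb, hb']
  algebraMap_mem' r := ⟨⟨r, by rw [re_algebraMap_R]⟩, 0, by rw [im_algebraMap_R]; simp⟩

lemma mem_order {π : R} {i : ℕ} {x : E} : x ∈ c.order π i ↔
    (∃ a, algebraMap R F a = c.re x) ∧ ∃ b, algebraMap R F (π ^ i * b) = c.im x := Iff.rfl

lemma exists_of_mem_order {π : R} {i : ℕ} {x : E} (hx : x ∈ c.order π i) :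
    ∃ a b : R, x = c.elt (algebraMap R F a) (algebraMap R F (π ^ i * b)) := by
  obtain ⟨⟨a, ha⟩, b, hb⟩ := hx
  exact ⟨a, b, by rw [ha, hb, elt_re_im]⟩

lemma elt_mem_order {π : R} {i : ℕ} (a b : R) :
    c.elt (algebraMap R F a) (algebraMap R F (π ^ i * b)) ∈ c.order π i :=
  ⟨⟨a, by simp⟩, b, by simp⟩

lemma order_antitone (π : R) : Antitone (c.order π) := by
  rintro i j hij x ⟨ha, b, hb⟩
  exact ⟨ha, π ^ (j - i) * b, by rw [← mul_assoc, ← pow_add, Nat.add_sub_cancel' hij, hb]⟩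

lemma isIntegral_θ : IsIntegral R c.θ := isIntegral_of_quadratic _ _ c.θ_mul

/-- One inclusion is the integrality of `θ`, the other is the field `integral`: this is where `θ`
generates the maximal order. -/
lemma order_zero (π : R) : c.order π 0 = integralClosure R E := by
  ext x
  rw [mem_integralClosure_iff]
  constructor
  · intro hx
    obtain ⟨a, b, rfl⟩ := c.exists_of_mem_order hx
    rw [elt, ← IsScalarTower.algebraMap_apply, Algebra.smul_def, ← IsScalarTower.algebraMap_apply]
    exact (isIntegral_algebraMap).add ((isIntegral_algebraMap).mul c.isIntegral_θ)
  · intro hx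
    obtain ⟨ha, b, hb⟩ := c.integral x hx
    exact ⟨ha, b, by simpa using hb⟩

lemma mem_order_zero_iff (π : R) {x : E} : x ∈ c.order π 0 ↔ IsIntegral R x := by
  rw [order_zero, mem_integralClosure_iff]

lemma exists_norm_eq {π : R} {x : E} (hx : x ∈ c.order π 0) :
    ∃ n, algebraMap R F n = c.norm x := by
  obtain ⟨a, b, rfl⟩ := c.exists_of_mem_order hx
  exact ⟨a ^ 2 + c.t * a * (π ^ 0 * b) + c.m * (π ^ 0 * b) ^ 2, by simp [norm]⟩

/-- The trace of `x` equals N(1 + x) - 1 - N(x), so both coefficients of the quadratic equation of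
`x` are integral. A criterion by norms alone is what minimality of a norm can feed. -/
lemma mem_order_zero_of_norm (π : R) {x : E} (h : ∃ n, algebraMap R F n = c.norm x)
    (h' : ∃ n, algebraMap R F n = c.norm (1 + x)) : x ∈ c.order π 0 := by
  obtain ⟨n, hn⟩ := h
  obtain ⟨n', hn'⟩ := h'
  rw [norm_one_add, ← hn] at hn'
  rw [mem_order_zero_iff]
  apply isIntegral_of_quadratic (n' - 1 - n) n
  rw [mul_self_eq c x, ← hn, IsScalarTower.algebraMap_apply R F E,
    IsScalarTower.algebraMap_apply R F E, map_sub (algebraMap R F),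
    map_sub (algebraMap R F), map_one, hn']
  congr 3; ring

lemma conj_mem_order {π : R} {i : ℕ} {x : E} (hx : x ∈ c.order π i) : c.conj x ∈ c.order π i := by
  obtain ⟨a, b, rfl⟩ := c.exists_of_mem_order hx
  refine ⟨⟨a + c.t * (π ^ i * b), by simp [conj]⟩, -b, by simp [conj]⟩

variable [IsDomain R] [IsDiscreteValuationRing R] [IsFractionRing R F]

lemma pow_mul_θ_mem_order {π : R} (i : ℕ) : c.elt 0 (algebraMap R F (π ^ i)) ∈ c.order π i :=
  ⟨⟨0, by simp⟩, 1, by simp⟩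

lemma order_le_order_iff {π : R} (hπ : Irreducible π) {i j : ℕ} :
    c.order π i ≤ c.order π j ↔ j ≤ i := by
  refine ⟨fun h => ?_, fun h => c.order_antitone π h⟩
  obtain ⟨-, b, hb⟩ := h (c.pow_mul_θ_mem_order (π := π) i)
  rw [im_elt] at hb
  have := IsFractionRing.injective R F hb
  exact (pow_dvd_pow_iff hπ.ne_zero hπ.not_isUnit).mp ⟨b, this.symm⟩

lemma order_injective {π : R} (hπ : Irreducible π) : Function.Injective (c.order π) := by
  intro i j h
  exact le_antisymm ((c.order_le_order_iff hπ).mp h.ge) ((c.order_le_order_iff hπ).mp h.le)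

/-- A lattice in `E` is a multiple of exactly one of the orders `R + πⁱ (R + R θ)`. -/
theorem exists_eq_smul_order {π : R} (hπ : Irreducible π) (Λ : Submodule R E)
    (h₁ : ∃ n, ∀ x ∈ Λ, algebraMap R E (π ^ n) * x ∈ c.order π 0)
    (h₂ : ∃ n, ∀ x ∈ c.order π 0, algebraMap R E (π ^ n) * x ∈ Λ) :
    ∃ (z : Eˣ) (i : ℕ), ∀ y, y ∈ Λ ↔ ↑z⁻¹ * y ∈ c.order π i := by
  obtain ⟨n₁, h₁⟩ := h₁
  obtain ⟨n₂, h₂⟩ := h₂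
  have hinj := IsFractionRing.injective R F
  have hπF : ∀ n : ℕ, algebraMap R F (π ^ n) ≠ 0 := fun n =>
    (map_ne_zero_iff _ hinj).mpr (pow_ne_zero _ hπ.ne_zero)
  -- Norms on the lattice have bounded denominators; after scaling by π^(2 n₁) they lie in `R`,
  -- where a least valuation exists.
  have hf : ∀ x : Λ, ∃ n : R, algebraMap R F n = algebraMap R F (π ^ n₁) ^ 2 * c.norm x := by
    rintro ⟨x, hx⟩
    obtain ⟨n, hn⟩ := c.exists_norm_eq (h₁ x hx)
    exact ⟨n, by rw [hn, norm_mul, norm_algebraMap_R]⟩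
  choose f hf using hf
  have hne : {x : Λ | f x ≠ 0}.Nonempty := by
    refine ⟨⟨_, h₂ 1 (one_mem _)⟩, fun h => ?_⟩
    have := hf ⟨_, h₂ 1 (one_mem _)⟩
    rw [h, map_zero] at this
    simp only [mul_one, norm_algebraMap_R] at this
    exact mul_ne_zero (pow_ne_zero _ (hπF n₁)) (pow_ne_zero _ (hπF n₂)) this.symm
  -- The minimum is taken over elements of nonzero norm, so `x` is a unit of `E` even when `E` has
  -- zero divisors.
  obtain ⟨x, hx, hmin⟩ := WellFounded.has_min
    (InvImage.wf (fun x : Λ => IsDiscreteValuationRing.addVal R (f x)) wellFounded_lt) _ hne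
  have hdvd : ∀ y : Λ, f x ∣ f y := by
    intro y
    by_cases hy : f y = 0
    · rw [hy]; exact dvd_zero _
    · exact IsDiscreteValuationRing.addVal_le_iff_dvd.mp (not_lt.mp (hmin y hy))
  have hNx : c.norm x ≠ 0 := by
    intro h
    have := hf x
    rw [h, mul_zero, map_eq_zero_iff _ hinj] at this
    exact hx this
  obtain ⟨z, hz⟩ := c.isUnit_of_norm_ne_zero hNx
  have hzN : c.norm (z⁻¹ : Eˣ) * c.norm x = 1 := by
    rw [← hz, ← norm_mul, Units.inv_mul, norm_one]
  have hnorm : ∀ y ∈ Λ, ∃ n, algebraMap R F n = c.norm (↑z⁻¹ * y) := by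
    intro y hy
    obtain ⟨d, hd⟩ := hdvd ⟨y, hy⟩
    refine ⟨d, ?_⟩
    have h := hf ⟨y, hy⟩
    rw [hd, map_mul, hf x] at h
    have h' : c.norm x * algebraMap R F d = c.norm y :=
      mul_left_cancel₀ (pow_ne_zero 2 (hπF n₁)) (by rw [← mul_assoc]; exact h)
    rw [norm_mul, ← h', ← mul_assoc, hzN, one_mul]
  -- The lattice is closed under addition, so minimality also applies to `x + y` and makes the norm
  -- of 1 + z⁻¹y integral.
  have hint : ∀ y ∈ Λ, ↑z⁻¹ * y ∈ c.order π 0 := by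
    intro y hy
    refine c.mem_order_zero_of_norm π (hnorm y hy) ?_
    have := hnorm (x + y) (Λ.add_mem x.2 hy)
    rwa [mul_add, ← hz, Units.inv_mul] at this
  -- z⁻¹Λ contains `R` because `z ∈ Λ`, and it lies in R + Rθ, so it is determined by the ideal of
  -- possible coefficients of `θ`.
  let J : Ideal R :=
    { carrier := {b | ↑z * c.elt 0 (algebraMap R F b) ∈ Λ}
      add_mem' := by
        intro a b ha hb
        have := Λ.add_mem ha hb
        rw [← mul_add] at this
        have e : c.elt 0 (algebraMap R F (a + b)) =
            c.elt 0 (algebraMap R F a) + c.elt 0 (algebraMap R F b) := by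
          apply c.ext_re_im <;> simp
        rwa [← e] at this
      zero_mem' := by
        have : c.elt 0 (algebraMap R F 0) = 0 := by apply c.ext_re_im <;> simp
        rw [Set.mem_ofPred_eq, this, mul_zero]
        exact Λ.zero_mem
      smul_mem' := by
        intro a b hb
        have := Λ.smul_mem a hb
        rw [smul_eq, mul_left_comm] at this
        have e : c.elt 0 (algebraMap R F (a * b)) =
            algebraMap R E a * c.elt 0 (algebraMap R F b) := by
          apply c.ext_re_im <;> simp [re_algebraMap_mul, im_algebraMap_mul]
        rwa [← e] at this }
  have hJ : ∀ b, b ∈ J ↔ ↑z * c.elt 0 (algebraMap R F b) ∈ Λ := fun b => Iff.rfl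
  have hR : ∀ a : R, ↑z * algebraMap R E a ∈ Λ := by
    intro a
    rw [mul_comm, ← smul_eq, hz]
    exact Λ.smul_mem a x.2
  have hmem : ∀ a b : R, ↑z * c.elt (algebraMap R F a) (algebraMap R F b) ∈ Λ ↔ b ∈ J := by
    intro a b
    have : c.elt (algebraMap R F a) (algebraMap R F b) =
        algebraMap R E a + c.elt 0 (algebraMap R F b) := by
      apply c.ext_re_im <;> simp [re_algebraMap_R, im_algebraMap_R]
    rw [this, mul_add, hJ]
    exact Λ.add_mem_iff_right (hR a)
  -- π^n₁ z θ is integral, so a further factor π^n₂ moves it into the lattice.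
  have hJ0 : J ≠ ⊥ := by
    intro h0
    have h3 := h₂ (algebraMap R E (π ^ n₁) * (↑z * c.θ)) (by
      rw [← mul_assoc, hz]
      exact mul_mem (h₁ _ x.2) ((c.mem_order_zero_iff π).mpr c.isIntegral_θ))
    have : (π ^ n₂ * π ^ n₁) ∈ J := by
      rw [hJ]
      convert h3 using 1
      rw [mul_left_comm _ (z : E), mul_left_comm _ (z : E)]
      congr 1
      apply c.ext_re_im <;>
        simp only [re_algebraMap_mul, im_algebraMap_mul, c.re_θ, c.im_θ, re_elt, im_elt, map_mul,
          mul_zero, mul_one]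
    rw [h0, Ideal.mem_bot] at this
    exact mul_ne_zero (pow_ne_zero _ hπ.ne_zero) (pow_ne_zero _ hπ.ne_zero) this
  obtain ⟨i, hi⟩ := IsDiscreteValuationRing.ideal_eq_span_pow_irreducible hJ0 hπ
  refine ⟨z, i, fun y => ?_⟩
  constructor
  · intro hy
    obtain ⟨⟨a, ha⟩, b, hb⟩ := hint y hy
    rw [pow_zero, one_mul] at hb
    have hy' : b ∈ J := by
      rw [← hmem a, ha, hb, elt_re_im, ← mul_assoc, Units.mul_inv, one_mul]
      exact hy
    rw [hi, Ideal.mem_span_singleton] at hy'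
    obtain ⟨d, rfl⟩ := hy'
    exact ⟨⟨a, ha⟩, d, hb⟩
  · intro hy
    obtain ⟨a, b, hab⟩ := c.exists_of_mem_order hy
    have : ↑z * c.elt (algebraMap R F a) (algebraMap R F (π ^ i * b)) ∈ Λ := by
      rw [hmem, hi, Ideal.mem_span_singleton]
      exact dvd_mul_right _ _
    rwa [← hab, ← mul_assoc, Units.mul_inv, one_mul] at this

/-- The unit group of the order `R + πⁱ (R + R θ)`, as a subgroup of `Eˣ`. -/
def unitGroup (π : R) (i : ℕ) : Subgroup Eˣ where
  carrier := {u | (u : E) ∈ c.order π i ∧ ((u⁻¹ : Eˣ) : E) ∈ c.order π i}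
  mul_mem' := by
    rintro a b ⟨ha, ha'⟩ ⟨hb, hb'⟩
    refine ⟨mul_mem ha hb, ?_⟩
    rw [mul_inv]
    exact mul_mem ha' hb'
  one_mem' := by simp
  inv_mem' := by rintro a ⟨ha, ha'⟩; exact ⟨ha', by simpa using ha⟩

lemma mem_unitGroup {π : R} {i : ℕ} {u : Eˣ} : u ∈ c.unitGroup π i ↔
    (u : E) ∈ c.order π i ∧ ((u⁻¹ : Eˣ) : E) ∈ c.order π i := Iff.rfl

lemma unitGroup_antitone (π : R) : Antitone (c.unitGroup π) := fun _ _ h _ hu =>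
  ⟨c.order_antitone π h hu.1, c.order_antitone π h hu.2⟩

/-- Two multiples `z O_i` and `w O_j` coincide only if `i = j` and `z⁻¹ w` is a unit of `O_i`. -/
lemma eq_of_smul_order_eq {π : R} (hπ : Irreducible π) {i j : ℕ} {z w : Eˣ}
    (h : ∀ y : E, ↑z⁻¹ * y ∈ c.order π i ↔ ↑w⁻¹ * y ∈ c.order π j) :
    i = j ∧ z⁻¹ * w ∈ c.unitGroup π i := by
  -- The order is recovered from the lattice as its ring of multipliers.
  have key : ∀ (k : ℕ) (v : Eˣ) (x : E), x ∈ c.order π k ↔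
      ∀ y : E, ↑v⁻¹ * y ∈ c.order π k → ↑v⁻¹ * (x * y) ∈ c.order π k := by
    intro k v x
    constructor
    · intro hx y hy
      rw [mul_left_comm]
      exact mul_mem hx hy
    · intro hx
      have := hx v (by simp)
      simpa [mul_left_comm] using this
  have hij : c.order π i = c.order π j := by
    ext x
    rw [key i z, key j w]
    simp_rw [h]
  have hij := c.order_injective hπ hij
  subst hij
  refine ⟨rfl, ?_, ?_⟩
  · have := (h w).mpr (by simp)
    simpa using this
  · have := (h z).mp (by simp)
    simpa using this

lemma smul_order_eq_iff {π : R} (hπ : Irreducible π) {i : ℕ} {z w : Eˣ} :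
    (∀ y : E, ↑z⁻¹ * y ∈ c.order π i ↔ ↑w⁻¹ * y ∈ c.order π i) ↔
      z⁻¹ * w ∈ c.unitGroup π i := by
  refine ⟨fun h => (c.eq_of_smul_order_eq hπ h).2, fun h y => ?_⟩
  obtain ⟨h1, h2⟩ := h
  simp only [_root_.mul_inv_rev, inv_inv, Units.val_mul] at h1 h2
  constructor
  · intro hy
    have := mul_mem h2 hy
    rwa [← mul_assoc, mul_assoc _ (z : E), Units.mul_inv, mul_one] at this
  · intro hy
    have := mul_mem h1 hy
    rwa [← mul_assoc, mul_assoc _ (w : E), Units.mul_inv, mul_one] at this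

end QuadCoord

/-! ### Indices of the unit groups -/

/-- Indices are computed by counting the values of an invariant that separates the cosets. No
finiteness is required, since both sides are 0 in the infinite case. -/
lemma index_eq_card_range {G X : Type*} [Group G] (H : Subgroup G) (f : G → X)
    (hf : ∀ x y, f x = f y ↔ x⁻¹ * y ∈ H) : H.index = Nat.card (Set.range f) := by
  refine Nat.card_congr (Equiv.ofBijective
    (Quotient.lift (fun x => (⟨f x, x, rfl⟩ : Set.range f)) ?_) ⟨?_, ?_⟩)
  · intro x y hxy
    exact Subtype.ext ((hf x y).mpr (QuotientGroup.leftRel_apply.mp hxy))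
  · rintro ⟨x⟩ ⟨y⟩ hxy
    exact Quotient.sound (QuotientGroup.leftRel_apply.mpr ((hf x y).mp (congrArg Subtype.val hxy)))
  · rintro ⟨-, x, rfl⟩
    exact ⟨Quotient.mk _ x, rfl⟩

lemma addIndex_eq_card_range {G X : Type*} [AddGroup G] (H : AddSubgroup G) (f : G → X)
    (hf : ∀ x y, f x = f y ↔ -x + y ∈ H) : H.index = Nat.card (Set.range f) := by
  refine Nat.card_congr (Equiv.ofBijective
    (Quotient.lift (fun x => (⟨f x, x, rfl⟩ : Set.range f)) ?_) ⟨?_, ?_⟩)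
  · intro x y hxy
    exact Subtype.ext ((hf x y).mpr (QuotientAddGroup.leftRel_apply.mp hxy))
  · rintro ⟨x⟩ ⟨y⟩ hxy
    exact Quotient.sound
      (QuotientAddGroup.leftRel_apply.mpr ((hf x y).mp (congrArg Subtype.val hxy)))
  · rintro ⟨-, x, rfl⟩
    exact ⟨Quotient.mk _ x, rfl⟩

lemma addRelIndex_eq_card_range {G X : Type*} [AddGroup G] (H A : AddSubgroup G) (f : G → X)
    (hf : ∀ x ∈ A, ∀ y ∈ A, f x = f y ↔ -x + y ∈ H) :
    H.relIndex A = Nat.card (f '' (A : Set G)) := by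
  rw [AddSubgroup.relIndex, addIndex_eq_card_range _ (fun x : A => f x)]
  · congr 1
    rw [Set.image_eq_range]
    rfl
  · rintro ⟨x, hx⟩ ⟨y, hy⟩
    rw [AddSubgroup.mem_addSubgroupOf]
    exact hf x hx y hy

lemma relIndex_eq_card_range {G X : Type*} [Group G] (H A : Subgroup G) (f : G → X)
    (hf : ∀ x ∈ A, ∀ y ∈ A, f x = f y ↔ x⁻¹ * y ∈ H) :
    H.relIndex A = Nat.card (f '' (A : Set G)) := by
  rw [Subgroup.relIndex, index_eq_card_range _ (fun x : A => f x)]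
  · congr 1
    rw [Set.image_eq_range]
    rfl
  · rintro ⟨x, hx⟩ ⟨y, hy⟩
    rw [Subgroup.mem_subgroupOf]
    exact hf x hx y hy

lemma residue_eq_zero_iff_dvd {R : Type*} [CommRing R] [IsDomain R] [IsDiscreteValuationRing R]
    {π : R} (hπ : Irreducible π) {a : R} : IsLocalRing.residue R a = 0 ↔ π ∣ a := by
  rw [IsLocalRing.residue_eq_zero_iff, hπ.maximalIdeal_eq, Ideal.mem_span_singleton]

lemma residue_eq_iff_dvd {R : Type*} [CommRing R] [IsDomain R] [IsDiscreteValuationRing R]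
    {π : R} (hπ : Irreducible π) {a b : R} :
    IsLocalRing.residue R a = IsLocalRing.residue R b ↔ π ∣ a - b := by
  rw [← residue_eq_zero_iff_dvd hπ, map_sub, sub_eq_zero]

namespace QuadCoord

variable {R F E : Type*} [CommRing R] [Field F] [Algebra R F]
  [CommRing E] [Algebra F E] [Algebra R E] [IsScalarTower R F E]
  (c : QuadCoord R F E)
variable [IsDomain R] [IsDiscreteValuationRing R] [IsFractionRing R F]

/-- The integral first coordinate of `x`. -/
noncomputable def intRe (x : E) : R := Function.invFun (algebraMap R F) (c.re x)

/-- The integral second coordinate of `x` in the basis `1, πⁱ θ`. -/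
noncomputable def intIm (π : R) (i : ℕ) (x : E) : R :=
  Function.invFun (fun b => algebraMap R F (π ^ i * b)) (c.im x)

lemma algebraMap_intRe {π : R} {i : ℕ} {x : E} (hx : x ∈ c.order π i) :
    algebraMap R F (c.intRe x) = c.re x := Function.invFun_eq hx.1

lemma algebraMap_intIm {π : R} {i : ℕ} {x : E} (hx : x ∈ c.order π i) :
    algebraMap R F (π ^ i * c.intIm π i x) = c.im x :=
  Function.invFun_eq (f := fun b => algebraMap R F (π ^ i * b)) hx.2

lemma intRe_elt (a : R) (b : F) : c.intRe (c.elt (algebraMap R F a) b) = a := by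
  rw [intRe, re_elt]
  exact Function.leftInverse_invFun (IsFractionRing.injective R F) a

lemma intIm_elt {π : R} (hπ : Irreducible π) (i : ℕ) (a : F) (b : R) :
    c.intIm π i (c.elt a (algebraMap R F (π ^ i * b))) = b := by
  rw [intIm, im_elt]
  refine Function.leftInverse_invFun (f := fun b => algebraMap R F (π ^ i * b)) ?_ b
  intro x y h
  exact mul_left_cancel₀ (pow_ne_zero _ hπ.ne_zero) (IsFractionRing.injective R F h)

lemma eq_elt {π : R} {i : ℕ} {x : E} (hx : x ∈ c.order π i) :
    x = c.elt (algebraMap R F (c.intRe x)) (algebraMap R F (π ^ i * c.intIm π i x)) := by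
  rw [c.algebraMap_intRe hx, c.algebraMap_intIm hx, elt_re_im]

/-- The norm form on `R²` belonging to the order `R + πⁱ (R + R θ)`. -/
lemma norm_eq {π : R} {i : ℕ} {x : E} (hx : x ∈ c.order π i) :
    c.norm x = algebraMap R F (c.intRe x ^ 2 + c.t * c.intRe x * (π ^ i * c.intIm π i x) +
      c.m * (π ^ i * c.intIm π i x) ^ 2) := by
  conv_lhs => rw [c.eq_elt hx]
  simp [norm]

lemma mem_unitGroup_of_norm {π : R} {i : ℕ} {u : Eˣ} (hu : (u : E) ∈ c.order π i) {n : R}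
    (hn : IsUnit n) (h : algebraMap R F n = c.norm u) : u ∈ c.unitGroup π i := by
  refine ⟨hu, ?_⟩
  obtain ⟨n, rfl⟩ := hn
  have : ((u⁻¹ : Eˣ) : E) = algebraMap R E (n⁻¹ : Rˣ) * c.conj u := by
    rw [Units.inv_eq_of_mul_eq_one_right]
    rw [mul_left_comm, mul_conj, ← h, ← IsScalarTower.algebraMap_apply, ← map_mul, Units.inv_mul,
      map_one]
  rw [this]
  exact mul_mem (Subalgebra.algebraMap_mem _ _) (c.conj_mem_order hu)

lemma isUnit_norm_of_mem_unitGroup {π : R} {i : ℕ} {u : Eˣ} (hu : u ∈ c.unitGroup π i) {n : R}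
    (h : algebraMap R F n = c.norm u) : IsUnit n := by
  obtain ⟨n', hn'⟩ := c.exists_norm_eq (c.order_antitone π (Nat.zero_le i) hu.2)
  refine IsUnit.of_mul_eq_one n' (IsFractionRing.injective R F ?_)
  rw [map_mul, h, hn', ← norm_mul, Units.mul_inv, norm_one, map_one]

/-- The norm of `x` is a unit, so x⁻¹ is a unit multiple of the conjugate. As x⁻¹y is already a unit
of O_i, only its second coordinate can obstruct membership in O_j. -/
lemma inv_mul_mem_unitGroup_iff {π : R} {i j : ℕ} {x y : Eˣ} (hx : x ∈ c.unitGroup π i)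
    (hy : y ∈ c.unitGroup π i) : x⁻¹ * y ∈ c.unitGroup π j ↔
      ∃ d, algebraMap R F (π ^ j * d) = c.im (c.conj x * y) := by
  obtain ⟨n, hn⟩ := c.exists_norm_eq (c.order_antitone π (Nat.zero_le i) hx.1)
  have hnu := c.isUnit_norm_of_mem_unitGroup hx hn
  have hxy := mul_mem (inv_mem hx) hy
  obtain ⟨n', hn'⟩ := c.exists_norm_eq (c.order_antitone π (Nat.zero_le i) hxy.1)
  have hnu' := c.isUnit_norm_of_mem_unitGroup hxy hn'
  obtain ⟨n, rfl⟩ := hnu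
  have hxinv : ((x⁻¹ : Eˣ) : E) = algebraMap R E (n⁻¹ : Rˣ) * c.conj x := by
    rw [Units.inv_eq_of_mul_eq_one_right]
    rw [mul_left_comm, mul_conj, ← hn, ← IsScalarTower.algebraMap_apply, ← map_mul, Units.inv_mul,
      map_one]
  have him : c.im (x⁻¹ * y : Eˣ) = algebraMap R F (n⁻¹ : Rˣ) * c.im (c.conj x * y) := by
    rw [Units.val_mul, hxinv, mul_assoc, im_algebraMap_mul]
  constructor
  · rintro ⟨⟨-, b, hb⟩, -⟩
    refine ⟨n * b, ?_⟩
    rw [mul_left_comm, map_mul, hb, him, ← mul_assoc, ← map_mul, Units.mul_inv, map_one, one_mul]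
  · rintro ⟨d, hd⟩
    refine c.mem_unitGroup_of_norm ⟨hxy.1.1, (n⁻¹ : Rˣ) * d, ?_⟩ hnu' hn'
    rw [him, ← hd, ← map_mul]
    congr 1; ring

lemma im_conj_mul {π : R} {i : ℕ} {x y : E} (hx : x ∈ c.order π i) (hy : y ∈ c.order π i) :
    c.im (c.conj x * y) = algebraMap R F
      (π ^ i * (c.intRe x * c.intIm π i y - c.intIm π i x * c.intRe y)) := by
  conv_lhs => rw [c.eq_elt hx, c.eq_elt hy]
  simp only [conj, im_mul, re_elt, im_elt, map_mul, map_sub]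
  ring

/-- The coset of a unit is recorded by the point (re : im) of the projective line over the residue
field; the condition is the vanishing of a 2 × 2 determinant. -/
lemma inv_mul_mem_unitGroup_succ_iff {π : R} (hπ : Irreducible π) {i : ℕ} {x y : Eˣ}
    (hx : x ∈ c.unitGroup π i) (hy : y ∈ c.unitGroup π i) :
    x⁻¹ * y ∈ c.unitGroup π (i + 1) ↔
      IsLocalRing.residue R (c.intRe x) * IsLocalRing.residue R (c.intIm π i y) =
        IsLocalRing.residue R (c.intIm π i x) * IsLocalRing.residue R (c.intRe y) := by
  rw [c.inv_mul_mem_unitGroup_iff hx hy, c.im_conj_mul hx.1 hy.1,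
    ← map_mul, ← map_mul, residue_eq_iff_dvd hπ]
  constructor
  · rintro ⟨d, hd⟩
    have := IsFractionRing.injective R F hd
    rw [pow_succ, mul_assoc] at this
    exact ⟨d, (mul_left_cancel₀ (pow_ne_zero _ hπ.ne_zero) this).symm⟩
  · rintro ⟨d, hd⟩
    exact ⟨d, by rw [hd, pow_succ, mul_assoc]⟩

/-- For i ≥ 1 the norm is congruent to the square of the first coordinate modulo π. -/
lemma isUnit_intRe {π : R} (hπ : Irreducible π) {i : ℕ} (hi : i ≠ 0) {x : Eˣ}
    (hx : x ∈ c.unitGroup π i) : IsUnit (c.intRe x) := by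
  have h := c.isUnit_norm_of_mem_unitGroup hx (c.norm_eq hx.1).symm
  by_contra hn
  have h1 : π ∣ c.intRe x := by
    rw [← residue_eq_zero_iff_dvd hπ, IsLocalRing.residue_eq_zero_iff]
    exact hn
  have h2 : π ∣ π ^ i := dvd_pow_self _ hi
  refine hπ.not_isUnit (isUnit_of_dvd_unit ?_ h)
  refine dvd_add (dvd_add ?_ ?_) ?_
  · exact dvd_pow h1 two_ne_zero
  · exact Dvd.dvd.mul_right (Dvd.dvd.mul_left h1 _) _
  · exact Dvd.dvd.mul_left (dvd_pow (h2.mul_right _) two_ne_zero) _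

/-- An element of `Eˣ` from integral coordinates with unit norm. -/
lemma exists_mem_unitGroup {π : R} (hπ : Irreducible π) {i : ℕ} (a b : R)
    (h : IsUnit (a ^ 2 + c.t * a * (π ^ i * b) + c.m * (π ^ i * b) ^ 2)) :
    ∃ x ∈ c.unitGroup π i, c.intRe (x : E) = a ∧ c.intIm π i (x : E) = b := by
  have hm := c.elt_mem_order (π := π) (i := i) a b
  have hN := c.norm_eq hm
  rw [intRe_elt, c.intIm_elt hπ] at hN
  obtain ⟨u, hu⟩ := c.isUnit_of_norm_ne_zero (x := c.elt (algebraMap R F a)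
    (algebraMap R F (π ^ i * b))) (by
      rw [hN]
      exact (map_ne_zero_iff _ (IsFractionRing.injective R F)).mpr h.ne_zero)
  refine ⟨u, c.mem_unitGroup_of_norm (hu ▸ hm) h (by rw [hu, hN]), ?_, ?_⟩
  · rw [hu, intRe_elt]
  · rw [hu, c.intIm_elt hπ]

/-- Every point of the projective line with nonzero first coordinate occurs, and no other, so im /
re runs through the residue field. -/
lemma relIndex_unitGroup_succ {π : R} (hπ : Irreducible π) {i : ℕ} (hi : i ≠ 0) :
    (c.unitGroup π (i + 1)).relIndex (c.unitGroup π i) =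
      Nat.card (IsLocalRing.ResidueField R) := by
  rw [relIndex_eq_card_range _ _ (fun x : Eˣ => IsLocalRing.residue R (c.intIm π i x) /
    IsLocalRing.residue R (c.intRe x))]
  · rw [← Nat.card_univ (α := IsLocalRing.ResidueField R)]
    congr 2
    rw [Set.eq_univ_iff_forall]
    intro s
    obtain ⟨b, rfl⟩ := IsLocalRing.residue_surjective s
    obtain ⟨x, hx, h1, h2⟩ := c.exists_mem_unitGroup (i := i) hπ 1 b (by
      have h : π ∣ c.t * 1 * (π ^ i * b) + c.m * (π ^ i * b) ^ 2 := by
        have h2 : π ∣ π ^ i * b := (dvd_pow_self _ hi).mul_right _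
        exact dvd_add (h2.mul_left _) (Dvd.dvd.mul_left (dvd_pow h2 two_ne_zero) _)
      rw [← residue_eq_zero_iff_dvd hπ] at h
      rw [← IsLocalRing.residue_ne_zero_iff_isUnit, one_pow, add_assoc, map_add, h]
      simp)
    exact ⟨x, hx, by simp only [h1, h2, map_one, div_one]⟩
  · intro x hx y hy
    rw [c.inv_mul_mem_unitGroup_succ_iff hπ hx hy]
    have h1 := (IsLocalRing.residue_ne_zero_iff_isUnit _).mpr (c.isUnit_intRe hπ hi hx)
    have h2 := (IsLocalRing.residue_ne_zero_iff_isUnit _).mpr (c.isUnit_intRe hπ hi hy)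
    rw [div_eq_div_iff h1 h2, eq_comm, mul_comm (IsLocalRing.residue R (c.intIm π i y))]

/-- The roots of `X² - t X + m` in the residue field. -/
def residueRoots : Set (IsLocalRing.ResidueField R) :=
  {s | s ^ 2 - IsLocalRing.residue R c.t * s + IsLocalRing.residue R c.m = 0}

-- The units of O_0 reduce to the points of the projective line at which the norm form does not
-- vanish. In the coordinate -re / im the zeros of the form are the residue roots; the point at
-- infinity (`none`) is never a zero, as the form is re² there. The equation is additive to avoid
-- truncated subtraction.
open Classical in
lemma relIndex_unitGroup_one [Finite (IsLocalRing.ResidueField R)] {π : R} (hπ : Irreducible π) :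
    (c.unitGroup π 1).relIndex (c.unitGroup π 0) + c.residueRoots.ncard =
      Nat.card (IsLocalRing.ResidueField R) + 1 := by
  rw [relIndex_eq_card_range _ _ (fun x : Eˣ =>
    if IsLocalRing.residue R (c.intIm π 0 x) = 0 then none else
      some (-IsLocalRing.residue R (c.intRe x) / IsLocalRing.residue R (c.intIm π 0 x)))]
  · have : (fun x : Eˣ =>
      if IsLocalRing.residue R (c.intIm π 0 x) = 0 then none else
      some (-IsLocalRing.residue R (c.intRe x) / IsLocalRing.residue R (c.intIm π 0 x))) ''
        (c.unitGroup π 0 : Set Eˣ) = (some '' c.residueRoots)ᶜ := by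
      ext s
      constructor
      · rintro ⟨x, hx, rfl⟩ ⟨y, hy, hxy⟩
        dsimp only at hxy
        split_ifs at hxy with h
        have hy' := Option.some_injective _ hxy
        rw [hy'] at hy
        have hN := c.isUnit_norm_of_mem_unitGroup hx (c.norm_eq hx.1).symm
        rw [← IsLocalRing.residue_ne_zero_iff_isUnit] at hN
        apply hN
        simp only [residueRoots, Set.mem_ofPred_eq] at hy
        simp only [pow_zero, one_mul, map_add, map_mul, map_pow]
        field_simp at hy
        linear_combination hy
      · intro hs
        rcases s with - | s
        · exact ⟨1, one_mem _, by
            have : c.intIm π 0 ((1 : Eˣ) : E) = 0 := by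
              have h := c.intIm_elt hπ 0 1 0
              have h1 : c.elt 1 (algebraMap R F (π ^ 0 * 0)) = 1 := by simp [elt]
              rwa [h1] at h
            simp only [this, map_zero, if_true]⟩
        · obtain ⟨a, rfl⟩ := IsLocalRing.residue_surjective s
          obtain ⟨x, hx, h1, h2⟩ := c.exists_mem_unitGroup (i := 0) hπ (-a) 1 (by
            rw [← IsLocalRing.residue_ne_zero_iff_isUnit]
            intro h
            refine hs ⟨_, ?_, rfl⟩
            simp only [residueRoots, Set.mem_ofPred_eq, ← map_mul, ← map_pow, ← map_add,
              ← map_sub]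
            rw [← h]
            congr 1; ring)
          refine ⟨x, hx, ?_⟩
          simp [h1, h2]
    rw [this]
    have h := Set.ncard_add_ncard_compl (some '' c.residueRoots)
    rw [Set.ncard_image_of_injective _ (Option.some_injective _), Finite.card_option] at h
    rw [← h, add_comm, Nat.card_coe_set_eq]
  · intro x hx y hy
    rw [c.inv_mul_mem_unitGroup_succ_iff hπ hx hy]
    have key : ∀ z : Eˣ, z ∈ c.unitGroup π 0 → IsLocalRing.residue R (c.intIm π 0 z) = 0 →
        IsLocalRing.residue R (c.intRe z) ≠ 0 := by
      intro z hz h0 h1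
      have hN := c.isUnit_norm_of_mem_unitGroup hz (c.norm_eq hz.1).symm
      rw [← IsLocalRing.residue_ne_zero_iff_isUnit] at hN
      apply hN
      simp [h0, h1]
    split_ifs with h1 h2 h2
    · simp [h1, h2]
    · simp [h1, h2, key x hx h1]
    · simp [h1, h2, key y hy h2]
    · rw [Option.some_inj, div_eq_div_iff h1 h2, neg_mul, neg_mul, neg_inj,
        mul_comm (IsLocalRing.residue R (c.intRe y))]

end QuadCoord

/-! ### Indices of orders and of principal multiples -/

/-- The additive group `x H`. -/
def mulMap {E : Type*} [CommRing E] (x : E) (H : AddSubgroup E) : AddSubgroup E :=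
  H.map (AddMonoidHom.mulLeft x)

section mulMap

variable {E : Type*} [CommRing E]

lemma mem_mulMap {x : E} {H : AddSubgroup E} {y : E} : y ∈ mulMap x H ↔ ∃ h ∈ H, x * h = y :=
  Iff.rfl

lemma mem_mulMap_unit {x : Eˣ} {H : AddSubgroup E} {y : E} :
    y ∈ mulMap (x : E) H ↔ ↑x⁻¹ * y ∈ H := by
  rw [mem_mulMap]
  constructor
  · rintro ⟨h, hh, rfl⟩
    simpa using hh
  · intro h
    exact ⟨_, h, by simp⟩

lemma mulMap_mul (x y : E) (H : AddSubgroup E) : mulMap (x * y) H = mulMap x (mulMap y H) := by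
  ext z
  simp only [mem_mulMap]
  constructor
  · rintro ⟨h, hh, rfl⟩
    exact ⟨y * h, ⟨h, hh, rfl⟩, by ring⟩
  · rintro ⟨-, ⟨h, hh, rfl⟩, rfl⟩
    exact ⟨h, hh, by ring⟩

lemma mulMap_mono (x : E) {H K : AddSubgroup E} (h : H ≤ K) : mulMap x H ≤ mulMap x K :=
  AddSubgroup.map_mono h

lemma relIndex_mulMap (x : Eˣ) (H K : AddSubgroup E) :
    (mulMap (x : E) H).relIndex (mulMap (x : E) K) = H.relIndex K :=
  AddSubgroup.relIndex_map_map_of_injective H K (x.isUnit.mul_right_injective)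

end mulMap

namespace QuadCoord

variable {R F E : Type*} [CommRing R] [Field F] [Algebra R F]
  [CommRing E] [Algebra F E] [Algebra R E] [IsScalarTower R F E]
  (c : QuadCoord R F E)
variable [IsDomain R] [IsDiscreteValuationRing R] [IsFractionRing R F]

/-- The additive group of the order `R + πⁱ (R + R θ)`. -/
def addOrder (π : R) (i : ℕ) : AddSubgroup E := (Subalgebra.toSubmodule (c.order π i)).toAddSubgroup

lemma mem_addOrder {π : R} {i : ℕ} {x : E} : x ∈ c.addOrder π i ↔ x ∈ c.order π i := Iff.rfl

lemma addOrder_antitone (π : R) : Antitone (c.addOrder π) := fun _ _ h _ hx =>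
  c.order_antitone π h hx

lemma mulMap_addOrder_le {π : R} {i : ℕ} {x : E} (hx : x ∈ c.order π i) :
    mulMap x (c.addOrder π i) ≤ c.addOrder π i := by
  rintro _ ⟨y, hy, rfl⟩
  exact (c.order π i).mul_mem hx hy

lemma algebraMap_ne_zero {π : R} (hπ : Irreducible π) : algebraMap R F π ≠ 0 :=
  (map_ne_zero_iff _ (IsFractionRing.injective R F)).mpr hπ.ne_zero

lemma isUnit_algebraMap (R F E : Type*) [CommRing R] [Field F] [Algebra R F] [CommRing E]
    [Algebra F E] [Algebra R E] [IsScalarTower R F E] [IsDomain R] [IsDiscreteValuationRing R]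
    [IsFractionRing R F] {π : R} (hπ : Irreducible π) : IsUnit (algebraMap R E π) := by
  rw [IsScalarTower.algebraMap_apply R F E]
  exact (IsUnit.mk0 _ (algebraMap_ne_zero hπ)).map _

variable (F E) in
/-- The uniformizer as a unit of `E`. -/
noncomputable def unif {π : R} (hπ : Irreducible π) : Eˣ := (isUnit_algebraMap R F E hπ).unit

@[simp] lemma coe_unif {π : R} (hπ : Irreducible π) : (unif F E hπ : E) = algebraMap R E π := rfl

/-- The condition on the first coordinate cannot be dropped: π O_i is a proper subgroup of O_{i+1},
cut out by divisibility of the first coordinate by π. -/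
lemma unif_mul_mem_order_iff {π : R} (hπ : Irreducible π) {i : ℕ} {x : E} :
    algebraMap R E π * x ∈ c.order π (i + 1) ∧ (∃ a, algebraMap R F a = c.re x) ↔
      x ∈ c.order π i := by
  have h0 := algebraMap_ne_zero (F := F) hπ
  constructor
  · rintro ⟨⟨-, b, hb⟩, ha⟩
    refine ⟨ha, b, ?_⟩
    rw [im_algebraMap_mul, pow_succ', mul_assoc, map_mul] at hb
    exact mul_left_cancel₀ h0 hb
  · rintro ⟨⟨a, ha⟩, b, hb⟩
    refine ⟨⟨⟨π * a, by rw [re_algebraMap_mul, map_mul, ha]⟩, b, ?_⟩, a, ha⟩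
    rw [im_algebraMap_mul, ← hb, ← map_mul, pow_succ', mul_assoc]

lemma relIndex_addOrder_succ {π : R} (hπ : Irreducible π) (i : ℕ) :
    (c.addOrder π (i + 1)).relIndex (c.addOrder π i) = Nat.card (IsLocalRing.ResidueField R) := by
  rw [addRelIndex_eq_card_range _ _ (fun x : E => IsLocalRing.residue R (c.intIm π i x))]
  · rw [← Nat.card_univ (α := IsLocalRing.ResidueField R)]
    congr 2
    rw [Set.eq_univ_iff_forall]
    intro s
    obtain ⟨b, rfl⟩ := IsLocalRing.residue_surjective s
    exact ⟨_, c.elt_mem_order (π := π) (i := i) 0 b, by simp only [c.intIm_elt hπ]⟩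
  · intro x hx y hy
    rw [residue_eq_iff_dvd hπ, ← dvd_neg, neg_sub]
    have him : c.im (-x + y) = algebraMap R F (π ^ i * (c.intIm π i y - c.intIm π i x)) := by
      rw [map_add, map_neg, ← c.algebraMap_intIm hx, ← c.algebraMap_intIm hy, mul_sub, map_sub]
      ring
    constructor
    · rintro ⟨d, hd⟩
      refine ⟨((c.addOrder π i).add_mem ((c.addOrder π i).neg_mem hx) hy).1, d, ?_⟩
      rw [him, hd, pow_succ, mul_assoc]
    · rintro ⟨-, d, hd⟩
      rw [him, pow_succ, mul_assoc] at hd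
      exact ⟨d, (mul_left_cancel₀ (pow_ne_zero _ hπ.ne_zero)
        (IsFractionRing.injective R F hd)).symm⟩

variable [Finite (IsLocalRing.ResidueField R)]

lemma relIndex_addOrder_zero {π : R} (hπ : Irreducible π) (i : ℕ) :
    (c.addOrder π i).relIndex (c.addOrder π 0) = Nat.card (IsLocalRing.ResidueField R) ^ i := by
  induction i with
  | zero => simp
  | succ i ih =>
    rw [← AddSubgroup.relIndex_mul_relIndex _ _ _ (c.addOrder_antitone π (Nat.le_succ i))
      (c.addOrder_antitone π (Nat.zero_le i)), ih, c.relIndex_addOrder_succ hπ, pow_succ']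

/-- The index of `x (R + R θ)` in `R + R θ`. -/
noncomputable def idx (π : R) (x : E) : ℕ := (mulMap x (c.addOrder π 0)).relIndex (c.addOrder π 0)

/-- In the chain xy O_0 ⊆ x O_0 ⊆ O_0 the lower step has the index of `y`, because multiplication by
a unit of `E` preserves indices. -/
lemma idx_mul {π : R} {x : Eˣ} {y : E} (hx : (x : E) ∈ c.order π 0) (hy : y ∈ c.order π 0) :
    c.idx π (x * y) = c.idx π x * c.idx π y := by
  rw [idx, mulMap_mul, ← AddSubgroup.relIndex_mul_relIndex _ _ _
    (mulMap_mono _ (c.mulMap_addOrder_le hy)) (c.mulMap_addOrder_le hx), relIndex_mulMap, idx, idx,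
    mul_comm]

lemma mulMap_of_mem_unitGroup {π : R} {i : ℕ} {x : Eˣ} (hx : x ∈ c.unitGroup π i) :
    mulMap (x : E) (c.addOrder π i) = c.addOrder π i := by
  refine le_antisymm (c.mulMap_addOrder_le hx.1) fun y hy => ?_
  rw [mem_mulMap_unit]
  exact (c.order π i).mul_mem hx.2 hy

lemma idx_of_mem_unitGroup {π : R} {i : ℕ} {x : Eˣ} (hx : x ∈ c.unitGroup π i) :
    c.idx π x = 1 := by
  rw [idx, c.mulMap_of_mem_unitGroup (c.unitGroup_antitone π (Nat.zero_le i) hx),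
    AddSubgroup.relIndex_self]

lemma card_residueField_pos : 0 < Nat.card (IsLocalRing.ResidueField R) := Nat.card_pos

/-- The index of x O_i in O_0 can be computed through O_i or through x O_0, and the index of O_i in
O_0 equals that of x O_i in x O_0. It is finite and cancels, so the index of `x` is the same in
every order that contains it. -/
lemma relIndex_mulMap_addOrder {π : R} (hπ : Irreducible π) {i : ℕ} {x : Eˣ}
    (hx : (x : E) ∈ c.order π i) :
    (mulMap (x : E) (c.addOrder π i)).relIndex (c.addOrder π i) = c.idx π x := by
  have h0 := c.addOrder_antitone π (Nat.zero_le i)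
  have h1 := AddSubgroup.relIndex_mul_relIndex _ _ _ (c.mulMap_addOrder_le hx) h0
  have h2 := AddSubgroup.relIndex_mul_relIndex _ _ _ (mulMap_mono (x : E) h0)
    (c.mulMap_addOrder_le (h0 hx))
  rw [relIndex_mulMap, ← h1, mul_comm, c.relIndex_addOrder_zero hπ] at h2
  exact (Nat.eq_of_mul_eq_mul_right (pow_pos card_residueField_pos i) h2).symm

lemma idx_unif {π : R} (hπ : Irreducible π) :
    c.idx π (unif F E hπ) = Nat.card (IsLocalRing.ResidueField R) ^ 2 := by
  have h : mulMap (unif F E hπ : E) (c.addOrder π 0) ≤ c.addOrder π 1 := by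
    rintro _ ⟨x, hx, rfl⟩
    exact ((c.unif_mul_mem_order_iff hπ).mpr hx).1
  rw [idx, ← AddSubgroup.relIndex_mul_relIndex _ _ _ h (c.addOrder_antitone π zero_le_one),
    c.relIndex_addOrder_succ hπ, pow_two]
  congr 1
  -- Inside O_1 the subgroup π O_0 is the kernel of the reduction of the first coordinate.
  rw [addRelIndex_eq_card_range _ _ (fun x : E => IsLocalRing.residue R (c.intRe x))]
  · rw [← Nat.card_univ (α := IsLocalRing.ResidueField R)]
    congr 2
    rw [Set.eq_univ_iff_forall]
    intro s
    obtain ⟨b, rfl⟩ := IsLocalRing.residue_surjective s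
    exact ⟨_, c.elt_mem_order (π := π) (i := 1) b 0, by simp only [c.intRe_elt]⟩
  · intro x hx y hy
    rw [residue_eq_iff_dvd hπ, ← dvd_neg, neg_sub, mem_mulMap]
    have hre : c.re (-x + y) = algebraMap R F (c.intRe y - c.intRe x) := by
      rw [map_add, map_neg, ← c.algebraMap_intRe hx, ← c.algebraMap_intRe hy, map_sub]
      ring
    have hxy : -x + y ∈ c.order π 1 := (c.addOrder π 1).add_mem ((c.addOrder π 1).neg_mem hx) hy
    constructor
    · rintro ⟨d, hd⟩
      obtain ⟨-, b, hb⟩ := hxy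
      refine ⟨c.elt (algebraMap R F d) (algebraMap R F (π ^ 0 * b)),
        c.elt_mem_order (π := π) d b, ?_⟩
      apply c.ext_re_im
      · rw [coe_unif, re_algebraMap_mul, re_elt, ← map_mul, hre, hd]
      · rw [coe_unif, im_algebraMap_mul, im_elt, ← map_mul, ← hb]
        congr 1; ring
    · rintro ⟨h, ⟨⟨a, ha⟩, -⟩, hxy⟩
      refine ⟨a, IsFractionRing.injective R F ?_⟩
      rw [← hre, ← hxy, coe_unif, re_algebraMap_mul, map_mul, ha]

lemma unif_mem_order {π : R} (hπ : Irreducible π) (i : ℕ) : (unif F E hπ : E) ∈ c.order π i :=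
  Subalgebra.algebraMap_mem _ _

lemma idx_unif_pow {π : R} (hπ : Irreducible π) (k : ℕ) :
    c.idx π ((unif F E hπ ^ k : Eˣ) : E) = Nat.card (IsLocalRing.ResidueField R) ^ (2 * k) := by
  induction k with
  | zero =>
    rw [pow_zero, c.idx_of_mem_unitGroup (one_mem (c.unitGroup π 0))]; simp
  | succ k ih =>
    rw [pow_succ', Units.val_mul, c.idx_mul (c.unif_mem_order hπ 0), ih, c.idx_unif hπ, ← pow_add]
    · congr 1; ring
    · rw [Units.val_pow_eq_pow_val]
      exact pow_mem (c.unif_mem_order hπ 0) k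

lemma unif_pow_mul_mem_order {π : R} (hπ : Irreducible π) {i : ℕ} (k : ℕ) {x : E}
    (hx : x ∈ c.order π i) : ((unif F E hπ ^ k : Eˣ) : E) * x ∈ c.order π (i + k) := by
  induction k with
  | zero => simpa using hx
  | succ k ih =>
    rw [pow_succ', Units.val_mul, mul_assoc, ← add_assoc]
    exact ((c.unif_mul_mem_order_iff hπ).mpr ih).1

/-- `πᵏ O_i` has index `qᵏ` in `O_{i+k}`. -/
lemma relIndex_unif_pow_mul {π : R} (hπ : Irreducible π) (i k : ℕ) :
    (mulMap ((unif F E hπ ^ k : Eˣ) : E) (c.addOrder π i)).relIndex (c.addOrder π (i + k)) =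
      Nat.card (IsLocalRing.ResidueField R) ^ k := by
  have hle : mulMap ((unif F E hπ ^ k : Eˣ) : E) (c.addOrder π i) ≤ c.addOrder π (i + k) := by
    rintro _ ⟨x, hx, rfl⟩
    exact c.unif_pow_mul_mem_order hπ k hx
  have h0 : ((unif F E hπ ^ k : Eˣ) : E) ∈ c.order π 0 := by
    rw [Units.val_pow_eq_pow_val]
    exact pow_mem (c.unif_mem_order hπ 0) k
  have h1 := AddSubgroup.relIndex_mul_relIndex _ _ _ hle (c.addOrder_antitone π (Nat.zero_le _))
  have h2 := AddSubgroup.relIndex_mul_relIndex _ _ _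
    (mulMap_mono ((unif F E hπ ^ k : Eˣ) : E) (c.addOrder_antitone π (Nat.zero_le i)))
    (c.mulMap_addOrder_le h0)
  change _ * c.idx π _ = _ at h2
  rw [relIndex_mulMap, ← h1, c.relIndex_addOrder_zero hπ, c.relIndex_addOrder_zero hπ,
    c.idx_unif_pow hπ, ← pow_add, show i + 2 * k = k + (i + k) by ring, pow_add] at h2
  exact (Nat.eq_of_mul_eq_mul_right (pow_pos card_residueField_pos _) h2).symm

/-- A product of `x` with an integral element, its conjugate up to a unit of `R`, is a power of π,
whose index is finite. -/
lemma idx_ne_zero {π : R} (hπ : Irreducible π) {x : Eˣ} (hx : (x : E) ∈ c.order π 0) :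
    c.idx π x ≠ 0 := by
  obtain ⟨n, hn⟩ := c.exists_norm_eq hx
  have hn0 : n ≠ 0 := by
    rintro rfl
    exact c.norm_units_ne_zero x (by rw [← hn, map_zero])
  obtain ⟨k, u, rfl⟩ := IsDiscreteValuationRing.eq_unit_mul_pow_irreducible hn0 hπ
  have hy : algebraMap R E (u⁻¹ : Rˣ) * c.conj x ∈ c.order π 0 :=
    mul_mem (Subalgebra.algebraMap_mem _ _) (c.conj_mem_order hx)
  have h := c.idx_mul hx hy
  have e : (x : E) * (algebraMap R E (u⁻¹ : Rˣ) * c.conj x) = ((unif F E hπ ^ k : Eˣ) : E) := by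
    rw [mul_left_comm, mul_conj, ← hn, ← IsScalarTower.algebraMap_apply, ← map_mul,
      Units.inv_mul_cancel_left, Units.val_pow_eq_pow_val, coe_unif, map_pow]
  rw [e, c.idx_unif_pow hπ] at h
  intro h0
  rw [h0, zero_mul] at h
  exact (pow_pos card_residueField_pos _).ne' h

end QuadCoord

/-! ### Ideals of finite index and their Dirichlet series -/

lemma hasSum_prod_of_finite {ι β : Type*} [Finite ι] {f : β → ℂ} {S : ℂ} (h : HasSum f S) :
    HasSum (fun p : ι × β => f p.2) (Nat.card ι * S) := by
  have hft := Fintype.ofFinite ι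
  have h1 := hasSum_fintype (fun _ : ι => (1 : ℂ))
  rw [Finset.sum_const, Finset.card_univ, nsmul_one] at h1
  have h3 : Summable fun x : ι × β => (fun _ : ι => (1 : ℂ)) x.1 * f x.2 :=
    summable_mul_of_summable_norm (f := fun _ : ι => (1 : ℂ)) (g := f)
      h1.summable.norm h.summable.norm
  have h2 := HasSum.mul h1 h h3
  rw [Nat.card_eq_fintype_card]
  simpa only [one_mul] using h2

lemma HasSum.congr_fun {β : Type*} {f g : β → ℂ} {S : ℂ} (hfg : ∀ x, g x = f x)
    (h : HasSum f S) : HasSum g S := by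
  rwa [funext hfg]

lemma hasSum_sigma_of_finite {ι : Type*} [Fintype ι] {γ : ι → Type*} {f : (Σ i, γ i) → ℂ}
    {S : ι → ℂ} (h : ∀ i, HasSum (fun x => f ⟨i, x⟩) (S i)) : HasSum f (∑ i, S i) := by
  have hs : Summable f := by
    apply Summable.of_norm
    rw [summable_sigma_of_nonneg fun _ => norm_nonneg _]
    exact ⟨fun i => (h i).summable.norm, Summable.of_finite⟩
  have := hs.hasSum.sigma h
  rw [(this.unique (hasSum_fintype S)).symm]
  exact hs.hasSum

lemma card_quotient_eq_relIndex {R E : Type*} [CommRing R] [CommRing E] [Algebra R E]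
    (O : Subalgebra R E) (I : Ideal O) (H : AddSubgroup E)
    (h : ∀ y : O, y ∈ I ↔ (y : E) ∈ H) :
    Nat.card (O ⧸ I) = H.relIndex (Subalgebra.toSubmodule O).toAddSubgroup := by
  have : I.toAddSubgroup = H.addSubgroupOf (Subalgebra.toSubmodule O).toAddSubgroup := by
    ext y
    exact h y
  change I.toAddSubgroup.index = _
  rw [this]
  rfl

namespace QuadCoord

variable {R F E : Type*} [CommRing R] [Field F] [Algebra R F]
  [CommRing E] [Algebra F E] [Algebra R E] [IsScalarTower R F E]
  (c : QuadCoord R F E)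
variable [IsDomain R] [IsDiscreteValuationRing R] [IsFractionRing R F]

/-- The classes modulo `O_iˣ` of the elements of `O_i ∩ Eˣ`; they correspond to the invertible
ideals of `O_i`. -/
def prinSet (π : R) (i : ℕ) : Set (Eˣ ⧸ c.unitGroup π i) := {x | ((x.out : Eˣ) : E) ∈ c.order π i}

lemma mk_out_eq {π : R} {i : ℕ} (y : Eˣ) : ∃ u ∈ c.unitGroup π i,
    (QuotientGroup.mk y : Eˣ ⧸ c.unitGroup π i).out = y * u := by
  obtain ⟨u, hu⟩ := QuotientGroup.mk_out_eq_mul (c.unitGroup π i) y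
  exact ⟨u, u.2, hu⟩

lemma mk_mem_prinSet {π : R} {i : ℕ} {y : Eˣ} :
    (QuotientGroup.mk y : Eˣ ⧸ c.unitGroup π i) ∈ c.prinSet π i ↔ (y : E) ∈ c.order π i := by
  obtain ⟨u, hu, h⟩ := c.mk_out_eq (π := π) (i := i) y
  rw [prinSet, Set.mem_ofPred_eq, h, Units.val_mul]
  refine ⟨fun h => ?_, fun h => mul_mem h hu.1⟩
  have := mul_mem h hu.2
  rwa [mul_assoc, Units.mul_inv, mul_one] at this

/-- The index of the ideal belonging to a class. -/
noncomputable def prinIdx (π : R) (i : ℕ) (x : Eˣ ⧸ c.unitGroup π i) : ℕ :=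
  c.idx π ((x.out : Eˣ) : E)

variable [Finite (IsLocalRing.ResidueField R)]

lemma prinIdx_mk {π : R} {i : ℕ} {y : Eˣ} (hy : (y : E) ∈ c.order π i) :
    c.prinIdx π i (QuotientGroup.mk y) = c.idx π y := by
  obtain ⟨u, hu, h⟩ := c.mk_out_eq (π := π) (i := i) y
  have h0 := c.order_antitone π (Nat.zero_le i)
  rw [prinIdx, h, Units.val_mul, c.idx_mul (h0 hy) (h0 hu.1), c.idx_of_mem_unitGroup hu, mul_one]

/-- In O_{i+1} the norm is congruent to re² modulo π. So a non-unit has first coordinate divisible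
by π, and this places it in π O_i. -/
lemma mem_unitGroup_or_exists_eq_unif_mul {π : R} (hπ : Irreducible π) {i : ℕ} {y : Eˣ}
    (hy : (y : E) ∈ c.order π (i + 1)) :
    y ∈ c.unitGroup π (i + 1) ∨ ∃ x : Eˣ, (x : E) ∈ c.order π i ∧ y = unif F E hπ * x := by
  by_cases h : π ∣ c.intRe (y : E)
  · right
    refine ⟨(unif F E hπ)⁻¹ * y, ?_, by simp⟩
    obtain ⟨a, ha⟩ := h
    rw [← c.unif_mul_mem_order_iff hπ]
    constructor
    · rw [← coe_unif (F := F) hπ, Units.val_mul, Units.mul_inv_cancel_left]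
      exact hy
    · refine ⟨a, mul_left_cancel₀ (algebraMap_ne_zero (F := F) hπ) ?_⟩
      rw [← map_mul, ← ha, c.algebraMap_intRe hy, ← re_algebraMap_mul, ← coe_unif (F := F) hπ,
        Units.val_mul, Units.mul_inv_cancel_left]
  · left
    refine c.mem_unitGroup_of_norm hy ?_ (c.norm_eq hy).symm
    rw [← IsLocalRing.residue_ne_zero_iff_isUnit]
    rw [← residue_eq_zero_iff_dvd hπ] at h
    have h0 : IsLocalRing.residue R π = 0 := (residue_eq_zero_iff_dvd hπ).mpr dvd_rfl
    simpa [h0] using h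

lemma one_lt_card_residueField : 1 < Nat.card (IsLocalRing.ResidueField R) :=
  Finite.one_lt_card

/-- The classes of non-units of `O_{i+1}` are the classes `π x u` with `x` in `O_i` and `u` in
`O_iˣ / O_{i+1}ˣ`. -/
noncomputable def prinMap {π : R} (hπ : Irreducible π) (i : ℕ) :
    Unit ⊕ ((c.unitGroup π i ⧸ (c.unitGroup π (i + 1)).subgroupOf (c.unitGroup π i)) ×
      c.prinSet π i) → c.prinSet π (i + 1)
  | .inl _ => ⟨QuotientGroup.mk 1, c.mk_mem_prinSet.mpr (by simp)⟩
  | .inr (u, x) => ⟨QuotientGroup.mk (unif F E hπ * (x.1.out * (u.out : Eˣ))),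
      c.mk_mem_prinSet.mpr ((c.unif_mul_mem_order_iff hπ).mpr (mul_mem x.2 u.out.2.1)).1⟩

lemma prinIdx_prinMap_inr {π : R} (hπ : Irreducible π) (i : ℕ)
    (u : c.unitGroup π i ⧸ (c.unitGroup π (i + 1)).subgroupOf (c.unitGroup π i))
    (x : c.prinSet π i) : c.prinIdx π (i + 1) (c.prinMap hπ i (.inr (u, x))) =
      Nat.card (IsLocalRing.ResidueField R) ^ 2 * c.prinIdx π i x := by
  have h0 := c.order_antitone π (Nat.zero_le i)
  rw [prinMap, c.prinIdx_mk, Units.val_mul, Units.val_mul, c.idx_mul (c.unif_mem_order hπ 0),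
    c.idx_mul (h0 x.2), c.idx_unif hπ, c.idx_of_mem_unitGroup u.out.2, mul_one]
  · rfl
  · exact h0 u.out.2.1
  · exact h0 (mul_mem x.2 u.out.2.1)
  · exact ((c.unif_mul_mem_order_iff hπ).mpr (mul_mem x.2 u.out.2.1)).1

lemma prinIdx_prinMap_inl {π : R} (hπ : Irreducible π) (i : ℕ) (x : Unit) :
    c.prinIdx π (i + 1) (c.prinMap hπ i (.inl x)) = 1 := by
  rw [prinMap, c.prinIdx_mk (by simp), c.idx_of_mem_unitGroup (one_mem (c.unitGroup π 0))]

lemma prinMap_bijective {π : R} (hπ : Irreducible π) (i : ℕ) :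
    Function.Bijective (c.prinMap hπ i) := by
  -- The two kinds of classes are told apart by the index: 1 against a multiple of q².
  have hne : ∀ v u x, c.prinMap hπ i (.inl v) ≠ c.prinMap hπ i (.inr (u, x)) := by
    intro v u x h
    have h1 := c.prinIdx_prinMap_inr hπ i u x
    rw [← h, c.prinIdx_prinMap_inl] at h1
    have := one_lt_card_residueField (R := R)
    have h2 := (Nat.eq_one_of_mul_eq_one_right h1.symm)
    have h3 := Nat.pow_eq_one.mp h2
    omega
  constructor
  · rintro (v | ⟨u, x⟩) (w | ⟨u', x'⟩) h
    · rfl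
    · exact absurd h (hne _ _ _)
    · exact absurd h.symm (hne _ _ _)
    · have h1 := QuotientGroup.eq.mp (congrArg Subtype.val h)
      have e : (unif F E hπ * (x.1.out * (u.out : Eˣ)))⁻¹ *
          (unif F E hπ * (x'.1.out * (u'.out : Eˣ))) =
          (x.1.out⁻¹ * x'.1.out) * ((u.out : Eˣ)⁻¹ * (u'.out : Eˣ)) := by
        rw [inv_mul_eq_iff_eq_mul, mul_assoc (unif F E hπ)]
        congr 1
        rw [mul_mul_mul_comm, mul_inv_cancel_left, mul_inv_cancel_left]
      rw [e] at h1
      have hx : x = x' := by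
        apply Subtype.ext
        rw [← QuotientGroup.out_eq' x.1, ← QuotientGroup.out_eq' x'.1, QuotientGroup.eq]
        have h2 := mul_mem (c.unitGroup_antitone π (Nat.le_succ i) h1)
          (inv_mem (mul_mem (inv_mem u.out.2) u'.out.2))
        rwa [mul_inv_cancel_right] at h2
      subst hx
      have hu : u = u' := by
        rw [← QuotientGroup.out_eq' u, ← QuotientGroup.out_eq' u', QuotientGroup.eq,
          Subgroup.mem_subgroupOf]
        simpa using h1
      rw [hu]
  · rintro ⟨y, hy⟩
    induction y using QuotientGroup.induction_on with | H y =>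
    rw [c.mk_mem_prinSet] at hy
    rcases c.mem_unitGroup_or_exists_eq_unif_mul hπ hy with h | ⟨x, hx, rfl⟩
    · refine ⟨.inl (), Subtype.ext (QuotientGroup.eq.mpr ?_)⟩
      simpa using h
    · obtain ⟨v, hv, hxv⟩ := c.mk_out_eq (π := π) (i := i) x
      let u : c.unitGroup π i ⧸ (c.unitGroup π (i + 1)).subgroupOf (c.unitGroup π i) :=
        QuotientGroup.mk (⟨v⁻¹, inv_mem hv⟩ : c.unitGroup π i)
      obtain ⟨w, hw⟩ := QuotientGroup.mk_out_eq_mul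
        ((c.unitGroup π (i + 1)).subgroupOf (c.unitGroup π i)) ⟨v⁻¹, inv_mem hv⟩
      refine ⟨.inr (u, ⟨QuotientGroup.mk x, c.mk_mem_prinSet.mpr hx⟩),
        Subtype.ext (QuotientGroup.eq.mpr ?_)⟩
      have hw' : ((u.out : c.unitGroup π i) : Eˣ) = v⁻¹ * (w : c.unitGroup π i) :=
        congrArg Subtype.val hw
      simp only [hxv, hw']
      have e : (unif F E hπ * (x * v * (v⁻¹ * ((w : c.unitGroup π i) : Eˣ))))⁻¹ *
          (unif F E hπ * x) = (((w : c.unitGroup π i) : Eˣ))⁻¹ := by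
        rw [mul_assoc x v, mul_inv_cancel_left]
        rw [inv_mul_eq_iff_eq_mul]
        rw [mul_assoc, mul_inv_cancel_right]
      rw [e]
      exact inv_mem (Subgroup.mem_subgroupOf.mp w.2)

/-- The unit class contributes 1. Every class `x` of O_i gives one class of index q² times that of
`x` for each coset in O_iˣ / O_{i+1}ˣ. The hypothesis `hfin` excludes the infinite index, which
would be read as 0. -/
lemma hasSum_prinSet_succ {π : R} (hπ : Irreducible π) {i : ℕ} {s S : ℂ}
    (hfin : (c.unitGroup π (i + 1)).relIndex (c.unitGroup π i) ≠ 0)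
    (h : HasSum (fun x : c.prinSet π i => (c.prinIdx π i x : ℂ) ^ (-s)) S) :
    HasSum (fun x : c.prinSet π (i + 1) => (c.prinIdx π (i + 1) x : ℂ) ^ (-s))
      (1 + (c.unitGroup π (i + 1)).relIndex (c.unitGroup π i) *
        (((Nat.card (IsLocalRing.ResidueField R) : ℂ) ^ (-s)) ^ 2 * S)) := by
  have : Finite (c.unitGroup π i ⧸ (c.unitGroup π (i + 1)).subgroupOf (c.unitGroup π i)) :=
    Nat.finite_of_card_ne_zero hfin
  rw [← (Equiv.ofBijective _ (c.prinMap_bijective hπ i)).hasSum_iff]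
  refine HasSum.sum (a := 1) ?_ ?_
  · convert hasSum_fintype (fun _ : Unit => (1 : ℂ)) using 1
    · ext x
      simp [c.prinIdx_prinMap_inl hπ i]
    · simp
  · convert hasSum_prod_of_finite (h.mul_left
      (((Nat.card (IsLocalRing.ResidueField R) : ℂ) ^ (-s)) ^ 2))
      (ι := c.unitGroup π i ⧸ (c.unitGroup π (i + 1)).subgroupOf (c.unitGroup π i)) using 1
    swap
    · rfl
    ext ⟨u, x⟩
    simp only [Function.comp_apply, Equiv.ofBijective_apply, c.prinIdx_prinMap_inr hπ i]
    rw [pow_two, pow_two, Nat.cast_mul, Complex.natCast_mul_natCast_cpow, Nat.cast_mul,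
      Complex.natCast_mul_natCast_cpow]

/-- The ideal `z O_i ∩ O_n` of `O_n`, for `i ≤ n`. -/
def idealOf {π : R} {n i : ℕ} (hin : i ≤ n) (z : Eˣ) : Ideal (c.order π n) where
  carrier := {y | ↑z⁻¹ * (y : E) ∈ c.order π i}
  add_mem' := by
    intro a b ha hb
    rw [Set.mem_ofPred_eq, Subalgebra.coe_add, mul_add]
    exact add_mem ha hb
  zero_mem' := by simp
  smul_mem' := by
    intro a b hb
    rw [Set.mem_ofPred_eq, smul_eq_mul, Subalgebra.coe_mul, mul_left_comm]
    exact mul_mem (c.order_antitone π hin a.2) hb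

lemma mem_idealOf {π : R} {n i : ℕ} (hin : i ≤ n) (z : Eˣ) (y : c.order π n) :
    y ∈ c.idealOf hin z ↔ ↑z⁻¹ * (y : E) ∈ c.order π i := Iff.rfl

/-- With k = n - i, the chain πᵏ x O_i ⊆ πᵏ O_i ⊆ O_n has steps of index `idx x` and qᵏ. -/
lemma card_quotient_idealOf {π : R} (hπ : Irreducible π) {n i : ℕ} (hin : i ≤ n) {x : Eˣ}
    (hx : (x : E) ∈ c.order π i) :
    Nat.card (c.order π n ⧸ c.idealOf hin (unif F E hπ ^ (n - i) * x)) =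
      Nat.card (IsLocalRing.ResidueField R) ^ (n - i) * c.idx π x := by
  rw [card_quotient_eq_relIndex _ _ (mulMap ((unif F E hπ ^ (n - i) * x : Eˣ) : E)
    (c.addOrder π i))]
  · obtain ⟨k, rfl⟩ := Nat.exists_eq_add_of_le hin
    rw [Nat.add_sub_cancel_left]
    change AddSubgroup.relIndex _ (c.addOrder π (i + k)) = _
    have hle : mulMap ((unif F E hπ ^ k : Eˣ) : E) (c.addOrder π i) ≤ c.addOrder π (i + k) := by
      rintro _ ⟨x, hx, rfl⟩
      exact c.unif_pow_mul_mem_order hπ k hx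
    rw [Units.val_mul, mulMap_mul, ← AddSubgroup.relIndex_mul_relIndex _ _ _
      (mulMap_mono _ (c.mulMap_addOrder_le hx)) hle, relIndex_mulMap,
      c.relIndex_mulMap_addOrder hπ hx, c.relIndex_unif_pow_mul hπ, mul_comm]
  · intro y
    rw [c.mem_idealOf, mem_mulMap_unit, mem_addOrder]

/-- Two powers of π agree in the finite quotient; their difference is a power of π times a unit 1 -
π^(k+1). -/
lemma exists_pow_mem_of_finite {π : R} (hπ : Irreducible π) {n : ℕ} (I : Ideal (c.order π n))
    [Finite (c.order π n ⧸ I)] : ∃ a : ℕ, algebraMap R (c.order π n) (π ^ a) ∈ I := by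
  obtain ⟨a, b, hab, h⟩ := Finite.exists_ne_map_eq_of_infinite
    (fun k : ℕ => Ideal.Quotient.mk I (algebraMap R (c.order π n) (π ^ k)))
  wlog hlt : a < b generalizing a b
  · exact this b a hab.symm h.symm (by omega)
  refine ⟨a, ?_⟩
  rw [Ideal.Quotient.eq] at h
  obtain ⟨k, rfl⟩ := Nat.exists_eq_add_of_lt hlt
  have hu : IsUnit (1 - π ^ (k + 1)) := by
    rw [← IsLocalRing.residue_ne_zero_iff_isUnit]
    have h0 : IsLocalRing.residue R π = 0 := (residue_eq_zero_iff_dvd hπ).mpr dvd_rfl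
    simp [h0]
  obtain ⟨u, hu⟩ := hu
  have h2 := I.mul_mem_left (algebraMap R (c.order π n) (u⁻¹ : Rˣ)) h
  rw [← map_sub, ← map_mul] at h2
  convert h2 using 2
  rw [add_assoc, pow_add, ← mul_one_sub, ← hu, mul_left_comm, Units.inv_mul, mul_one]

/-- As a lattice the ideal is z O_i. It is stable under O_n, so O_n lies in its multiplier ring O_i
and i ≤ n. Since both z and z πⁱθ lie in O_n, the first coordinate of z is divisible by π^(n-i),
which puts z in π^(n-i) O_i. -/
lemma exists_eq_idealOf {π : R} (hπ : Irreducible π) {n : ℕ} (I : Ideal (c.order π n))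
    [Finite (c.order π n ⧸ I)] : ∃ (i : ℕ) (hin : i ≤ n) (x : Eˣ), (x : E) ∈ c.order π i ∧
      I = c.idealOf hin (unif F E hπ ^ (n - i) * x) := by
  let Λ : Submodule R E := (I.restrictScalars R).map (c.order π n).val.toLinearMap
  have hΛ : ∀ y : c.order π n, (y : E) ∈ Λ ↔ y ∈ I := by
    intro y
    constructor
    · rintro ⟨y', hy', h⟩
      rwa [← Subtype.ext (a1 := y') (a2 := y) h]
    · intro hy
      exact ⟨y, hy, rfl⟩
  have hΛ' : ∀ y ∈ Λ, y ∈ c.order π n := by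
    rintro _ ⟨y', hy', rfl⟩
    exact y'.2
  obtain ⟨a, ha⟩ := c.exists_pow_mem_of_finite hπ I
  obtain ⟨z, i, hz⟩ := c.exists_eq_smul_order hπ Λ
    ⟨0, fun x hx => by simpa using c.order_antitone π (Nat.zero_le n) (hΛ' x hx)⟩
    ⟨a + n, fun x hx => by
      have hx' := c.unif_pow_mul_mem_order hπ n hx
      rw [zero_add] at hx'
      have := I.mul_mem_left ⟨_, hx'⟩ ha
      rw [← hΛ] at this
      convert this using 1
      rw [pow_add, map_mul, mul_assoc, mul_comm, map_pow (algebraMap R E) π n]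
      rfl⟩
  have hzΛ : (z : E) ∈ Λ := by rw [hz]; simp
  have hzn := hΛ' _ hzΛ
  have hin : i ≤ n := by
    rw [← c.order_le_order_iff hπ]
    intro x hx
    have := I.mul_mem_left ⟨x, hx⟩ ((hΛ ⟨z, hzn⟩).mp hzΛ)
    rw [← hΛ, hz] at this
    simpa [mul_left_comm] using this
  obtain ⟨k, rfl⟩ := Nat.exists_eq_add_of_le hin
  have hzθ : (z : E) * c.elt 0 (algebraMap R F (π ^ i)) ∈ c.order π (i + k) := by
    apply hΛ'
    rw [hz, Units.inv_mul_cancel_left]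
    exact c.pow_mul_θ_mem_order i
  have hx : ((unif F E hπ ^ k)⁻¹ * z : Eˣ) ∈ {x : Eˣ | (x : E) ∈ c.order π i} := by
    obtain ⟨⟨a, ha⟩, b, hb⟩ := hzn
    obtain ⟨-, d, hd⟩ := hzθ
    rw [im_mul, im_elt, re_elt, mul_zero, add_zero, ← ha, ← hb] at hd
    simp only [← map_mul, ← map_add] at hd
    have hd := IsFractionRing.injective R F hd
    -- Comparison of the second coordinates in z · πⁱθ ∈ O_{i+k}.
    have hak : a = π ^ k * (d - π ^ i * b * c.t) := by
      apply mul_left_cancel₀ (pow_ne_zero i hπ.ne_zero)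
      rw [pow_add] at hd
      linear_combination -hd
    have hzk : (z : E) = ((unif F E hπ ^ k : Eˣ) : E) *
        c.elt (algebraMap R F (d - π ^ i * b * c.t)) (algebraMap R F (π ^ i * b)) := by
      rw [Units.val_pow_eq_pow_val, coe_unif, ← map_pow]
      apply c.ext_re_im
      · rw [re_algebraMap_mul, re_elt, ← map_mul, ← hak, ha]
      · rw [im_algebraMap_mul, im_elt, ← map_mul, ← hb]
        congr 1; ring
    rw [Set.mem_ofPred_eq, Units.val_mul, hzk, Units.inv_mul_cancel_left]
    exact c.elt_mem_order _ _
  refine ⟨i, hin, _, hx, ?_⟩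
  ext y
  rw [c.mem_idealOf, Nat.add_sub_cancel_left, mul_inv_cancel_left, ← hz, hΛ]

/-- The ideals of finite index of `O_n` are the ideals `π^(n-i) x O_i` with `i ≤ n` and `x` in
`O_i ∩ Eˣ`. -/
noncomputable def idealMap {π : R} (hπ : Irreducible π) (n : ℕ)
    (p : Σ i : Fin (n + 1), c.prinSet π i) :
    {I : Ideal (c.order π n) // Finite (c.order π n ⧸ I)} :=
  ⟨c.idealOf (Nat.lt_succ_iff.mp p.1.2) (unif F E hπ ^ (n - (p.1 : ℕ)) * p.2.1.out), by
    apply Nat.finite_of_card_ne_zero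
    rw [c.card_quotient_idealOf hπ _ p.2.2]
    exact mul_ne_zero (pow_pos card_residueField_pos _).ne'
      (c.idx_ne_zero hπ (c.order_antitone π (Nat.zero_le _) p.2.2))⟩

lemma card_quotient_idealMap {π : R} (hπ : Irreducible π) (n : ℕ)
    (p : Σ i : Fin (n + 1), c.prinSet π i) :
    Nat.card (c.order π n ⧸ (c.idealMap hπ n p).1) =
      Nat.card (IsLocalRing.ResidueField R) ^ (n - (p.1 : ℕ)) * c.prinIdx π p.1 p.2 :=
  c.card_quotient_idealOf hπ (Nat.lt_succ_iff.mp p.1.2) p.2.2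

lemma unif_pow_mul_mul_mem {π : R} (hπ : Irreducible π) {n i : ℕ} (hin : i ≤ n) {x : Eˣ}
    (hx : (x : E) ∈ c.order π i) {y : E}
    (hy : ↑(unif F E hπ ^ (n - i) * x)⁻¹ * y ∈ c.order π i) : y ∈ c.order π n := by
  have := c.unif_pow_mul_mem_order hπ (n - i) (mul_mem hx hy)
  rw [Nat.add_sub_cancel' hin, ← mul_assoc, ← mul_assoc, ← Units.val_mul, Units.mul_inv,
    one_mul] at this
  exact this

lemma idealMap_bijective {π : R} (hπ : Irreducible π) (n : ℕ) :
    Function.Bijective (c.idealMap hπ n) := by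
  constructor
  · rintro ⟨⟨i, hi⟩, x, hx⟩ ⟨⟨j, hj⟩, y, hy⟩ h
    have hi' := Nat.lt_succ_iff.mp hi
    have hj' := Nat.lt_succ_iff.mp hj
    have h1 : c.idealOf hi' (unif F E hπ ^ (n - i) * x.out) =
        c.idealOf hj' (unif F E hπ ^ (n - j) * y.out) := congrArg Subtype.val h
    have h2 : ∀ w : E, ↑(unif F E hπ ^ (n - i) * x.out)⁻¹ * w ∈ c.order π i ↔
        ↑(unif F E hπ ^ (n - j) * y.out)⁻¹ * w ∈ c.order π j := by
      intro w
      constructor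
      · intro hw
        have hwn := c.unif_pow_mul_mul_mem hπ hi' hx hw
        exact (c.mem_idealOf hj' _ ⟨w, hwn⟩).mp (h1 ▸ (c.mem_idealOf hi' _ ⟨w, hwn⟩).mpr hw)
      · intro hw
        have hwn := c.unif_pow_mul_mul_mem hπ hj' hy hw
        exact (c.mem_idealOf hi' _ ⟨w, hwn⟩).mp (h1 ▸ (c.mem_idealOf hj' _ ⟨w, hwn⟩).mpr hw)
    obtain ⟨h3, h4⟩ := c.eq_of_smul_order_eq hπ h2
    subst h3
    have : x = y := by
      rw [← QuotientGroup.out_eq' x, ← QuotientGroup.out_eq' y, QuotientGroup.eq]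
      convert h4 using 1
      rw [mul_inv, mul_mul_mul_comm, inv_mul_cancel, one_mul]
    subst this
    rfl
  · rintro ⟨I, hI⟩
    obtain ⟨i, hin, x, hx, rfl⟩ := c.exists_eq_idealOf hπ I
    refine ⟨⟨⟨i, Nat.lt_succ_iff.mpr hin⟩, QuotientGroup.mk x, c.mk_mem_prinSet.mpr hx⟩,
      Subtype.ext ?_⟩
    obtain ⟨u, hu, hxu⟩ := c.mk_out_eq (π := π) (i := i) x
    ext y
    change y ∈ c.idealOf hin _ ↔ _
    rw [c.mem_idealOf, c.mem_idealOf]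
    revert y
    rw [Subtype.forall]
    intro y _
    refine (c.smul_order_eq_iff hπ).mpr ?_ y
    simp only [hxu, mul_inv]
    have e : (unif F E hπ ^ (n - i))⁻¹ * (x⁻¹ * u⁻¹) * (unif F E hπ ^ (n - i) * x) = u⁻¹ := by
      rw [mul_mul_mul_comm, inv_mul_cancel, one_mul, mul_right_comm, inv_mul_cancel, one_mul]
    rw [e]
    exact inv_mem hu

lemma hasSum_order {π : R} (hπ : Irreducible π) (n : ℕ) {s : ℂ} {S : ℕ → ℂ}
    (h : ∀ i ≤ n, HasSum (fun x : c.prinSet π i => (c.prinIdx π i x : ℂ) ^ (-s)) (S i)) :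
    HasSum (fun I : {I : Ideal (c.order π n) // Finite (c.order π n ⧸ I)} =>
      (Nat.card (c.order π n ⧸ I.1) : ℂ) ^ (-s))
      (∑ i ∈ Finset.range (n + 1),
        ((Nat.card (IsLocalRing.ResidueField R) : ℂ) ^ (-s)) ^ (n - i) * S i) := by
  rw [← (Equiv.ofBijective _ (c.idealMap_bijective hπ n)).hasSum_iff, Finset.sum_range]
  refine hasSum_sigma_of_finite fun i => ?_
  refine HasSum.congr_fun (fun x => ?_) ((h i (Nat.lt_succ_iff.mp i.2)).mul_left
    (((Nat.card (IsLocalRing.ResidueField R) : ℂ) ^ (-s)) ^ (n - (i : ℕ))))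
  simp only [Function.comp_apply, Equiv.ofBijective_apply, c.card_quotient_idealMap hπ]
  rw [Nat.cast_mul, Complex.natCast_mul_natCast_cpow]
  congr 1
  rw [Nat.cast_pow, ← Complex.natCast_cpow_natCast_mul, ← Complex.cpow_nat_mul]

end QuadCoord

/-! ### The maximal order: residue roots, prime elements, zeta function -/

namespace QuadCoord

variable {R F E : Type*} [CommRing R] [Field F] [Algebra R F]
  [CommRing E] [Algebra F E] [Algebra R E] [IsScalarTower R F E]
  (c : QuadCoord R F E)
variable [IsDomain R] [IsDiscreteValuationRing R] [IsFractionRing R F]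

lemma intRe_mul {π : R} {x y : E} (hx : x ∈ c.order π 0) (hy : y ∈ c.order π 0) :
    c.intRe (x * y) = c.intRe x * c.intRe y - c.intIm π 0 x * c.intIm π 0 y * c.m := by
  apply IsFractionRing.injective R F
  have hx' := c.algebraMap_intIm hx
  have hy' := c.algebraMap_intIm hy
  rw [pow_zero, one_mul] at hx' hy'
  rw [c.algebraMap_intRe (mul_mem hx hy), re_mul, map_sub, map_mul, map_mul, map_mul,
    c.algebraMap_intRe hx, c.algebraMap_intRe hy, hx', hy']

lemma intIm_mul {π : R} {x y : E} (hx : x ∈ c.order π 0) (hy : y ∈ c.order π 0) :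
    c.intIm π 0 (x * y) = c.intRe x * c.intIm π 0 y + c.intIm π 0 x * c.intRe y +
      c.intIm π 0 x * c.intIm π 0 y * c.t := by
  apply IsFractionRing.injective R F
  have hx' := c.algebraMap_intIm hx
  have hy' := c.algebraMap_intIm hy
  have hxy := c.algebraMap_intIm (mul_mem hx hy)
  rw [pow_zero, one_mul] at hx' hy' hxy
  rw [hxy, im_mul]
  simp only [map_add, map_mul]
  rw [c.algebraMap_intRe hx, c.algebraMap_intRe hy, hx', hy']

lemma intRe_add {π : R} {x y : E} (hx : x ∈ c.order π 0) (hy : y ∈ c.order π 0) :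
    c.intRe (x + y) = c.intRe x + c.intRe y := by
  apply IsFractionRing.injective R F
  rw [c.algebraMap_intRe (add_mem hx hy), map_add, map_add,
    c.algebraMap_intRe hx, c.algebraMap_intRe hy]

lemma intIm_add {π : R} {x y : E} (hx : x ∈ c.order π 0) (hy : y ∈ c.order π 0) :
    c.intIm π 0 (x + y) = c.intIm π 0 x + c.intIm π 0 y := by
  apply IsFractionRing.injective R F
  have hx' := c.algebraMap_intIm hx
  have hy' := c.algebraMap_intIm hy
  have hxy := c.algebraMap_intIm (add_mem hx hy)
  rw [pow_zero, one_mul] at hx' hy' hxy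
  rw [hxy, map_add, map_add, hx', hy']

lemma intRe_algebraMap (a : R) : c.intRe (algebraMap R E a) = a := by
  have := c.intRe_elt a 0
  rwa [elt, zero_smul, add_zero, ← IsScalarTower.algebraMap_apply] at this

lemma intIm_algebraMap {π : R} (hπ : Irreducible π) (a : R) :
    c.intIm π 0 (algebraMap R E a) = 0 := by
  have := c.intIm_elt hπ 0 (algebraMap R F a) 0
  rwa [elt, mul_zero, map_zero, zero_smul, add_zero, ← IsScalarTower.algebraMap_apply] at this

lemma mem_order_of_integralClosure (π : R) (x : integralClosure R E) : (x : E) ∈ c.order π 0 := by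
  rw [order_zero]
  exact x.2

/-- Evaluation `θ ↦ ρ` at a root `ρ` of `X² - t X + m` in the residue field. -/
noncomputable def evalHom {π : R} (hπ : Irreducible π) {ρ : IsLocalRing.ResidueField R}
    (hρ : ρ ∈ c.residueRoots) : integralClosure R E →+* IsLocalRing.ResidueField R where
  toFun x := IsLocalRing.residue R (c.intRe (x : E)) +
    IsLocalRing.residue R (c.intIm π 0 (x : E)) * ρ
  map_one' := by
    have h1 : ((1 : integralClosure R E) : E) = algebraMap R E 1 := by simp
    rw [h1, intRe_algebraMap, c.intIm_algebraMap hπ]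
    simp
  map_zero' := by
    have h1 : ((0 : integralClosure R E) : E) = algebraMap R E 0 := by simp
    rw [h1, intRe_algebraMap, c.intIm_algebraMap hπ]
    simp
  map_add' x y := by
    rw [Subalgebra.coe_add, c.intRe_add (c.mem_order_of_integralClosure π x)
      (c.mem_order_of_integralClosure π y), c.intIm_add (c.mem_order_of_integralClosure π x)
      (c.mem_order_of_integralClosure π y), map_add, map_add]
    ring
  map_mul' x y := by
    rw [Subalgebra.coe_mul, c.intRe_mul (c.mem_order_of_integralClosure π x)
      (c.mem_order_of_integralClosure π y), c.intIm_mul (c.mem_order_of_integralClosure π x)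
      (c.mem_order_of_integralClosure π y)]
    simp only [map_add, map_mul, map_sub]
    simp only [residueRoots, Set.mem_ofPred_eq] at hρ
    linear_combination -(IsLocalRing.residue R (c.intIm π 0 (x : E)) *
      IsLocalRing.residue R (c.intIm π 0 (y : E))) * hρ

lemma evalHom_apply {π : R} (hπ : Irreducible π) {ρ : IsLocalRing.ResidueField R}
    (hρ : ρ ∈ c.residueRoots) (x : integralClosure R E) : c.evalHom hπ hρ x =
      IsLocalRing.residue R (c.intRe (x : E)) + IsLocalRing.residue R (c.intIm π 0 (x : E)) * ρ :=
  rfl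

lemma evalHom_algebraMap {π : R} (hπ : Irreducible π) {ρ : IsLocalRing.ResidueField R}
    (hρ : ρ ∈ c.residueRoots) (a : R) :
    c.evalHom hπ hρ (algebraMap R _ a) = IsLocalRing.residue R a := by
  rw [evalHom_apply]
  change IsLocalRing.residue R (c.intRe (algebraMap R E a)) +
    IsLocalRing.residue R (c.intIm π 0 (algebraMap R E a)) * ρ = _
  rw [intRe_algebraMap, c.intIm_algebraMap hπ]
  simp

lemma evalHom_surjective {π : R} (hπ : Irreducible π) {ρ : IsLocalRing.ResidueField R}
    (hρ : ρ ∈ c.residueRoots) : Function.Surjective (c.evalHom hπ hρ) := by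
  intro s
  obtain ⟨a, rfl⟩ := IsLocalRing.residue_surjective s
  exact ⟨_, c.evalHom_algebraMap hπ hρ a⟩

lemma θ_mem_integralClosure : c.θ ∈ integralClosure R E := c.isIntegral_θ

lemma evalHom_θ {π : R} (hπ : Irreducible π) {ρ : IsLocalRing.ResidueField R}
    (hρ : ρ ∈ c.residueRoots) : c.evalHom hπ hρ ⟨c.θ, c.θ_mem_integralClosure⟩ = ρ := by
  rw [evalHom_apply]
  have h1 : c.θ = c.elt (algebraMap R F 0) (algebraMap R F (π ^ 0 * 1)) := by simp [elt]
  have h2 := c.intRe_elt 0 (algebraMap R F (π ^ 0 * 1))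
  have h3 := c.intIm_elt hπ 0 (algebraMap R F 0) 1
  rw [← h1] at h2 h3
  simp [h2, h3]

lemma eq_or_eq_of_mem_residueRoots {ρ s : IsLocalRing.ResidueField R} (hρ : ρ ∈ c.residueRoots)
    (hs : s ∈ c.residueRoots) : s = ρ ∨ s = IsLocalRing.residue R c.t - ρ := by
  simp only [residueRoots, Set.mem_ofPred_eq] at hρ hs
  have : (s - ρ) * (s - (IsLocalRing.residue R c.t - ρ)) = 0 := by linear_combination hs - hρ
  rcases mul_eq_zero.mp this with h | h
  · exact .inl (sub_eq_zero.mp h)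
  · exact .inr (sub_eq_zero.mp h)

lemma sub_mem_residueRoots {ρ : IsLocalRing.ResidueField R} (hρ : ρ ∈ c.residueRoots) :
    IsLocalRing.residue R c.t - ρ ∈ c.residueRoots := by
  simp only [residueRoots, Set.mem_ofPred_eq] at hρ ⊢
  linear_combination hρ

lemma residueRoots_eq_pair {ρ : IsLocalRing.ResidueField R} (hρ : ρ ∈ c.residueRoots) :
    c.residueRoots = {ρ, IsLocalRing.residue R c.t - ρ} := by
  ext s
  constructor
  · exact c.eq_or_eq_of_mem_residueRoots hρ
  · rintro (rfl | rfl)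
    · exact hρ
    · exact c.sub_mem_residueRoots hρ

/-- A root in the residue field lifts to `a` such that the norm of `θ - a` is a uniformizer. -/
lemma exists_lift_root {π : R} (hπ : Irreducible π) {ρ : IsLocalRing.ResidueField R}
    (hρ : ρ ∈ c.residueRoots) : ∃ (a : R) (u : Rˣ), IsLocalRing.residue R a = ρ ∧
      a ^ 2 - c.t * a + c.m = π * u := by
  obtain ⟨a, rfl⟩ := IsLocalRing.residue_surjective ρ
  simp only [residueRoots, Set.mem_ofPred_eq, ← map_mul, ← map_pow, ← map_sub, ← map_add] at hρ
  obtain ⟨d, hd⟩ := (residue_eq_zero_iff_dvd hπ).mp hρ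
  have h0 : IsLocalRing.residue R π = 0 := (residue_eq_zero_iff_dvd hπ).mpr dvd_rfl
  by_cases hdu : IsUnit d
  · obtain ⟨u, rfl⟩ := hdu
    exact ⟨a, u, rfl, hd⟩
  have hd0 : IsLocalRing.residue R d = 0 := by
    rw [IsLocalRing.residue_eq_zero_iff]; exact hdu
  by_cases ht : IsLocalRing.residue R (2 * a - c.t) = 0
  -- Here ρ is a double root and the value at `a` is divisible by π². Then (θ - a)/π has trace `-e`
  -- and norm `d'`, so it is integral without lying in R + Rθ.
  · exfalso
    obtain ⟨d', rfl⟩ := (residue_eq_zero_iff_dvd hπ).mp hd0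
    obtain ⟨e, he⟩ := (residue_eq_zero_iff_dvd hπ).mp ht
    have hπF := algebraMap_ne_zero (F := F) hπ
    let y : E := c.elt (-(algebraMap R F a) / algebraMap R F π) (1 / algebraMap R F π)
    have hy : IsIntegral R y := by
      refine isIntegral_of_quadratic (-e) d' ?_
      rw [c.mul_self_eq y, IsScalarTower.algebraMap_apply R F E,
        IsScalarTower.algebraMap_apply R F E]
      congr 3
      · simp only [y, re_elt, im_elt, map_neg]
        field_simp
        have := congrArg (algebraMap R F) he
        simp only [map_sub, map_mul, map_ofNat] at this
        linear_combination -this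
      · simp only [y, norm, re_elt, im_elt]
        field_simp
        have := congrArg (algebraMap R F) hd
        simp only [map_sub, map_mul, map_add, map_pow] at this
        linear_combination this
    obtain ⟨-, b, hb⟩ := c.integral y hy
    simp only [y, im_elt] at hb
    rw [eq_div_iff hπF, ← map_mul, ← map_one (algebraMap R F)] at hb
    exact hπ.not_isUnit (IsUnit.of_mul_eq_one_right _ (IsFractionRing.injective R F hb))
  -- At a simple root, replacing `a` by `a + π` changes the value by π(2a - t + π), which makes the
  -- cofactor of π a unit.
  · have hu : IsUnit (d + (2 * a - c.t) + π) := by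
      rw [← IsLocalRing.residue_ne_zero_iff_isUnit, map_add, map_add, hd0, h0, zero_add, add_zero]
      exact ht
    obtain ⟨u, hu⟩ := hu
    refine ⟨a + π, u, by rw [map_add, h0, add_zero], ?_⟩
    rw [hu]
    linear_combination hd

variable [Finite (IsLocalRing.ResidueField R)]

section LinearFactor

variable {π : R} (hπ : Irreducible π) {a : R} {u : Rˣ} (ha : a ^ 2 - c.t * a + c.m = π * u)

include hπ ha in
lemma residue_mem_residueRoots : IsLocalRing.residue R a ∈ c.residueRoots := by
  simp only [residueRoots, Set.mem_ofPred_eq, ← map_mul, ← map_pow, ← map_sub, ← map_add]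
  rw [ha, residue_eq_zero_iff_dvd hπ]
  exact dvd_mul_right _ _

lemma norm_linear : c.norm (c.elt (-algebraMap R F a) 1) =
    algebraMap R F (a ^ 2 - c.t * a + c.m) := by
  simp only [norm, re_elt, im_elt, map_add, map_sub, map_mul, map_pow]
  ring

include hπ ha in
lemma isUnit_linear : IsUnit (c.elt (-algebraMap R F a) 1) := by
  apply c.isUnit_of_norm_ne_zero
  rw [norm_linear, ha]
  exact (map_ne_zero_iff _ (IsFractionRing.injective R F)).mpr (mul_ne_zero hπ.ne_zero u.ne_zero)

lemma linear_mem_order : c.elt (-algebraMap R F a) 1 ∈ c.order π 0 :=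
  ⟨⟨-a, by simp⟩, 1, by simp⟩

/-- The element `θ - a` of norm `π u`, as a unit of `E`. -/
noncomputable def linear : Eˣ := (c.isUnit_linear hπ ha).unit

lemma coe_linear : (c.linear hπ ha : E) = c.elt (-algebraMap R F a) 1 := rfl

/-- The element θ - a generates the kernel of the evaluation θ ↦ a in the residue field: write x =
(re x + a im x) + im x (θ - a), and note that π is itself a multiple of θ - a, through the
conjugate. -/
lemma inv_linear_mul_mem_iff {x : E} (hx : x ∈ c.order π 0) :
    ↑(c.linear hπ ha)⁻¹ * x ∈ c.order π 0 ↔ IsLocalRing.residue R (c.intRe x) +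
      IsLocalRing.residue R (c.intIm π 0 x) * IsLocalRing.residue R a = 0 := by
  have hlin : (c.linear hπ ha : E) ∈ c.order π 0 := c.linear_mem_order
  constructor
  · intro h
    have e := congrArg (c.evalHom hπ (c.residue_mem_residueRoots hπ ha))
      (show (⟨x, by rw [order_zero] at hx; exact hx⟩ : integralClosure R E) =
        (⟨c.linear hπ ha, by rw [order_zero] at hlin; exact hlin⟩ : integralClosure R E) *
        ⟨_, by rw [order_zero] at h; exact h⟩ from Subtype.ext (by simp))
    rw [map_mul, evalHom_apply, evalHom_apply] at e
    rw [e]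
    have h1 : (c.linear hπ ha : E) = c.elt (algebraMap R F (-a)) (algebraMap R F (π ^ 0 * 1)) := by
      simp [coe_linear]
    have h2 := c.intRe_elt (-a) (algebraMap R F (π ^ 0 * 1))
    have h3 := c.intIm_elt hπ 0 (algebraMap R F (-a)) 1
    rw [← h1] at h2 h3
    simp [h2, h3]
  · intro h
    rw [← map_mul, ← map_add, residue_eq_zero_iff_dvd hπ] at h
    obtain ⟨d, hd⟩ := h
    have hconj : (c.linear hπ ha : E) * (algebraMap R E (u⁻¹ : Rˣ) * c.conj (c.linear hπ ha)) =
        algebraMap R E π := by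
      rw [mul_left_comm, mul_conj, coe_linear, norm_linear, ha, ← IsScalarTower.algebraMap_apply,
        ← map_mul, mul_comm, mul_assoc, Units.mul_inv, mul_one]
    have hx' : x = algebraMap R E π * algebraMap R E d +
        algebraMap R E (c.intIm π 0 x) * c.linear hπ ha := by
      rw [← map_mul, ← hd]
      apply c.ext_re_im
      · rw [map_add, re_algebraMap_R, re_algebraMap_mul, coe_linear, re_elt,
          ← c.algebraMap_intRe hx]
        simp only [map_add, map_mul]; ring
      · rw [map_add, im_algebraMap_R, im_algebraMap_mul, coe_linear, im_elt,
          ← c.algebraMap_intIm hx]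
        simp
    have : ↑(c.linear hπ ha)⁻¹ * x = algebraMap R E (u⁻¹ : Rˣ) * c.conj (c.linear hπ ha) *
        algebraMap R E d + algebraMap R E (c.intIm π 0 x) := by
      rw [Units.inv_mul_eq_iff_eq_mul]
      conv_lhs => rw [hx']
      rw [mul_add, ← mul_assoc, hconj, mul_comm (c.linear hπ ha : E)]
    rw [this]
    exact add_mem (mul_mem (mul_mem (Subalgebra.algebraMap_mem _ _) (c.conj_mem_order hlin))
      (Subalgebra.algebraMap_mem _ _)) (Subalgebra.algebraMap_mem _ _)

lemma idx_linear : c.idx π (c.linear hπ ha) = Nat.card (IsLocalRing.ResidueField R) := by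
  rw [idx, addRelIndex_eq_card_range _ _ (fun x : E => IsLocalRing.residue R (c.intRe x) +
    IsLocalRing.residue R (c.intIm π 0 x) * IsLocalRing.residue R a)]
  · rw [← Nat.card_univ (α := IsLocalRing.ResidueField R)]
    congr 2
    rw [Set.eq_univ_iff_forall]
    intro s
    obtain ⟨b, rfl⟩ := IsLocalRing.residue_surjective s
    refine ⟨algebraMap R E b, Subalgebra.algebraMap_mem (c.order π 0) b, ?_⟩
    simp only [c.intRe_algebraMap, c.intIm_algebraMap hπ, map_zero, zero_mul, add_zero]
  · intro x hx y hy
    have hnx : -x ∈ c.order π 0 := neg_mem (S := Subalgebra R E) hx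
    rw [mem_mulMap_unit, mem_addOrder,
      c.inv_linear_mul_mem_iff hπ ha (add_mem (S := Subalgebra R E) hnx hy),
      c.intRe_add hnx hy, c.intIm_add hnx hy]
    have e1 := c.intRe_add hnx hx
    have e2 := c.intIm_add hnx hx
    rw [neg_add_cancel, ← map_zero (algebraMap R E), intRe_algebraMap] at e1
    rw [neg_add_cancel, ← map_zero (algebraMap R E), c.intIm_algebraMap hπ] at e2
    rw [eq_neg_of_add_eq_zero_left e1.symm, eq_neg_of_add_eq_zero_left e2.symm]
    simp only [map_add, map_neg]
    constructor
    · intro h; linear_combination -h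
    · intro h; linear_combination -h

end LinearFactor

end QuadCoord

lemma norm_natCast_cpow_neg_lt_one {n : ℕ} (hn : 1 < n) {s : ℂ} (hs : 0 < s.re) :
    ‖(n : ℂ) ^ (-s)‖ < 1 := by
  rw [Complex.norm_natCast_cpow_of_pos (by omega)]
  exact Real.rpow_lt_one_of_one_lt_of_neg (by exact_mod_cast hn) (by simpa using hs)

namespace QuadCoord

variable {R F E : Type*} [CommRing R] [Field F] [Algebra R F]
  [CommRing E] [Algebra F E] [Algebra R E] [IsScalarTower R F E]
  (c : QuadCoord R F E)
variable [IsDomain R] [IsDiscreteValuationRing R] [IsFractionRing R F]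
variable [Finite (IsLocalRing.ResidueField R)]

lemma pow_coe_mem {π : R} {p : Eˣ} (hp : (p : E) ∈ c.order π 0) (k : ℕ) :
    ((p ^ k : Eˣ) : E) ∈ c.order π 0 := by
  rw [Units.val_pow_eq_pow_val]
  exact pow_mem hp k

lemma idx_pow {π : R} {p : Eˣ} (hp : (p : E) ∈ c.order π 0) (k : ℕ) :
    c.idx π ((p ^ k : Eˣ) : E) = c.idx π p ^ k := by
  induction k with
  | zero => rw [pow_zero, c.idx_of_mem_unitGroup (one_mem (c.unitGroup π 0)), pow_zero]
  | succ k ih => rw [pow_succ', Units.val_mul, c.idx_mul hp (c.pow_coe_mem hp k), ih, pow_succ']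

lemma cpow_natCast_pow (n k : ℕ) (s : ℂ) : ((n ^ k : ℕ) : ℂ) ^ s = ((n : ℂ) ^ s) ^ k := by
  rw [Nat.cast_pow, ← Complex.natCast_cpow_natCast_mul, ← Complex.cpow_nat_mul]

lemma mk_eq_iff_unitGroup {π : R} {i : ℕ} {x y : Eˣ} :
    (QuotientGroup.mk x : Eˣ ⧸ c.unitGroup π i) = QuotientGroup.mk y ↔
      x⁻¹ * y ∈ c.unitGroup π i := QuotientGroup.eq

/-- If every non-unit of the maximal order is divisible by the single element `p`, then the
classes in `prinSet` are the powers of `p`. -/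
lemma hasSum_prinSet_zero_of_single {π : R} (hπ : Irreducible π) {p : Eˣ}
    (hp : (p : E) ∈ c.order π 0)
    (h1 : 1 < c.idx π p) (hdiv : ∀ x : Eˣ, (x : E) ∈ c.order π 0 → x ∈ c.unitGroup π 0 ∨
      ((p⁻¹ * x : Eˣ) : E) ∈ c.order π 0) {s : ℂ} (hs : 0 < s.re) :
    HasSum (fun x : c.prinSet π 0 => (c.prinIdx π 0 x : ℂ) ^ (-s))
      (1 - (c.idx π p : ℂ) ^ (-s))⁻¹ := by
  let f : ℕ → c.prinSet π 0 := fun k =>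
    ⟨QuotientGroup.mk (p ^ k), c.mk_mem_prinSet.mpr (c.pow_coe_mem hp k)⟩
  have hidx : ∀ k, c.prinIdx π 0 (f k) = c.idx π p ^ k := by
    intro k
    rw [c.prinIdx_mk (c.pow_coe_mem hp k), c.idx_pow hp]
  have hf : Function.Bijective f := by
    constructor
    · intro k l h
      have := hidx k
      rw [h, hidx l] at this
      exact (Nat.pow_right_injective h1 this).symm
    -- Descent on the index: division by `p` makes it strictly smaller.
    · have key : ∀ (n : ℕ) (x : Eˣ), (x : E) ∈ c.order π 0 → c.idx π x = n →
          ∃ k, p ^ k * x⁻¹ ∈ c.unitGroup π 0 := by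
        intro n
        induction n using Nat.strong_induction_on with | _ n ih =>
        intro x hx hn
        rcases hdiv x hx with h | h
        · exact ⟨0, by simpa using h⟩
        · have e := c.idx_mul hp h
          rw [← Units.val_mul, mul_inv_cancel_left, hn] at e
          have hne := c.idx_ne_zero hπ h
          obtain ⟨k, hk⟩ := ih _ (by
            rw [e]
            exact (Nat.lt_mul_iff_one_lt_left (Nat.pos_of_ne_zero hne)).mpr h1) _ h rfl
          refine ⟨k + 1, ?_⟩
          rw [_root_.mul_inv_rev, inv_inv] at hk
          rw [pow_succ]
          convert hk using 1
          rw [mul_assoc, mul_comm p]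
      rintro ⟨x, hx⟩
      induction x using QuotientGroup.induction_on with | H x =>
      obtain ⟨k, hk⟩ := key _ x (c.mk_mem_prinSet.mp hx) rfl
      refine ⟨k, Subtype.ext ((c.mk_eq_iff_unitGroup).mpr ?_)⟩
      rw [← inv_mem_iff, _root_.mul_inv_rev, inv_inv, mul_comm]
      exact hk
  rw [← (Equiv.ofBijective f hf).hasSum_iff]
  refine HasSum.congr_fun (fun k => ?_)
    (hasSum_geometric_of_norm_lt_one (norm_natCast_cpow_neg_lt_one h1 hs))
  simp only [Function.comp_apply, Equiv.ofBijective_apply, hidx]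
  rw [cpow_natCast_pow]

/-- The split case, with two prime elements. By `hcop` no power of `p'` is divisible by `p`, which
makes the exponent of `p` unique; the exponent of `p'` can then be read off the index. The double
series is a product of two geometric series. -/
lemma hasSum_prinSet_zero_of_pair {π : R} (hπ : Irreducible π) {p p' : Eˣ}
    (hp : (p : E) ∈ c.order π 0) (hp' : (p' : E) ∈ c.order π 0)
    (h1 : 1 < c.idx π p) (h1' : 1 < c.idx π p')
    (hdiv : ∀ x : Eˣ, (x : E) ∈ c.order π 0 → x ∈ c.unitGroup π 0 ∨
      ((p⁻¹ * x : Eˣ) : E) ∈ c.order π 0 ∨ ((p'⁻¹ * x : Eˣ) : E) ∈ c.order π 0)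
    (hcop : ∀ k : ℕ, ((p⁻¹ * p' ^ k : Eˣ) : E) ∉ c.order π 0) {s : ℂ} (hs : 0 < s.re) :
    HasSum (fun x : c.prinSet π 0 => (c.prinIdx π 0 x : ℂ) ^ (-s))
      ((1 - (c.idx π p : ℂ) ^ (-s))⁻¹ * (1 - (c.idx π p' : ℂ) ^ (-s))⁻¹) := by
  have hmem : ∀ k l : ℕ, ((p ^ k * p' ^ l : Eˣ) : E) ∈ c.order π 0 := by
    intro k l
    rw [Units.val_mul]
    exact mul_mem (c.pow_coe_mem hp k) (c.pow_coe_mem hp' l)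
  let f : ℕ × ℕ → c.prinSet π 0 := fun k =>
    ⟨QuotientGroup.mk (p ^ k.1 * p' ^ k.2), c.mk_mem_prinSet.mpr (hmem _ _)⟩
  have hidx : ∀ k, c.prinIdx π 0 (f k) = c.idx π p ^ k.1 * c.idx π p' ^ k.2 := by
    intro k
    rw [c.prinIdx_mk (hmem _ _), Units.val_mul, c.idx_mul (c.pow_coe_mem hp _)
      (c.pow_coe_mem hp' _), c.idx_pow hp, c.idx_pow hp']
  -- If k' = k + j + 1, then cancelling pᵏ would make p divide p'^l.
  have hle : ∀ k l k' l' : ℕ, (p ^ k * p' ^ l)⁻¹ * (p ^ k' * p' ^ l') ∈ c.unitGroup π 0 →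
      k' ≤ k := by
    intro k l k' l' h
    by_contra hlt
    obtain ⟨j, rfl⟩ := Nat.exists_eq_add_of_lt (not_le.mp hlt)
    apply hcop l
    have := mul_mem (hmem j l') h.2
    convert this using 1
    rw [← Units.val_mul]
    congr 1
    rw [inv_mul_eq_iff_eq_mul, ← mul_assoc, eq_mul_inv_iff_mul_eq, pow_succ, pow_add]
    simp only [_root_.mul_inv_rev, mul_assoc, mul_inv_cancel_left, inv_mul_cancel_left]
    rw [mul_left_comm]
  have hf : Function.Bijective f := by
    constructor
    · rintro ⟨k, l⟩ ⟨k', l'⟩ h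
      have h2 := (c.mk_eq_iff_unitGroup).mp (congrArg Subtype.val h)
      have h3 := (c.mk_eq_iff_unitGroup).mp (congrArg Subtype.val h.symm)
      have hk : k = k' := le_antisymm (hle _ _ _ _ h3) (hle _ _ _ _ h2)
      subst hk
      have := hidx (k, l)
      rw [h, hidx] at this
      have h4 := Nat.eq_of_mul_eq_mul_left (pow_pos (by omega) _) this
      exact Prod.ext rfl (Nat.pow_right_injective h1' h4).symm
    · have key : ∀ (n : ℕ) (x : Eˣ), (x : E) ∈ c.order π 0 → c.idx π x = n →
          ∃ k l, p ^ k * p' ^ l * x⁻¹ ∈ c.unitGroup π 0 := by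
        intro n
        induction n using Nat.strong_induction_on with | _ n ih =>
        intro x hx hn
        have step : ∀ p₀ : Eˣ, (p₀ : E) ∈ c.order π 0 → 1 < c.idx π p₀ →
            ((p₀⁻¹ * x : Eˣ) : E) ∈ c.order π 0 →
              ∃ k l, p ^ k * p' ^ l * (p₀⁻¹ * x)⁻¹ ∈ c.unitGroup π 0 := by
          intro p₀ hp₀ hlt h
          have e := c.idx_mul hp₀ h
          rw [← Units.val_mul, mul_inv_cancel_left, hn] at e
          have hne := c.idx_ne_zero hπ h
          exact ih _ (by
            rw [e]
            exact (Nat.lt_mul_iff_one_lt_left (Nat.pos_of_ne_zero hne)).mpr hlt) _ h rfl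
        rcases hdiv x hx with h | h | h
        · exact ⟨0, 0, by simpa using h⟩
        · obtain ⟨k, l, hk⟩ := step p hp h1 h
          refine ⟨k + 1, l, ?_⟩
          convert hk using 1
          rw [_root_.mul_inv_rev, inv_inv, pow_succ, mul_comm x⁻¹ p, ← mul_assoc,
            mul_right_comm (p ^ k)]
        · obtain ⟨k, l, hk⟩ := step p' hp' h1' h
          refine ⟨k, l + 1, ?_⟩
          convert hk using 1
          rw [_root_.mul_inv_rev, inv_inv, pow_succ, mul_comm x⁻¹ p', ← mul_assoc, ← mul_assoc]
      rintro ⟨x, hx⟩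
      induction x using QuotientGroup.induction_on with | H x =>
      obtain ⟨k, l, hk⟩ := key _ x (c.mk_mem_prinSet.mp hx) rfl
      refine ⟨(k, l), Subtype.ext ((c.mk_eq_iff_unitGroup).mpr ?_)⟩
      rw [← inv_mem_iff, _root_.mul_inv_rev, inv_inv, mul_comm]
      exact hk
  rw [← (Equiv.ofBijective f hf).hasSum_iff]
  have g1 := hasSum_geometric_of_norm_lt_one (norm_natCast_cpow_neg_lt_one h1 hs)
  have g2 := hasSum_geometric_of_norm_lt_one (norm_natCast_cpow_neg_lt_one h1' hs)
  refine HasSum.congr_fun (fun k => ?_)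
    (g1.mul g2 (summable_mul_of_summable_norm g1.summable.norm g2.summable.norm))
  simp only [Function.comp_apply, Equiv.ofBijective_apply, hidx]
  rw [Nat.cast_mul, Complex.natCast_mul_natCast_cpow, cpow_natCast_pow, cpow_natCast_pow]

lemma mem_unitGroup_or_norm {π : R} {x : Eˣ} (hx : (x : E) ∈ c.order π 0) :
    x ∈ c.unitGroup π 0 ∨ IsLocalRing.residue R (c.intRe (x : E)) ^ 2 + IsLocalRing.residue R c.t *
      IsLocalRing.residue R (c.intRe (x : E)) * IsLocalRing.residue R (c.intIm π 0 (x : E)) +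
      IsLocalRing.residue R c.m * IsLocalRing.residue R (c.intIm π 0 (x : E)) ^ 2 = 0 := by
  by_cases h : IsUnit (c.intRe (x : E) ^ 2 + c.t * c.intRe (x : E) * (π ^ 0 * c.intIm π 0 (x : E)) +
      c.m * (π ^ 0 * c.intIm π 0 (x : E)) ^ 2)
  · exact .inl (c.mem_unitGroup_of_norm hx h (c.norm_eq hx).symm)
  · right
    rw [← IsLocalRing.residue_ne_zero_iff_isUnit, not_not] at h
    simpa using h

/-- In the inert case, non-units of the maximal order are divisible by the uniformizer. -/
lemma mem_unitGroup_or_of_residueRoots_empty {π : R} (hπ : Irreducible π)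
    (h0 : c.residueRoots = ∅) {x : Eˣ} (hx : (x : E) ∈ c.order π 0) :
    x ∈ c.unitGroup π 0 ∨ (((unif F E hπ)⁻¹ * x : Eˣ) : E) ∈ c.order π 0 := by
  refine (c.mem_unitGroup_or_norm hx).imp_right fun h => ?_
  have hb : IsLocalRing.residue R (c.intIm π 0 (x : E)) = 0 := by
    by_contra hb
    have : -IsLocalRing.residue R (c.intRe (x : E)) / IsLocalRing.residue R (c.intIm π 0 (x : E)) ∈
        c.residueRoots := by
      simp only [residueRoots, Set.mem_ofPred_eq]
      field_simp
      linear_combination h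
    rw [h0] at this
    exact this
  have ha : IsLocalRing.residue R (c.intRe (x : E)) = 0 := by
    simpa [hb] using h
  obtain ⟨a, ha⟩ := (residue_eq_zero_iff_dvd hπ).mp ha
  obtain ⟨b, hb⟩ := (residue_eq_zero_iff_dvd hπ).mp hb
  have e : (x : E) = unif F E hπ * c.elt (algebraMap R F a) (algebraMap R F (π ^ 0 * b)) := by
    rw [coe_unif]
    apply c.ext_re_im
    · rw [re_algebraMap_mul, re_elt, ← map_mul, ← ha, c.algebraMap_intRe hx]
    · rw [im_algebraMap_mul, im_elt, ← map_mul, ← c.algebraMap_intIm hx, hb]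
      congr 1; ring
  rw [Units.val_mul, e, Units.inv_mul_cancel_left]
  exact c.elt_mem_order _ _

/-- Modulo π the norm form factors as (re + a im)(re + a' im), and each linear factor tests
divisibility by one of the two prime elements. -/
lemma mem_unitGroup_or_of_root {π : R} (hπ : Irreducible π) {a a' : R} {u u' : Rˣ}
    (ha : a ^ 2 - c.t * a + c.m = π * u) (ha' : a' ^ 2 - c.t * a' + c.m = π * u')
    (haa' : IsLocalRing.residue R a + IsLocalRing.residue R a' = IsLocalRing.residue R c.t)
    {x : Eˣ} (hx : (x : E) ∈ c.order π 0) :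
    x ∈ c.unitGroup π 0 ∨ (((c.linear hπ ha)⁻¹ * x : Eˣ) : E) ∈ c.order π 0 ∨
      (((c.linear hπ ha')⁻¹ * x : Eˣ) : E) ∈ c.order π 0 := by
  refine (c.mem_unitGroup_or_norm hx).imp_right fun h => ?_
  rw [Units.val_mul, Units.val_mul, c.inv_linear_mul_mem_iff hπ ha hx,
    c.inv_linear_mul_mem_iff hπ ha' hx, ← mul_eq_zero]
  have hr := c.residue_mem_residueRoots hπ ha
  simp only [residueRoots, Set.mem_ofPred_eq] at hr
  linear_combination h + (IsLocalRing.residue R (c.intRe (x : E)) *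
    IsLocalRing.residue R (c.intIm π 0 (x : E)) + IsLocalRing.residue R (c.intIm π 0 (x : E)) ^ 2 *
    IsLocalRing.residue R a) * haa' - IsLocalRing.residue R (c.intIm π 0 (x : E)) ^ 2 * hr

/-- The zeta function of the maximal order. -/
theorem hasSum_prinSet_zero {π : R} (hπ : Irreducible π) {s : ℂ} (hs : 0 < s.re) :
    HasSum (fun x : c.prinSet π 0 => (c.prinIdx π 0 x : ℂ) ^ (-s))
      ((1 - (Nat.card (IsLocalRing.ResidueField R) : ℂ) ^ (-s)) *
        (1 - ((c.residueRoots.ncard : ℂ) - 1) *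
          (Nat.card (IsLocalRing.ResidueField R) : ℂ) ^ (-s)))⁻¹ := by
  have hq := one_lt_card_residueField (R := R)
  -- With u = q^(-s), the factor (1 - u)(1 - (r - 1)u) is 1 - u² for no root (prime element π of
  -- index q²), 1 - u for a double root and (1 - u)² for two roots (prime elements of index q).
  rcases c.residueRoots.eq_empty_or_nonempty with h0 | ⟨ρ, hρ⟩
  · have h := c.hasSum_prinSet_zero_of_single hπ (c.unif_mem_order hπ 0)
      (by rw [c.idx_unif hπ]; exact Nat.one_lt_pow two_ne_zero hq)
      (fun x hx => c.mem_unitGroup_or_of_residueRoots_empty hπ h0 hx) hs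
    rw [c.idx_unif hπ, cpow_natCast_pow] at h
    convert h using 2
    rw [h0, Set.ncard_empty, Nat.cast_zero]
    ring
  · obtain ⟨a, u, har, ha⟩ := c.exists_lift_root hπ hρ
    have ha' : (c.t - a) ^ 2 - c.t * (c.t - a) + c.m = π * u := by
      rw [← ha]; ring
    have hsum : IsLocalRing.residue R a + IsLocalRing.residue R (c.t - a) =
        IsLocalRing.residue R c.t := by rw [← map_add]; congr 1; ring
    have hpair := c.residueRoots_eq_pair hρ
    by_cases heq : ρ = IsLocalRing.residue R c.t - ρ
    · have h := c.hasSum_prinSet_zero_of_single hπ (p := c.linear hπ ha) c.linear_mem_order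
        (by rw [c.idx_linear]; exact hq) (fun x hx => by
          refine (c.mem_unitGroup_or_of_root hπ ha ha' hsum hx).imp_right fun h => ?_
          rcases h with h | h
          · exact h
          · rw [Units.val_mul, c.inv_linear_mul_mem_iff hπ ha hx]
            rw [Units.val_mul, c.inv_linear_mul_mem_iff hπ ha' hx] at h
            rw [map_sub, har, ← heq] at h
            rw [har]
            exact h) hs
      rw [c.idx_linear] at h
      convert h using 2
      rw [hpair, ← heq, Set.pair_eq_singleton, Set.ncard_singleton, Nat.cast_one]
      ring
    · have h := c.hasSum_prinSet_zero_of_pair hπ (p := c.linear hπ ha) (p' := c.linear hπ ha')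
        c.linear_mem_order c.linear_mem_order
        (by rw [c.idx_linear]; exact hq) (by rw [c.idx_linear]; exact hq)
        (fun x hx => c.mem_unitGroup_or_of_root hπ ha ha' hsum hx) (fun k hk => by
          -- Evaluation at ρ kills the multiples of the first prime element and sends the second one
          -- to 2ρ - t, which is nonzero for distinct roots.
          have hm := c.pow_coe_mem (π := π) (p := c.linear hπ ha') c.linear_mem_order k
          rw [Units.val_mul, c.inv_linear_mul_mem_iff hπ ha hm] at hk
          have hlin : (c.linear hπ ha' : E) ∈ integralClosure R E := by
            rw [← c.order_zero π]; exact c.linear_mem_order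
          have e := map_pow (c.evalHom hπ (c.residue_mem_residueRoots hπ ha)) ⟨_, hlin⟩ k
          rw [evalHom_apply, evalHom_apply] at e
          simp only [SubmonoidClass.mk_pow] at e
          rw [← Units.val_pow_eq_pow_val, hk] at e
          have e' := eq_zero_of_pow_eq_zero e.symm
          have h1 : (c.linear hπ ha' : E) =
              c.elt (algebraMap R F (-(c.t - a))) (algebraMap R F (π ^ 0 * 1)) := by
            rw [coe_linear]; simp
          have h2 := c.intRe_elt (-(c.t - a)) (algebraMap R F (π ^ 0 * 1))
          have h3 := c.intIm_elt hπ 0 (algebraMap R F (-(c.t - a))) 1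
          rw [← h1] at h2 h3
          rw [h2, h3, har, map_neg, map_sub, har, map_one, one_mul] at e'
          apply heq
          linear_combination e') hs
      rw [c.idx_linear, c.idx_linear] at h
      have e : (c.residueRoots.ncard : ℂ) - 1 = 1 := by
        rw [hpair, Set.ncard_pair heq]
        norm_num
      rw [e, one_mul, mul_inv]
      exact h

end QuadCoord

/-! ### The local factor and the normalised zeta functions -/

/-- The local factor `q^(ns) ∑_{j ≤ n} q^(j(1-2s)) (1 - χ q^(-s))^[j < n]`. -/
noncomputable def localFactor (q n : ℕ) (χ : ℂ) (s : ℂ) : ℂ :=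
  (q : ℂ) ^ ((n : ℂ) * s) * ∑ j ∈ Finset.range (n + 1), ((q : ℂ) ^ (1 - 2 * s)) ^ j *
    (if j = n then 1 else 1 - χ * (q : ℂ) ^ (-s))

lemma differentiable_localFactor {q : ℕ} (hq : q ≠ 0) (n : ℕ) (χ : ℂ) :
    Differentiable ℂ (localFactor q n χ) := by
  have hq' : (q : ℂ) ≠ 0 := Nat.cast_ne_zero.mpr hq
  have h : ∀ f : ℂ → ℂ, Differentiable ℂ f → Differentiable ℂ fun s => (q : ℂ) ^ f s :=
    fun f hf => hf.const_cpow (Or.inl hq')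
  unfold localFactor
  refine (h _ (by fun_prop)).mul (Differentiable.fun_sum fun j _ => ?_)
  refine ((h _ (by fun_prop)).pow j).mul ?_
  split_ifs
  · fun_prop
  · exact (differentiable_const _).sub ((differentiable_const _).mul (h _ (by fun_prop)))

/-- The recursion for the sums over principal ideals. -/
lemma sum_recursion_eq {q Q u χ : ℂ} (hQ : Q * u = 1) {P : ℕ → ℂ}
    (hV : (1 - u) * (1 - χ * u) ≠ 0)
    (h0 : P 0 = ((1 - u) * (1 - χ * u))⁻¹) (h1 : P 1 = 1 + (q - χ) * (u ^ 2 * P 0))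
    (hP : ∀ i ≠ 0, P (i + 1) = 1 + q * (u ^ 2 * P i)) (n : ℕ) :
    Q ^ n * ((1 - u) * (1 - χ * u)) * ∑ i ∈ Finset.range (n + 1), u ^ (n - i) * P i =
      Q ^ n * ∑ j ∈ Finset.range (n + 1), (q * u ^ 2) ^ j * (if j = n then 1 else 1 - χ * u) := by
  set V := (1 - u) * (1 - χ * u) with hVdef
  have hVP : V * P 0 = 1 := by rw [h0, mul_inv_cancel₀ hV]
  -- Since Q u = 1, the left side is the sum of the D i. The right side G satisfies a first-order
  -- recursion, and the sum is recovered by telescoping.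
  let D : ℕ → ℂ := fun i => Q ^ i * V * P i
  let G : ℕ → ℂ := fun n => Q ^ n * ∑ j ∈ Finset.range (n + 1), (q * u ^ 2) ^ j *
    (if j = n then 1 else 1 - χ * u)
  have hL : ∀ n, Q ^ n * V * ∑ i ∈ Finset.range (n + 1), u ^ (n - i) * P i =
      ∑ i ∈ Finset.range (n + 1), D i := by
    intro n
    rw [Finset.mul_sum]
    refine Finset.sum_congr rfl fun i hi => ?_
    obtain ⟨k, rfl⟩ := Nat.exists_eq_add_of_le (Nat.lt_succ_iff.mp (Finset.mem_range.mp hi))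
    rw [Nat.add_sub_cancel_left, pow_add]
    have : Q ^ k * u ^ k = 1 := by rw [← mul_pow, hQ, one_pow]
    simp only [D]
    linear_combination (Q ^ i * V * P i) * this
  have hG0 : G 0 = 1 := by simp [G]
  have hG : ∀ n, G (n + 1) = Q ^ (n + 1) * (1 - χ * u) + q * u * G n := by
    intro n
    simp only [G]
    rw [Finset.sum_range_succ' _ (n + 1), mul_add, add_comm]
    congr 1
    · simp
    · rw [Finset.mul_sum, Finset.mul_sum, Finset.mul_sum]
      refine Finset.sum_congr rfl fun j _ => ?_
      rw [show (if j + 1 = n + 1 then (1 : ℂ) else 1 - χ * u) = if j = n then 1 else 1 - χ * u by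
        simp]
      rw [pow_succ, pow_succ]
      linear_combination (Q ^ n * q * u * (q * u ^ 2) ^ j *
        (if j = n then 1 else 1 - χ * u)) * hQ
  -- Both sides satisfy X(n + 1) = Q^(n+2) V + q u X(n), with X(n) standing for the n-th value of
  -- either side; for the differences of G this uses Q^(n+2)(1 - u) = Q^(n+2) - Q^(n+1).
  have hstep : ∀ n, G (n + 1) - G n = D (n + 1) := by
    intro n
    induction n with
    | zero =>
      rw [hG, hG0]
      simp only [D, zero_add, pow_one]
      rw [h1]
      linear_combination (1 - u * χ) * hQ - (q - χ) * u * V * P 0 * hQ - (q - χ) * u * hVP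
    | succ n ih =>
      have e : D (n + 2) = Q ^ (n + 2) * V + q * u * D (n + 1) := by
        simp only [D]
        rw [hP (n + 1) (Nat.succ_ne_zero n)]
        rw [pow_succ Q (n + 1)]
        linear_combination (Q ^ (n + 1) * V * q * u * P (n + 1)) * hQ
      rw [hG (n + 1), hG n, e, ← ih, hG n, hVdef, pow_succ Q (n + 1)]
      linear_combination (Q ^ (n + 1) * (1 - χ * u)) * hQ
  rw [hL]
  change _ = G n
  induction n with
  | zero => rw [hG0]; simp [D, hVP]
  | succ n ih => rw [Finset.sum_range_succ, ih, ← hstep]; ring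

namespace QuadCoord

variable {R F E : Type*} [CommRing R] [Field F] [Algebra R F]
  [CommRing E] [Algebra F E] [Algebra R E] [IsScalarTower R F E]
  (c : QuadCoord R F E)
variable [IsDomain R] [IsDiscreteValuationRing R] [IsFractionRing R F]

/-- The second coordinate modulo πⁿ identifies O_0 / O_n with R / πⁿ. -/
lemma colength_order {π : R} (hπ : Irreducible π) (n : ℕ) : colength (c.order π n) = n := by
  have hB : ∀ x : Subalgebra.toSubmodule (integralClosure R E), (x : E) ∈ c.order π 0 := fun x => by
    rw [order_zero]; exact x.2
  let f : Subalgebra.toSubmodule (integralClosure R E) →ₗ[R] R ⧸ Ideal.span {π ^ n} :=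
    { toFun := fun x => Ideal.Quotient.mk _ (c.intIm π 0 (x : E))
      map_add' := by
        intro x y
        rw [Submodule.coe_add, c.intIm_add (hB x) (hB y), map_add]
      map_smul' := by
        intro a x
        rw [SetLike.val_smul, Algebra.smul_def, c.intIm_mul (Subalgebra.algebraMap_mem _ _) (hB x),
          c.intRe_algebraMap, c.intIm_algebraMap hπ]
        simp only [zero_mul, add_zero, map_mul, RingHom.id_apply]
        rfl }
  have hf : Function.Surjective f := by
    intro s
    obtain ⟨b, rfl⟩ := Ideal.Quotient.mk_surjective s
    have hm := c.elt_mem_order (π := π) (i := 0) 0 b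
    rw [order_zero] at hm
    exact ⟨⟨_, hm⟩, congrArg _ (c.intIm_elt hπ 0 _ b)⟩
  have hker : (Subalgebra.toSubmodule (c.order π n)).submoduleOf
      (Subalgebra.toSubmodule (integralClosure R E)) = LinearMap.ker f := by
    ext x
    rw [LinearMap.mem_ker]
    change (x : E) ∈ c.order π n ↔ Ideal.Quotient.mk _ _ = 0
    rw [Ideal.Quotient.eq_zero_iff_mem, Ideal.mem_span_singleton]
    have h := c.algebraMap_intIm (hB x)
    constructor
    · rintro ⟨-, b, hb⟩
      rw [← h, pow_zero, one_mul] at hb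
      exact ⟨b, (IsFractionRing.injective R F hb).symm⟩
    · rintro ⟨b, hb⟩
      exact ⟨(hB x).1, b, by rw [← h, hb, pow_zero, one_mul]⟩
  rw [colength, hker, (f.quotKerEquivOfSurjective hf).length_eq]
  change (Ring.ord R (π ^ n)).toNat = n
  rw [Ring.ord_pow (mem_nonZeroDivisors_of_ne_zero hπ.ne_zero), Ring.ord_of_irreducible hπ]
  simp

lemma algebraMap_mem_of_isMaximal {π : R} (hπ : Irreducible π)
    (M : Ideal (integralClosure R E)) [M.IsMaximal] : algebraMap R (integralClosure R E) π ∈ M := by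
  have h : (M.comap (algebraMap R (integralClosure R E))).IsMaximal :=
    Ideal.isMaximal_comap_of_isIntegral_of_isMaximal M
  rw [← Ideal.mem_comap, IsLocalRing.eq_maximalIdeal h, hπ.maximalIdeal_eq]
  exact Ideal.mem_span_singleton_self π

/-- The kernel is generated by π, which lies in every maximal ideal, and by θ - a; it is maximal, so
inclusion is enough. -/
lemma ker_evalHom_eq_of_mem {π : R} (hπ : Irreducible π) {a : R}
    (ha : IsLocalRing.residue R a ∈ c.residueRoots) (M : Ideal (integralClosure R E))
    [M.IsMaximal]
    (hM : (⟨c.θ, c.θ_mem_integralClosure⟩ - algebraMap R (integralClosure R E) a :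
      integralClosure R E) ∈ M) : RingHom.ker (c.evalHom hπ ha) = M := by
  have hmax := RingHom.ker_isMaximal_of_surjective _ (c.evalHom_surjective hπ ha)
  refine hmax.eq_of_le Ideal.IsPrime.ne_top' fun x hx => ?_
  rw [RingHom.mem_ker, evalHom_apply, ← map_mul, ← map_add, residue_eq_zero_iff_dvd hπ] at hx
  obtain ⟨d, hd⟩ := hx
  have e : x = algebraMap R (integralClosure R E) π * algebraMap R _ d +
      algebraMap R _ (c.intIm π 0 (x : E)) *
        (⟨c.θ, c.θ_mem_integralClosure⟩ - algebraMap R (integralClosure R E) a) := by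
    apply Subtype.ext
    have hx := c.mem_order_of_integralClosure π x
    rw [← map_mul, ← hd]
    change (x : E) = algebraMap R E _ + algebraMap R E _ * (c.θ - algebraMap R E a)
    apply c.ext_re_im
    · rw [map_add, re_algebraMap_R, re_algebraMap_mul, map_sub, c.re_θ, re_algebraMap_R,
        ← c.algebraMap_intRe hx]
      simp only [map_add, map_mul]; ring
    · rw [map_add, im_algebraMap_R, im_algebraMap_mul, map_sub, c.im_θ, im_algebraMap_R,
        ← c.algebraMap_intIm hx]
      simp
  rw [e]
  exact M.add_mem (M.mul_mem_right _ (algebraMap_mem_of_isMaximal hπ M)) (M.mul_mem_left _ hM)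

variable [Finite (IsLocalRing.ResidueField R)]

/-- The maximal ideals of the maximal order belong to the roots of `X² - t X + m`, if any. -/
lemma maximalSpectrum_bijective {π : R} (hπ : Irreducible π) (hne : c.residueRoots.Nonempty) :
    Function.Bijective (fun ρ : c.residueRoots =>
      (⟨RingHom.ker (c.evalHom hπ ρ.2), RingHom.ker_isMaximal_of_surjective _
        (c.evalHom_surjective hπ ρ.2)⟩ : MaximalSpectrum (integralClosure R E))) := by
  constructor
  · rintro ⟨ρ, hρ⟩ ⟨σ, hσ⟩ h
    have h1 : RingHom.ker (c.evalHom hπ hρ) = RingHom.ker (c.evalHom hπ hσ) :=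
      congrArg MaximalSpectrum.asIdeal h
    obtain ⟨a, rfl⟩ := IsLocalRing.residue_surjective ρ
    have h2 : (⟨c.θ, c.θ_mem_integralClosure⟩ - algebraMap R (integralClosure R E) a :
      integralClosure R E) ∈ RingHom.ker (c.evalHom hπ hσ) := by
      rw [← h1, RingHom.mem_ker, map_sub, evalHom_θ, evalHom_algebraMap, sub_self]
    rw [RingHom.mem_ker, map_sub, evalHom_θ, evalHom_algebraMap, sub_eq_zero] at h2
    exact Subtype.ext h2.symm
  · rintro ⟨M, hM⟩
    obtain ⟨ρ, hρ⟩ := hne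
    obtain ⟨a, rfl⟩ := IsLocalRing.residue_surjective ρ
    have hρ' := c.sub_mem_residueRoots hρ
    rw [← map_sub] at hρ'
    have hmul : (⟨c.θ, c.θ_mem_integralClosure⟩ - algebraMap R (integralClosure R E) a) *
        (⟨c.θ, c.θ_mem_integralClosure⟩ - algebraMap R (integralClosure R E) (c.t - a)) ∈ M := by
      have hd := hρ
      simp only [residueRoots, Set.mem_ofPred_eq, ← map_mul, ← map_pow, ← map_sub, ← map_add] at hd
      obtain ⟨d, hd⟩ := (residue_eq_zero_iff_dvd hπ).mp hd
      have e : (⟨c.θ, c.θ_mem_integralClosure⟩ - algebraMap R (integralClosure R E) a) *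
          (⟨c.θ, c.θ_mem_integralClosure⟩ - algebraMap R (integralClosure R E) (c.t - a)) =
          algebraMap R _ π * -algebraMap R _ d := by
        rw [mul_neg, ← map_mul, ← hd]
        apply Subtype.ext
        change (c.θ - algebraMap R E a) * (c.θ - algebraMap R E (c.t - a)) = -algebraMap R E _
        simp only [map_sub, map_add, map_mul, map_pow]
        linear_combination c.θ_mul
      rw [e]
      exact M.mul_mem_right _ (algebraMap_mem_of_isMaximal hπ M)
    rcases hM.isPrime.mem_or_mem hmul with h | h
    · exact ⟨⟨_, hρ⟩, MaximalSpectrum.ext (c.ker_evalHom_eq_of_mem hπ hρ M h)⟩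
    · exact ⟨⟨_, hρ'⟩, MaximalSpectrum.ext (c.ker_evalHom_eq_of_mem hπ hρ' M h)⟩

/-- In the inert case the uniformizer generates a maximal ideal. -/
lemma isMaximal_span_of_residueRoots_empty {π : R} (hπ : Irreducible π) (h0 : c.residueRoots = ∅) :
    (Ideal.span {algebraMap R (integralClosure R E) π}).IsMaximal := by
  rw [Ideal.isMaximal_iff]
  constructor
  · intro h
    rw [Ideal.mem_span_singleton] at h
    obtain ⟨y, hy⟩ := h
    have hy' : (1 : E) = algebraMap R E π * y := congrArg Subtype.val hy
    have h1 := congrArg c.re hy'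
    rw [re_algebraMap_mul, c.re_one, ← c.algebraMap_intRe (c.mem_order_of_integralClosure π y),
      ← map_mul, ← map_one (algebraMap R F)] at h1
    exact hπ.not_isUnit (IsUnit.of_mul_eq_one _ (IsFractionRing.injective R F h1).symm)
  · intro J x hJ hx hxJ
    have hxm := c.mem_order_of_integralClosure π x
    -- Elements of norm zero are not units of `E` and need a separate argument: the norm form has no
    -- nontrivial zero modulo π, so they are divisible by π.
    by_cases hN : c.norm (x : E) = 0
    · exfalso
      apply hx
      rw [c.norm_eq hxm, map_eq_zero_iff _ (IsFractionRing.injective R F)] at hN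
      have hN' := congrArg (IsLocalRing.residue R) hN
      simp only [pow_zero, one_mul, map_add, map_mul, map_pow, map_zero] at hN'
      have hb : IsLocalRing.residue R (c.intIm π 0 (x : E)) = 0 := by
        by_contra hb
        have : -IsLocalRing.residue R (c.intRe (x : E)) /
            IsLocalRing.residue R (c.intIm π 0 (x : E)) ∈ c.residueRoots := by
          simp only [residueRoots, Set.mem_ofPred_eq]
          field_simp
          linear_combination hN'
        rw [h0] at this
        exact this
      have ha : IsLocalRing.residue R (c.intRe (x : E)) = 0 := by
        simpa [hb] using hN'
      obtain ⟨a, ha⟩ := (residue_eq_zero_iff_dvd hπ).mp ha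
      obtain ⟨b, hb⟩ := (residue_eq_zero_iff_dvd hπ).mp hb
      have hm := c.elt_mem_order (π := π) (i := 0) a b
      rw [order_zero] at hm
      rw [Ideal.mem_span_singleton]
      refine ⟨⟨_, hm⟩, Subtype.ext ?_⟩
      change (x : E) = algebraMap R E π * _
      apply c.ext_re_im
      · rw [re_algebraMap_mul, re_elt, ← map_mul, ← ha, c.algebraMap_intRe hxm]
      · rw [im_algebraMap_mul, im_elt, ← map_mul, ← c.algebraMap_intIm hxm, hb]
        congr 1; ring
    · obtain ⟨y, hy⟩ := c.isUnit_of_norm_ne_zero hN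
      rw [← hy] at hxm
      rcases c.mem_unitGroup_or_of_residueRoots_empty hπ h0 hxm with h | h
      · have h2 := h.2
        rw [order_zero] at h2
        have := J.mul_mem_right ⟨_, h2⟩ hxJ
        convert this using 1
        apply Subtype.ext
        rw [Subalgebra.coe_mul, ← hy]
        simp
      · exfalso
        apply hx
        rw [order_zero] at h
        rw [Ideal.mem_span_singleton]
        refine ⟨⟨_, h⟩, Subtype.ext ?_⟩
        change (x : E) = (unif F E hπ : E) * ((((unif F E hπ)⁻¹ * y : Eˣ)) : E)
        rw [← Units.val_mul, mul_inv_cancel_left, hy]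

lemma card_quotient_span_unif (c : QuadCoord R F E) {π : R} (hπ : Irreducible π) :
    Nat.card (integralClosure R E ⧸ Ideal.span {algebraMap R (integralClosure R E) π}) =
      Nat.card (IsLocalRing.ResidueField R) ^ 2 := by
  rw [card_quotient_eq_relIndex _ _ (mulMap (unif F E hπ : E) (c.addOrder π 0)), ← c.idx_unif hπ,
    ← c.order_zero π]
  · rfl
  · intro y
    rw [Ideal.mem_span_singleton, mem_mulMap]
    constructor
    · rintro ⟨z, hz⟩
      exact ⟨z, c.mem_order_of_integralClosure π z, (congrArg Subtype.val hz).symm⟩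
    · rintro ⟨z, hz, hzy⟩
      have hz' : z ∈ integralClosure R E := by rw [← c.order_zero π]; exact hz
      exact ⟨⟨z, hz'⟩, Subtype.ext hzy.symm⟩

/-- Without residue roots, π generates the only maximal ideal and its residue ring has q² elements.
Otherwise the maximal ideals correspond to the roots and each residue ring is the residue field of
`R`. -/
theorem vFactor_eq {π : R} (hπ : Irreducible π) (s : ℂ) : vFactor R E s =
    (1 - (Nat.card (IsLocalRing.ResidueField R) : ℂ) ^ (-s)) *
      (1 - ((c.residueRoots.ncard : ℂ) - 1) *
        (Nat.card (IsLocalRing.ResidueField R) : ℂ) ^ (-s)) := by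
  rcases c.residueRoots.eq_empty_or_nonempty with h0 | hne
  · have hmax := c.isMaximal_span_of_residueRoots_empty hπ h0
    have huniq : ∀ M : MaximalSpectrum (integralClosure R E), M = ⟨_, hmax⟩ := by
      rintro ⟨M, hM⟩
      refine MaximalSpectrum.ext (hmax.eq_of_le hM.ne_top ?_).symm
      rw [Ideal.span_singleton_le_iff_mem]
      exact algebraMap_mem_of_isMaximal hπ M
    rw [vFactor, finprod_eq_single _ ⟨_, hmax⟩ (fun M hM => absurd (huniq M) hM),
      c.card_quotient_span_unif hπ, cpow_natCast_pow, h0, Set.ncard_empty, Nat.cast_zero]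
    ring
  · have hbij := c.maximalSpectrum_bijective hπ hne
    rw [vFactor, ← finprod_eq_of_bijective (f := fun _ : c.residueRoots =>
      1 - (Nat.card (IsLocalRing.ResidueField R) : ℂ) ^ (-s)) _ hbij]
    · have := Fintype.ofFinite c.residueRoots
      rw [finprod_eq_prod_of_fintype, Finset.prod_const, Finset.card_univ,
        ← Nat.card_eq_fintype_card, Nat.card_coe_set_eq]
      obtain ⟨ρ, hρ⟩ := hne
      rw [c.residueRoots_eq_pair hρ]
      by_cases heq : ρ = IsLocalRing.residue R c.t - ρ
      · rw [← heq, Set.pair_eq_singleton, Set.ncard_singleton]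
        simp
      · rw [Set.ncard_pair heq]
        push_cast
        ring
    · rintro ⟨ρ, hρ⟩
      rw [Nat.card_congr (RingHom.quotientKerEquivOfSurjective
        (c.evalHom_surjective hπ hρ)).toEquiv]

lemma residueRoots_ncard_le_two : c.residueRoots.ncard ≤ 2 := by
  rcases c.residueRoots.eq_empty_or_nonempty with h0 | ⟨ρ, hρ⟩
  · simp [h0]
  · rw [c.residueRoots_eq_pair hρ]
    exact Set.ncard_insert_le _ _ |>.trans (by simp)

/-- The normalised zeta function of the order `O_n`. -/
theorem isNormalizedZeta_order {π : R} (hπ : Irreducible π) (n : ℕ) :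
    IsNormalizedZeta (Nat.card (IsLocalRing.ResidueField R)) (c.order π n)
      (localFactor (Nat.card (IsLocalRing.ResidueField R)) n ((c.residueRoots.ncard : ℂ) - 1)) := by
  have hq := one_lt_card_residueField (R := R)
  have hq0 : (Nat.card (IsLocalRing.ResidueField R) : ℂ) ≠ 0 :=
    Nat.cast_ne_zero.mpr (by omega)
  refine ⟨differentiable_localFactor (by omega) _ _, fun s hs => ?_⟩
  have hrel := c.relIndex_unitGroup_one hπ
  have hr2 := c.residueRoots_ncard_le_two
  set q := Nat.card (IsLocalRing.ResidueField R) with hqdef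
  set r := c.residueRoots.ncard with hrdef
  set u : ℂ := (q : ℂ) ^ (-s) with hu
  set V : ℂ := (1 - u) * (1 - ((r : ℂ) - 1) * u) with hVdef
  have hfin : ∀ i, (c.unitGroup π (i + 1)).relIndex (c.unitGroup π i) ≠ 0 := by
    intro i
    rcases eq_or_ne i 0 with rfl | hi
    · rw [zero_add]; omega
    · rw [c.relIndex_unitGroup_succ hπ hi]; omega
  -- The sums over principal ideals, generated by the recursion from 1/V for the maximal order.
  let P : ℕ → ℂ := fun i => Nat.rec V⁻¹
    (fun i p => 1 + (c.unitGroup π (i + 1)).relIndex (c.unitGroup π i) * (u ^ 2 * p)) i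
  have hP : ∀ i, HasSum (fun x : c.prinSet π i => (c.prinIdx π i x : ℂ) ^ (-s)) (P i) := by
    intro i
    induction i with
    | zero => exact c.hasSum_prinSet_zero hπ hs
    | succ i ih => exact c.hasSum_prinSet_succ hπ (hfin i) ih
  have hsum := c.hasSum_order hπ n (fun i _ => hP i)
  refine ⟨hsum.summable, ?_⟩
  rw [c.colength_order hπ, c.vFactor_eq hπ, orderZeta, hsum.tsum_eq]
  have hunorm : ‖u‖ < 1 := norm_natCast_cpow_neg_lt_one hq hs
  -- From |u| < 1 and |r - 1| ≤ 1; it guarantees that V really cancels the value 1/V of the maximal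
  -- order.
  have hV : V ≠ 0 := by
    refine mul_ne_zero ?_ ?_
    · intro h
      rw [← sub_eq_zero.mp h, NormOneClass.norm_one] at hunorm
      exact lt_irrefl _ hunorm
    · intro h
      have h1 : ‖((r : ℂ) - 1) * u‖ = 1 := by rw [← sub_eq_zero.mp h, NormOneClass.norm_one]
      have h2 : ‖(r : ℂ) - 1‖ ≤ 1 := by
        interval_cases r <;> norm_num
      rw [_root_.norm_mul] at h1
      nlinarith [norm_nonneg u, norm_nonneg ((r : ℂ) - 1)]
  have hQ : (q : ℂ) ^ s * u = 1 := by
    rw [hu, ← Complex.cpow_add _ _ hq0, add_neg_cancel, Complex.cpow_zero]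
  have key := sum_recursion_eq (q := q) (χ := (r : ℂ) - 1) hQ hV (P := P) rfl (by
      change 1 + (((c.unitGroup π 1).relIndex (c.unitGroup π 0) : ℕ) : ℂ) * _ = _
      congr 2
      have : (((c.unitGroup π 1).relIndex (c.unitGroup π 0) : ℕ) : ℂ) + r = q + 1 := by
        exact_mod_cast hrel
      linear_combination this) (by
      intro i hi
      change 1 + (((c.unitGroup π (i + 1)).relIndex (c.unitGroup π i) : ℕ) : ℂ) * _ = _
      rw [c.relIndex_unitGroup_succ hπ hi]) n
  rw [localFactor, Complex.cpow_nat_mul]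
  have hqu : (q : ℂ) ^ (1 - 2 * s) = q * u ^ 2 := by
    rw [Complex.cpow_sub _ _ hq0, Complex.cpow_one, hu, ← Complex.cpow_nat_mul, div_eq_mul_inv,
      ← Complex.cpow_neg]
    congr 2
    push_cast; ring
  rw [hqu]
  exact key.symm

end QuadCoord

/-- Two candidates agree on the half-plane, a neighbourhood of 1, hence everywhere by the identity
theorem. So the chosen function is the explicit one. -/
lemma IsNormalizedZeta.normalizedZeta_eq {R L : Type*} [CommRing R] [CommRing L] [Algebra R L]
    {q : ℕ} {O : Subalgebra R L} {J : ℂ → ℂ} (hJ : IsNormalizedZeta q O J) :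
    normalizedZeta q O = J := by
  have hex : ∃ J, IsNormalizedZeta q O J := ⟨J, hJ⟩
  rw [normalizedZeta, dif_pos hex]
  have h := hex.choose_spec
  have h1 : AnalyticOnNhd ℂ hex.choose Set.univ := fun x _ => h.1.analyticAt x
  have h2 : AnalyticOnNhd ℂ J Set.univ := fun x _ => hJ.1.analyticAt x
  refine h1.eq_of_eventuallyEq h2 (z₀ := 1) ?_
  have hopen : IsOpen {s : ℂ | 0 < s.re} := isOpen_lt continuous_const Complex.continuous_re
  filter_upwards [hopen.mem_nhds (by simp : (1 : ℂ) ∈ {s : ℂ | 0 < s.re})] with s hs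
  rw [(h.2 s hs).2, (hJ.2 s hs).2]

/-! ### The quotient measure and volumes of double cosets -/

section QuotientMeasure

variable {G : Type*} [Group G]

/-- The stabilizer in `H` of the coset `x C`. -/
def cosetStab (H C : Subgroup G) (x : G) : Subgroup H :=
  C.comap ((MulAut.conj x⁻¹).toMonoidHom.comp H.subtype)

lemma mem_cosetStab {H C : Subgroup G} {x : G} {h : H} :
    h ∈ cosetStab H C x ↔ x⁻¹ * h * x ∈ C := by
  simp [cosetStab, Subgroup.mem_comap]

lemma mul_relIndex_eq_measure [MeasurableSpace G] [MeasurableMul G] {S U : Subgroup G} (hSU : S ≤ U)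
    (hfin : S.relIndex U ≠ 0) (hS : MeasurableSet (S : Set G)) (μ : Measure G)
    [μ.IsMulLeftInvariant] : (S.relIndex U : ℝ≥0∞) * μ S = μ U := by
  have : Finite (U ⧸ S.subgroupOf U) := Nat.finite_of_card_ne_zero hfin
  have hU : (U : Set G) = ⋃ q : U ⧸ S.subgroupOf U, (fun x => ((q.out : U) : G)⁻¹ * x) ⁻¹' S := by
    ext x
    simp only [Set.mem_iUnion, Set.mem_preimage, SetLike.mem_coe]
    constructor
    · intro hx
      refine ⟨QuotientGroup.mk ⟨x, hx⟩, ?_⟩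
      have := QuotientGroup.eq.mp (QuotientGroup.out_eq' (QuotientGroup.mk ⟨x, hx⟩ :
        U ⧸ S.subgroupOf U))
      simpa [Subgroup.mem_subgroupOf] using this
    · rintro ⟨q, hq⟩
      have := U.mul_mem (q.out).2 (hSU hq)
      rwa [mul_inv_cancel_left] at this
  rw [hU, measure_iUnion]
  · simp only [measure_preimage_mul]
    rw [ENNReal.tsum_const, ENat.card_eq_coe_natCard]
    rfl
  · intro q q' hqq'
    refine Set.disjoint_left.mpr fun x hx hx' => hqq' ?_
    rw [← QuotientGroup.out_eq' q, ← QuotientGroup.out_eq' q', QuotientGroup.eq,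
      Subgroup.mem_subgroupOf]
    have := S.mul_mem hx (S.inv_mem hx')
    simpa using this
  · intro q
    exact measurable_const_mul _ hS

variable [TopologicalSpace G] [IsTopologicalGroup G] [MeasurableSpace G] [BorelSpace G]

lemma isOpen_cosetStab {H C : Subgroup G} (hC : IsOpen (C : Set G)) (x : G) :
    IsOpen (cosetStab H C x : Set H) := by
  have : (cosetStab H C x : Set H) = (fun h : H => x⁻¹ * (h : G) * x) ⁻¹' C := by
    ext h; exact mem_cosetStab
  rw [this]
  exact hC.preimage (by fun_prop)

lemma isCompact_cosetStab {H C : Subgroup G} (hH : IsClosed (H : Set G))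
    (hC : IsCompact (C : Set G)) (x : G) : IsCompact (cosetStab H C x : Set H) := by
  have h1 : IsCompact ((fun c => x * c * x⁻¹) '' (C : Set G)) :=
    hC.image (by fun_prop)
  have h2 := hH.isClosedEmbedding_subtypeVal.isCompact_preimage h1
  suffices e : (cosetStab H C x : Set H) =
      Subtype.val ⁻¹' ((fun c => x * c * x⁻¹) '' (C : Set G)) by
    rw [e]; exact h2
  ext h
  simp only [SetLike.mem_coe, mem_cosetStab, Set.mem_preimage, Set.mem_image]
  constructor
  · intro hh
    exact ⟨_, hh, by group⟩
  · rintro ⟨c, hc, hch⟩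
    change x * c * x⁻¹ = (h : G) at hch
    rw [← hch]
    have : x⁻¹ * (x * c * x⁻¹) * x = c := by group
    rwa [this]

lemma measure_cosetStab_ne {H C : Subgroup G} (hH : IsClosed (H : Set G))
    (hC : IsCompact (C : Set G)) (hC' : IsOpen (C : Set G)) (μH : Measure H) [μH.IsHaarMeasure]
    (x : G) : μH (cosetStab H C x) ≠ 0 ∧ μH (cosetStab H C x) ≠ ∞ :=
  ⟨(isOpen_cosetStab hC' x).measure_ne_zero μH ⟨1, one_mem _⟩,
    (isCompact_cosetStab hH hC x).measure_ne_top⟩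

open Classical in
/-- A function that is constant on the cosets `x C`, supported on one coset in each double coset
`H x C`, and has integral `1` over the sets `H x`. -/
noncomputable def fibreWeight (H C : Subgroup G) (μH : Measure H) (x : G) : ℝ≥0∞ :=
  let r := (Quotient.mk (DoubleCoset.setoid (H : Set G) (C : Set G)) x).out
  if x⁻¹ * r ∈ C then (μH (cosetStab H C r))⁻¹ else 0

lemma mk_doubleCoset_eq {H C : Subgroup G} {h x c : G} (hh : h ∈ H) (hc : c ∈ C) :
    Quotient.mk (DoubleCoset.setoid (H : Set G) (C : Set G)) (h * x * c) =
      Quotient.mk (DoubleCoset.setoid (H : Set G) (C : Set G)) x := by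
  refine Quotient.sound ?_
  refine (DoubleCoset.rel_iff).mpr ⟨h⁻¹, H.inv_mem hh, c⁻¹, C.inv_mem hc, by group⟩

lemma measurable_fibreWeight {H C : Subgroup G} (hC' : IsOpen (C : Set G)) (μH : Measure H) :
    Measurable (fibreWeight H C μH) := by
  refine Continuous.measurable (IsLocallyConstant.continuous ?_)
  refine (IsLocallyConstant.iff_exists_open _).mpr fun x => ?_
  refine ⟨(fun y => x⁻¹ * y) ⁻¹' C, hC'.preimage (by fun_prop), by simp, fun y hy => ?_⟩
  have hm := mk_doubleCoset_eq (H := H) (x := x) (one_mem _) hy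
  rw [one_mul, mul_inv_cancel_left] at hm
  have hy' : x⁻¹ * y ∈ C := hy
  rw [fibreWeight, fibreWeight, hm]
  congr 1
  rw [← C.mul_mem_cancel_left hy']
  simp [mul_assoc]

/-- If x = a r b with a ∈ H and b ∈ C, then h⁻¹x lies in r C exactly when h lies in the translate by
`a` of the stabilizer of r C; the weight is the inverse of its volume. -/
lemma lintegral_fibreWeight {H C : Subgroup G} (hH : IsClosed (H : Set G))
    (hC : IsCompact (C : Set G)) (hC' : IsOpen (C : Set G)) (μH : Measure H) [μH.IsHaarMeasure]
    (x : G) : ∫⁻ h : H, fibreWeight H C μH ((h : G)⁻¹ * x) ∂μH = 1 := by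
  set r := (Quotient.mk (DoubleCoset.setoid (H : Set G) (C : Set G)) x).out with hr
  have hrx : (DoubleCoset.setoid (H : Set G) (C : Set G)) r x := Quotient.exact (Quotient.out_eq _)
  obtain ⟨a, ha, b, hb, hab⟩ := DoubleCoset.rel_iff.mp hrx
  have hfun : (fun h : H => fibreWeight H C μH ((h : G)⁻¹ * x)) =
      Set.indicator ((fun h : H => (⟨a, ha⟩ : H)⁻¹ * h) ⁻¹' (cosetStab H C r))
        (fun _ => (μH (cosetStab H C r))⁻¹) := by
    classical
    funext h
    have hm := mk_doubleCoset_eq (H := H) (C := C) (x := x) (H.inv_mem h.2) (one_mem C)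
    rw [mul_one] at hm
    rw [fibreWeight, hm, ← hr, Set.indicator_apply]
    refine if_congr ?_ rfl rfl
    simp only [Set.mem_preimage, SetLike.mem_coe, mem_cosetStab, Subgroup.coe_mul, Subgroup.coe_inv]
    rw [hab, ← C.mul_mem_cancel_left hb]
    have : b * (((h : G)⁻¹ * (a * r * b))⁻¹ * r) = r⁻¹ * (a⁻¹ * h) * r := by group
    rw [this]
  rw [hfun, lintegral_indicator, setLIntegral_const, measure_preimage_mul, mul_comm]
  · have := measure_cosetStab_ne hH hC hC' μH r
    exact ENNReal.mul_inv_cancel this.1 this.2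
  · exact measurable_const_mul _ (isOpen_cosetStab hC' r).measurableSet

variable [T2Space G] [SecondCountableTopology G] [LocallyCompactSpace G]

/-- Averaging over the fibres is well defined on `H \ G`, if `H` is commutative. -/
lemma lintegral_fibre_eq {H : Subgroup G} (hcomm : ∀ a b : H, a * b = b * a)
    (μH : Measure H) [μH.IsHaarMeasure] (φ : G → ℝ≥0∞) (x : G) :
    ∫⁻ h : H, φ ((h : G) * (Quotient.mk (QuotientGroup.rightRel H) x).out) ∂μH =
      ∫⁻ h : H, φ ((h : G) * x) ∂μH := by
  set r := (Quotient.mk (QuotientGroup.rightRel H) x).out with hr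
  have hrx : QuotientGroup.rightRel H r x := Quotient.exact (Quotient.out_eq _)
  have ha : x * r⁻¹ ∈ H := QuotientGroup.rightRel_apply.mp hrx
  rw [← lintegral_mul_left_eq_self (μ := μH) (fun h : H => φ ((h : G) * r)) ⟨_, ha⟩]
  refine lintegral_congr fun h => ?_
  rw [hcomm]
  simp [mul_assoc]

lemma measurable_lintegral_fibre {H : Subgroup G} (hH : IsClosed (H : Set G))
    (μH : Measure H) [μH.IsHaarMeasure] {φ : G → ℝ≥0∞} (hφ : Measurable φ) :
    Measurable fun x => ∫⁻ h : H, φ ((h : G) * x) ∂μH := by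
  have : LocallyCompactSpace H := hH.locallyCompactSpace
  have : SecondCountableTopology H :=
    TopologicalSpace.Subtype.secondCountableTopology (H : Set G)
  refine Measurable.lintegral_prod_right' (f := fun p : G × H => φ ((p.2 : G) * p.1)) ?_
  exact hφ.comp (by fun_prop)

/-- The measure is the push-forward of the Haar measure weighted by w = `fibreWeight`. By Tonelli
and left invariance, the double integral of w(x) φ(hx) equals that of w(h⁻¹x) φ(x), and the inner
integral of w is 1. Commutativity of `H` makes the fibre integral independent of the representative.
-/
theorem exists_isQuotientMeasure {H C : Subgroup G} {U : Set H} (hH : IsClosed (H : Set G))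
    (hcomm : ∀ a b : H, a * b = b * a)
    (hC : IsCompact (C : Set G)) (hC' : IsOpen (C : Set G))
    (hU : IsCompact U) (hU' : IsOpen U) (hne : U.Nonempty) :
    ∃ ν, IsQuotientMeasure H (C : Set G) U ν := by
  have : LocallyCompactSpace H := hH.locallyCompactSpace
  have : SecondCountableTopology H :=
    TopologicalSpace.Subtype.secondCountableTopology (H : Set G)
  let KC : TopologicalSpace.PositiveCompacts G :=
    ⟨⟨C, hC⟩, by rw [hC'.interior_eq]; exact ⟨1, one_mem _⟩⟩
  let KU : TopologicalSpace.PositiveCompacts H :=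
    ⟨⟨U, hU⟩, by change (interior U).Nonempty; rw [hU'.interior_eq]; exact hne⟩
  set μG := Measure.haarMeasure KC with hμG
  set μH := Measure.haarMeasure KU with hμH
  refine ⟨(μG.withDensity (fibreWeight H C μH)).map (Quotient.mk _), μG, μH, inferInstance,
    Measure.haarMeasure_self, inferInstance, Measure.haarMeasure_self, fun φ hφ => ?_⟩
  have hw := measurable_fibreWeight (H := H) hC' μH
  have hmk : Measurable (Quotient.mk (QuotientGroup.rightRel H)) := measurable_quotient_mk''
  have hF := measurable_lintegral_fibre hH μH hφ
  rw [lintegral_map (measurable_from_quotient.mpr ?_) hmk]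
  · simp only [lintegral_fibre_eq hcomm μH φ]
    rw [lintegral_withDensity_eq_lintegral_mul _ hw hF]
    simp only [Pi.mul_apply]
    have h1 : ∀ x, fibreWeight H C μH x * ∫⁻ h : H, φ ((h : G) * x) ∂μH =
        ∫⁻ h : H, fibreWeight H C μH x * φ ((h : G) * x) ∂μH := fun x =>
      (lintegral_const_mul _ (hφ.comp (by fun_prop))).symm
    simp only [h1]
    rw [lintegral_lintegral_swap]
    · have h2 : ∀ h : H, ∫⁻ x, fibreWeight H C μH x * φ ((h : G) * x) ∂μG =
          ∫⁻ x, fibreWeight H C μH ((h : G)⁻¹ * x) * φ x ∂μG := fun h => by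
        rw [← lintegral_mul_left_eq_self (μ := μG)
          (fun x => fibreWeight H C μH ((h : G)⁻¹ * x) * φ x) (h : G)]
        simp
      simp only [h2]
      rw [lintegral_lintegral_swap]
      · refine lintegral_congr fun x => ?_
        rw [lintegral_mul_const, lintegral_fibreWeight hH hC hC', one_mul]
        exact hw.comp (by fun_prop)
      · exact ((hw.comp (by fun_prop)).mul (hφ.comp (by fun_prop))).aemeasurable
    · exact ((hw.comp (by fun_prop)).mul (hφ.comp (by fun_prop))).aemeasurable
  · have : (fun y : Quotient (QuotientGroup.rightRel H) =>
        ∫⁻ h : H, φ ((h : G) * y.out) ∂μH) ∘ Quotient.mk'' = fun x => ∫⁻ h : H, φ ((h : G) * x) ∂μH :=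
      funext fun x => lintegral_fibre_eq hcomm μH φ x
    rw [this]
    exact hF

/-- The volume in `H \ G` of a finite union of double cosets `H xᵢ C`. -/
theorem IsQuotientMeasure.measure_eq_sum {H C : Subgroup G} {U : Subgroup H}
    {ν : Measure (Quotient (QuotientGroup.rightRel H))}
    (hν : IsQuotientMeasure H (C : Set G) (U : Set H) ν)
    (hcomm : ∀ a b : H, a * b = b * a) (hC' : IsOpen (C : Set G))
    {n : ℕ} (x : ℕ → G) (hle : ∀ i ∈ Finset.range n, cosetStab H C (x i) ≤ U)
    (hfin : ∀ i ∈ Finset.range n, (cosetStab H C (x i)).relIndex U ≠ 0)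
    {A : Set (Quotient (QuotientGroup.rightRel H))}
    (hA : ∀ y, Quotient.mk _ y ∈ A ↔ ∃ i ∈ Finset.range n, ∃ h : H, (x i)⁻¹ * (h * y) ∈ C)
    (hdisj : ∀ i ∈ Finset.range n, ∀ j ∈ Finset.range n, ∀ h : H,
      (x i)⁻¹ * (h * x j) ∈ C → i = j) :
    ν A = ∑ i ∈ Finset.range n, ((cosetStab H C (x i)).relIndex U : ℝ≥0∞) := by
  obtain ⟨μG, μH, hμG, hC1, hμH, hU1, hφ⟩ := hν
  have hstab : ∀ i ∈ Finset.range n,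
      ((cosetStab H C (x i)).relIndex U : ℝ≥0∞) * μH (cosetStab H C (x i)) = 1 := fun i hi => by
    rw [mul_relIndex_eq_measure (hle i hi) (hfin i hi) (isOpen_cosetStab hC' _).measurableSet, hU1]
  -- Test function with value [U : Stabᵢ] on the coset xᵢC. Its integral over G is the sum of these
  -- indices, as C has volume 1; its fibre integrals are the indicator of `A`, as Stabᵢ has volume 1
  -- / [U : Stabᵢ].
  let φ : G → ℝ≥0∞ := fun y => ∑ i ∈ Finset.range n, ((fun y => (x i)⁻¹ * y) ⁻¹' C).indicator
    (fun _ => ((cosetStab H C (x i)).relIndex U : ℝ≥0∞)) y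
  have hCm : ∀ i, MeasurableSet ((fun y => (x i)⁻¹ * y) ⁻¹' (C : Set G)) := fun i =>
    measurable_const_mul _ hC'.measurableSet
  have hφm : Measurable φ := by
    refine Finset.measurable_fun_sum _ fun i _ => ?_
    exact measurable_const.indicator (hCm i)
  have h := hφ φ hφm
  have hL : ∫⁻ y, φ y ∂μG =
      ∑ i ∈ Finset.range n, ((cosetStab H C (x i)).relIndex U : ℝ≥0∞) := by
    rw [lintegral_finsetSum _ fun i _ => measurable_const.indicator (hCm i)]
    refine Finset.sum_congr rfl fun i _ => ?_
    rw [lintegral_indicator (hCm i), setLIntegral_const, measure_preimage_mul, hC1, mul_one]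
  have hAm : MeasurableSet A := by
    change MeasurableSet (Quotient.mk _ ⁻¹' A)
    have : (Quotient.mk (QuotientGroup.rightRel H) ⁻¹' A) = ⋃ i ∈ Finset.range n, ⋃ h : H,
        (fun y => (x i)⁻¹ * (h * y)) ⁻¹' (C : Set G) := by
      ext y
      rw [Set.mem_preimage, hA]
      simp
    rw [this]
    exact (isOpen_biUnion fun i _ => isOpen_iUnion fun h =>
      hC'.preimage (by fun_prop)).measurableSet
  have hR : ∀ y : Quotient (QuotientGroup.rightRel H),
      ∫⁻ h : H, φ ((h : G) * y.out) ∂μH = A.indicator 1 y := by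
    intro y
    have hm : ∀ i, MeasurableSet {h : H | (x i)⁻¹ * (h * y.out) ∈ C} := fun i =>
      (hC'.preimage (f := fun h : H => (x i)⁻¹ * (h * y.out)) (by fun_prop)).measurableSet
    have e : ∀ h : H, φ ((h : G) * y.out) = ∑ i ∈ Finset.range n,
        {h : H | (x i)⁻¹ * (h * y.out) ∈ C}.indicator
          (fun _ => ((cosetStab H C (x i)).relIndex U : ℝ≥0∞)) h := fun h => rfl
    simp only [e]
    rw [lintegral_finsetSum _ fun i _ => measurable_const.indicator (hm i)]
    simp only [lintegral_indicator (hm _), setLIntegral_const]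
    have hAy := hA y.out
    rw [Quotient.out_eq] at hAy
    by_cases hy : y ∈ A
    · rw [Set.indicator_of_mem hy, Pi.one_apply]
      obtain ⟨i, hi, h0, hh0⟩ := hAy.mp hy
      rw [Finset.sum_eq_single_of_mem i hi]
      -- The set of h with h y in xᵢC is a translate by h0 of the stabilizer of xᵢC.
      · convert hstab i hi using 2
        rw [← measure_preimage_mul μH h0⁻¹ (cosetStab H C (x i))]
        congr 1
        ext h
        simp only [Set.mem_ofPred_eq, Set.mem_preimage, SetLike.mem_coe, mem_cosetStab]
        rw [← C.mul_mem_cancel_right (y := (x i)⁻¹ * ((h0⁻¹ * h : H) : G) * x i) hh0, hcomm]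
        have : (x i)⁻¹ * ((h * h0⁻¹ : H) : G) * (x i) * ((x i)⁻¹ * (h0 * y.out)) =
          (x i)⁻¹ * (h * y.out) := by simp [mul_assoc]
        rw [this]
      · intro j hj hji
        have : {h : H | (x j)⁻¹ * (h * y.out) ∈ C} = ∅ := by
          refine Set.eq_empty_iff_forall_notMem.mpr fun h hh => hji ?_
          refine hdisj j hj i hi (h * h0⁻¹) ?_
          have := C.mul_mem hh (C.inv_mem hh0)
          simpa [mul_assoc] using this
        rw [this, measure_empty, mul_zero]
    · rw [Set.indicator_of_notMem hy]
      refine Finset.sum_eq_zero fun i hi => ?_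
      have : {h : H | (x i)⁻¹ * (h * y.out) ∈ C} = ∅ :=
        Set.eq_empty_iff_forall_notMem.mpr fun h hh => hy (hAy.mpr ⟨i, hi, h, hh⟩)
      rw [this, measure_empty, mul_zero]
  rw [hL] at h
  simp only [hR] at h
  rw [lintegral_indicator_one hAm] at h
  exact h.symm

end QuotientMeasure

/-! ### Completions of `K` and the topology of GL(2) -/

section LocalField

variable {K : Type*} [Field K] [NumberField K] (v : HeightOneSpectrum (𝓞 K))

lemma isOpen_adicCompletionIntegers :
    IsOpen (v.adicCompletionIntegers K : Set (v.adicCompletion K)) :=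
  Valued.isOpen_valuationSubring _

/-- `K` is dense in its completion. -/
lemma exists_sub_algebraMap_eq_mul (x : v.adicCompletion K) {a : v.adicCompletion K} (ha : a ≠ 0) :
    ∃ y : K, ∃ z : v.adicCompletionIntegers K, x - algebraMap K _ y = a * z := by
  have hopen : IsOpen {w | a⁻¹ * (x - w) ∈ v.adicCompletionIntegers K} :=
    (isOpen_adicCompletionIntegers v).preimage (f := fun w => a⁻¹ * (x - w)) (by fun_prop)
  obtain ⟨y, hy⟩ := (HeightOneSpectrum.denseRange_algebraMap K v).exists_mem_open hopen
    ⟨x, by simp⟩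
  exact ⟨y, ⟨_, hy⟩, by simp [mul_inv_cancel_left₀ ha]⟩

lemma valued_algebraMap (y : K) :
    Valued.v (algebraMap K (v.adicCompletion K) y) = v.valuation K y :=
  HeightOneSpectrum.valuedAdicCompletion_eq_valuation' v y

/-- A uniformizer from K has valuation `exp (-1)` and is divisible by π, which bounds the valuation
of π from below; the upper bound is discreteness of the value group. -/
lemma valuation_irreducible {π : v.adicCompletionIntegers K} (hπ : Irreducible π) :
    Valued.v (π : v.adicCompletion K) = WithZero.exp (-1 : ℤ) := by
  obtain ⟨ϖ, hϖ⟩ := v.valuation_exists_uniformizer K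
  have hle : Valued.v (algebraMap K (v.adicCompletion K) ϖ) = WithZero.exp (-1 : ℤ) := by
    rw [valued_algebraMap, hϖ]
  have hmem : algebraMap K (v.adicCompletion K) ϖ ∈ v.adicCompletionIntegers K := by
    rw [HeightOneSpectrum.mem_adicCompletionIntegers, hle]
    decide
  set w : v.adicCompletionIntegers K := ⟨_, hmem⟩
  have hnu : ¬ IsUnit w := by
    rw [HeightOneSpectrum.adicCompletionIntegers.isUnit_iff_valued_eq_one, hle]
    decide
  have hπ1 : Valued.v (π : v.adicCompletion K) < 1 := by
    refine lt_of_le_of_ne ((HeightOneSpectrum.mem_adicCompletionIntegers _ _ _).mp π.2) ?_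
    intro h
    exact hπ.not_isUnit (HeightOneSpectrum.adicCompletionIntegers.isUnit_iff_valued_eq_one.mpr h)
  have hdvd : π ∣ w := by
    rw [← Ideal.mem_span_singleton, ← hπ.maximalIdeal_eq]
    exact (IsLocalRing.mem_maximalIdeal _).mpr hnu
  obtain ⟨u, hu⟩ := hdvd
  have h1 : Valued.v (w : v.adicCompletion K) =
      Valued.v (π : v.adicCompletion K) * Valued.v (u : v.adicCompletion K) := by
    rw [hu, ← map_mul]; rfl
  have h2 : Valued.v (u : v.adicCompletion K) ≤ 1 :=
    (HeightOneSpectrum.mem_adicCompletionIntegers _ _ _).mp u.2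
  refine le_antisymm ?_ ?_
  · have hne : Valued.v (π : v.adicCompletion K) ≠ 0 := by
      rw [Valuation.ne_zero_iff]
      exact fun h => hπ.ne_zero (Subtype.ext h)
    rw [← WithZero.exp_log hne] at hπ1 ⊢
    rw [← WithZero.exp_zero, WithZero.exp_lt_exp] at hπ1
    rw [WithZero.exp_le_exp]
    omega
  · rw [← hle, show algebraMap K (v.adicCompletion K) ϖ = (w : v.adicCompletion K) from rfl, h1]
    exact mul_le_of_le_one_right' h2

lemma valuation_irreducible_pow {π : v.adicCompletionIntegers K} (hπ : Irreducible π) (n : ℕ) :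
    Valued.v ((π : v.adicCompletion K) ^ n) = WithZero.exp (-n : ℤ) := by
  rw [map_pow, valuation_irreducible v hπ, ← WithZero.exp_nsmul]
  simp

/-- Two approximations: of `x` by an element of `K` modulo π, and of that element by an integer of
`K` modulo `v`. -/
lemma exists_residue_algebraMap (x : v.adicCompletionIntegers K) :
    ∃ r : 𝓞 K, IsLocalRing.residue _ (algebraMap (𝓞 K) (v.adicCompletionIntegers K) r) =
      IsLocalRing.residue _ x := by
  obtain ⟨π, hπ⟩ := IsDiscreteValuationRing.exists_irreducible (v.adicCompletionIntegers K)
  have hπ0 : (π : v.adicCompletion K) ≠ 0 := fun h => hπ.ne_zero (Subtype.ext h)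
  obtain ⟨y, z, hyz⟩ := exists_sub_algebraMap_eq_mul v (x : v.adicCompletion K) hπ0
  have hy : algebraMap K (v.adicCompletion K) y ∈ v.adicCompletionIntegers K := by
    have : algebraMap K (v.adicCompletion K) y = x - π * z := by rw [← hyz]; ring
    rw [this]
    exact sub_mem x.2 (mul_mem π.2 z.2)
  have hy' : v.valuation K y ≤ 1 := by
    rw [← valued_algebraMap]
    exact (HeightOneSpectrum.mem_adicCompletionIntegers _ _ _).mp hy
  obtain ⟨r, hr⟩ := v.exists_valuation_sub_lt_of_integer hy' 1
  refine ⟨r, ?_⟩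
  have h1 : IsLocalRing.residue (v.adicCompletionIntegers K) ⟨_, hy⟩ = IsLocalRing.residue _ x := by
    rw [residue_eq_iff_dvd hπ]
    refine ⟨-z, Subtype.ext ?_⟩
    change algebraMap K (v.adicCompletion K) y - x = π * -z
    linear_combination -hyz
  rw [← h1, ← sub_eq_zero, ← map_sub, IsLocalRing.residue_eq_zero_iff, IsLocalRing.mem_maximalIdeal,
    mem_nonunits_iff, HeightOneSpectrum.adicCompletionIntegers.isUnit_iff_valued_eq_one]
  refine ne_of_lt ?_
  rw [Units.val_one, ← valued_algebraMap, map_sub] at hr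
  exact hr

lemma residue_algebraMap_eq_zero_iff {r : 𝓞 K} :
    IsLocalRing.residue _ (algebraMap (𝓞 K) (v.adicCompletionIntegers K) r) = 0 ↔
      r ∈ v.asIdeal := by
  rw [IsLocalRing.residue_eq_zero_iff, IsLocalRing.mem_maximalIdeal,
    mem_nonunits_iff, HeightOneSpectrum.adicCompletionIntegers.isUnit_iff_valued_eq_one,
    ← v.valuation_lt_one_iff_mem (K := K), ← valued_algebraMap]
  exact (lt_iff_le_and_ne.trans (and_iff_right
    (HeightOneSpectrum.coe_mem_adicCompletionIntegers v r))).symm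

/-- The residue field of the completion is `𝓞 K / v`. -/
noncomputable def residueFieldEquiv :
    𝓞 K ⧸ v.asIdeal ≃+* IsLocalRing.ResidueField (v.adicCompletionIntegers K) :=
  (Ideal.quotEquivOfEq (by
    ext r
    rw [RingHom.mem_ker, RingHom.comp_apply, residue_algebraMap_eq_zero_iff])).trans
    (RingHom.quotientKerEquivOfSurjective (f := (IsLocalRing.residue _).comp
      (algebraMap (𝓞 K) (v.adicCompletionIntegers K))) fun y => by
        obtain ⟨x, rfl⟩ := IsLocalRing.residue_surjective y
        exact exists_residue_algebraMap v x)

lemma card_residueField : Nat.card (IsLocalRing.ResidueField (v.adicCompletionIntegers K)) =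
    Ideal.absNorm v.asIdeal := by
  rw [← Nat.card_congr (residueFieldEquiv v).toEquiv]
  rfl

instance finite_residueField : Finite (IsLocalRing.ResidueField (v.adicCompletionIntegers K)) := by
  have : Finite (𝓞 K ⧸ v.asIdeal) := v.asIdeal.finiteQuotientOfFreeOfNeBot v.ne_bot
  exact Finite.of_equiv _ (residueFieldEquiv v).toEquiv

lemma isCompact_adicCompletionIntegers :
    IsCompact (v.adicCompletionIntegers K : Set (v.adicCompletion K)) := by
  have h := (Valued.integer.compactSpace_iff_completeSpace_and_isDiscreteValuationRing_and_finite_residueField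
    (K := v.adicCompletion K)).mpr ⟨?_, ?_, ?_⟩
  · exact isCompact_iff_compactSpace.mpr h
  · exact (Valued.isClosed_integer (v.adicCompletion K)).completeSpace_coe
  · exact inferInstanceAs (IsDiscreteValuationRing (v.adicCompletionIntegers K))
  · exact finite_residueField v

instance locallyCompactSpace_adicCompletion : LocallyCompactSpace (v.adicCompletion K) :=
  (isCompact_adicCompletionIntegers v).locallyCompactSpace_of_mem_nhds_of_addGroup
    ((isOpen_adicCompletionIntegers v).mem_nhds (zero_mem _))

instance secondCountableTopology_adicCompletion :
    SecondCountableTopology (v.adicCompletion K) := by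
  have : Countable K := (Module.finBasis ℚ K).equivFun.toEquiv.countable_iff.mpr inferInstance
  have : TopologicalSpace.SeparableSpace (v.adicCompletion K) :=
    ⟨_, Set.countable_range _, HeightOneSpectrum.denseRange_algebraMap K v⟩
  exact UniformSpace.secondCountable_of_separable _

instance secondCountableTopology_GL :
    SecondCountableTopology (GL (Fin 2) (v.adicCompletion K)) := by
  have : SecondCountableTopology (Matrix (Fin 2) (Fin 2) (v.adicCompletion K)) :=
    inferInstanceAs (SecondCountableTopology (Fin 2 → Fin 2 → v.adicCompletion K))
  have : SecondCountableTopology (Matrix (Fin 2) (Fin 2) (v.adicCompletion K))ᵐᵒᵖ :=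
    MulOpposite.opHomeomorph.symm.isEmbedding.secondCountableTopology
  exact Units.isEmbedding_embedProduct.secondCountableTopology

instance locallyCompactSpace_GL : LocallyCompactSpace (GL (Fin 2) (v.adicCompletion K)) := by
  have : LocallyCompactSpace (Matrix (Fin 2) (Fin 2) (v.adicCompletion K)) :=
    inferInstanceAs (LocallyCompactSpace (Fin 2 → Fin 2 → v.adicCompletion K))
  exact inferInstanceAs (LocallyCompactSpace (Matrix (Fin 2) (Fin 2) (v.adicCompletion K))ˣ)

/-- The monoid of integral matrices. -/
def integralMatrices : Submonoid (Matrix (Fin 2) (Fin 2) (v.adicCompletion K)) where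
  carrier := {x | ∀ i j, x i j ∈ v.adicCompletionIntegers K}
  one_mem' i j := by
    rw [Matrix.one_apply]
    split_ifs
    · exact one_mem _
    · exact zero_mem _
  mul_mem' hx hy i j := by
    rw [Matrix.mul_apply]
    exact sum_mem fun l _ => mul_mem (hx i l) (hy l j)

lemma isOpen_integralMatrices : IsOpen (integralMatrices v :
    Set (Matrix (Fin 2) (Fin 2) (v.adicCompletion K))) := by
  have : (integralMatrices v : Set (Matrix (Fin 2) (Fin 2) (v.adicCompletion K))) =
      ⋂ i, ⋂ j, (fun x => x i j) ⁻¹' (v.adicCompletionIntegers K) := by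
    ext x
    simp only [Set.mem_iInter]
    rfl
  rw [this]
  exact isOpen_iInter_of_finite fun i => isOpen_iInter_of_finite fun j =>
    (isOpen_adicCompletionIntegers v).preimage (by fun_prop)

lemma isCompact_integralMatrices : IsCompact (integralMatrices v :
    Set (Matrix (Fin 2) (Fin 2) (v.adicCompletion K))) := by
  have h := isCompact_univ_pi fun _ : Fin 2 => isCompact_univ_pi fun _ : Fin 2 =>
    isCompact_adicCompletionIntegers v
  have e : (integralMatrices v : Set (Matrix (Fin 2) (Fin 2) (v.adicCompletion K))) =
      Set.univ.pi fun _ : Fin 2 => Set.univ.pi fun _ : Fin 2 =>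
        (v.adicCompletionIntegers K : Set (v.adicCompletion K)) := by
    ext x
    exact ⟨fun h i _ j _ => h i j, fun h i j => h i trivial j trivial⟩
  rw [e]
  exact h

lemma maxCompactGL_eq : maxCompactGL v = (integralMatrices v).units := by
  ext x
  rw [Submonoid.mem_units_iff]
  constructor
  · rintro ⟨y, rfl⟩
    refine ⟨fun i j => (y.1 i j).2, fun i j => ?_⟩
    rw [← map_inv]
    exact ((y⁻¹).1 i j).2
  · rintro ⟨h1, h2⟩
    let f := (algebraMap (v.adicCompletionIntegers K) (v.adicCompletion K)).mapMatrix (m := Fin 2)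
    have hf : Function.Injective f := Matrix.map_injective Subtype.val_injective
    let a : Matrix (Fin 2) (Fin 2) (v.adicCompletionIntegers K) := Matrix.of fun i j => ⟨_, h1 i j⟩
    let b : Matrix (Fin 2) (Fin 2) (v.adicCompletionIntegers K) := Matrix.of fun i j => ⟨_, h2 i j⟩
    have ha : f a = x.1 := by ext i j; rfl
    have hb : f b = (x⁻¹).1 := by ext i j; rfl
    refine ⟨⟨a, b, hf ?_, hf ?_⟩, ?_⟩
    · rw [map_mul, ha, hb, map_one, ← Units.val_mul, mul_inv_cancel, Units.val_one]
    · rw [map_mul, ha, hb, map_one, ← Units.val_mul, inv_mul_cancel, Units.val_one]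
    · apply Units.ext
      exact ha

lemma isOpen_maxCompactGL : IsOpen (maxCompactGL v : Set (GL (Fin 2) (v.adicCompletion K))) := by
  rw [maxCompactGL_eq]
  have : ((integralMatrices v).units : Set (GL (Fin 2) (v.adicCompletion K))) =
      (fun x => x.1) ⁻¹' (integralMatrices v) ∩ (fun x => (x⁻¹).1) ⁻¹' (integralMatrices v) := by
    ext x
    exact Submonoid.mem_units_iff _ _
  rw [this]
  exact ((isOpen_integralMatrices v).preimage Units.continuous_val).inter
    ((isOpen_integralMatrices v).preimage Units.continuous_coe_inv)

lemma isCompact_maxCompactGL :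
    IsCompact (maxCompactGL v : Set (GL (Fin 2) (v.adicCompletion K))) := by
  rw [maxCompactGL_eq]
  exact Submonoid.units_isCompact (isCompact_integralMatrices v)

end LocalField

/-! ### Cosets of GL(2) as lattices -/

section Lattice

variable {R F E : Type*} [CommRing R] [Field F] [Algebra R F]
  [CommRing E] [Algebra F E] [Algebra R E] [IsScalarTower R F E]

/-- Multiplication by `y` in the coordinates `ev`. -/
noncomputable def mulMatrix (ev : E ≃ₗ[F] (Fin 2 → F)) : E →ₐ[F] Matrix (Fin 2) (Fin 2) F :=
  Algebra.leftMulMatrix (Module.Basis.ofEquivFun ev)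

lemma mulMatrix_mulVec (ev : E ≃ₗ[F] (Fin 2 → F)) (x y : E) :
    mulMatrix ev x *ᵥ ev y = ev (x * y) := by
  have e : ∀ z, ⇑((Module.Basis.ofEquivFun ev).repr z) = ev z := fun z =>
    funext (Module.Basis.ofEquivFun_repr_apply ev z)
  have := Algebra.leftMulMatrix_mulVec_repr (Module.Basis.ofEquivFun ev) x y
  rwa [e, e] at this

lemma mulMatrix_injective (ev : E ≃ₗ[F] (Fin 2 → F)) : Function.Injective (mulMatrix ev) :=
  Algebra.leftMulMatrix_injective _

lemma eq_mulMatrix_of_forall {ev : E ≃ₗ[F] (Fin 2 → F)} {A : Matrix (Fin 2) (Fin 2) F} {x : E}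
    (h : ∀ y, A *ᵥ ev y = ev (x * y)) : A = mulMatrix ev x := by
  refine Matrix.ext_of_mulVec_single fun i => ?_
  obtain ⟨y, hy⟩ := ev.surjective (Pi.single i 1)
  rw [← hy, h, mulMatrix_mulVec]

/-- The matrices that commute with a generator of `E` are those of multiplications. -/
lemma exists_mulMatrix_eq (ev : E ≃ₗ[F] (Fin 2 → F)) {g : E}
    (hg : ∀ y : E, ∃ p q : F, y = algebraMap F E p + q • g) {A : Matrix (Fin 2) (Fin 2) F}
    (hA : mulMatrix ev g * A = A * mulMatrix ev g) : ∃ y, mulMatrix ev y = A := by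
  refine ⟨ev.symm (A *ᵥ ev 1), (eq_mulMatrix_of_forall fun y => ?_).symm⟩
  obtain ⟨p, q, rfl⟩ := hg y
  have h1 : A *ᵥ ev g = ev (g * ev.symm (A *ᵥ ev 1)) := by
    rw [← mulMatrix_mulVec, LinearEquiv.apply_symm_apply, Matrix.mulVec_mulVec, hA,
      ← Matrix.mulVec_mulVec, mulMatrix_mulVec, mul_one]
  rw [Algebra.algebraMap_eq_smul_one, map_add, map_smul, map_smul, Matrix.mulVec_add,
    Matrix.mulVec_smul, Matrix.mulVec_smul, h1, mul_add, mul_smul_comm, mul_smul_comm, mul_one,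
    map_add, map_smul, map_smul, LinearEquiv.apply_symm_apply, mul_comm g]

/-- The units of `E` are the centralizer of a generator. -/
noncomputable def unitsEquivCentralizer (ev : E ≃ₗ[F] (Fin 2 → F)) {g : E}
    (hg : ∀ y : E, ∃ p q : F, y = algebraMap F E p + q • g) {G : GL (Fin 2) F}
    (hG : G.1 = mulMatrix ev g) : Eˣ ≃* Subgroup.centralizer {G} :=
  MulEquiv.ofBijective
    ((Units.map (mulMatrix ev : E →* Matrix (Fin 2) (Fin 2) F)).codRestrict
      (Subgroup.centralizer {G}) fun u => by
        rw [Subgroup.mem_centralizer_singleton_iff]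
        apply Units.ext
        change mulMatrix ev u * G.1 = G.1 * mulMatrix ev u
        rw [hG, ← map_mul, ← map_mul, mul_comm]) (by
    constructor
    · intro a b hab
      exact Units.ext (mulMatrix_injective ev (congrArg (fun x => x.1.1) hab))
    · rintro ⟨A, hA⟩
      have hA' := Subgroup.inv_mem _ hA
      rw [Subgroup.mem_centralizer_singleton_iff] at hA hA'
      obtain ⟨a, ha⟩ := exists_mulMatrix_eq ev hg (A := A.1) (by
        rw [← hG]; exact (congrArg Units.val hA).symm)
      obtain ⟨b, hb⟩ := exists_mulMatrix_eq ev hg (A := (A⁻¹).1) (by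
        rw [← hG]; exact (congrArg Units.val hA').symm)
      have hab : a * b = 1 := mulMatrix_injective ev (by
        rw [map_mul, ha, hb, map_one, ← Units.val_mul, mul_inv_cancel, Units.val_one])
      refine ⟨⟨a, b, hab, by rw [mul_comm, hab]⟩, ?_⟩
      apply Subtype.ext
      apply Units.ext
      exact ha)

variable (R) in
/-- The matrix `A` has entries in `R`. -/
def IsIntegralMatrix (A : Matrix (Fin 2) (Fin 2) F) : Prop :=
  ∀ i j, A i j ∈ (algebraMap R F).range

lemma IsIntegralMatrix.mulVec {A : Matrix (Fin 2) (Fin 2) F} (hA : IsIntegralMatrix R A)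
    {w : Fin 2 → F} (hw : ∀ i, w i ∈ (algebraMap R F).range) (i : Fin 2) :
    (A *ᵥ w) i ∈ (algebraMap R F).range := by
  rw [Matrix.mulVec, dotProduct]
  exact sum_mem fun j _ => mul_mem (hA i j) (hw j)

variable (R) in
/-- The lattice `{y | ev y ∈ x R²}`. -/
def matrixLattice (ev : E ≃ₗ[F] (Fin 2 → F)) (x : GL (Fin 2) F) : Submodule R E where
  carrier := {y | ∀ i, ((x⁻¹).1 *ᵥ ev y) i ∈ (algebraMap R F).range}
  add_mem' ha hb i := by
    rw [map_add, Matrix.mulVec_add]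
    exact add_mem (ha i) (hb i)
  zero_mem' i := by
    rw [map_zero, Matrix.mulVec_zero]
    exact zero_mem _
  smul_mem' r y hy i := by
    rw [← algebraMap_smul F r y, map_smul, Matrix.mulVec_smul]
    exact mul_mem ⟨r, rfl⟩ (hy i)

lemma mem_matrixLattice {ev : E ≃ₗ[F] (Fin 2 → F)} {x : GL (Fin 2) F} {y : E} :
    y ∈ matrixLattice R ev x ↔ ∀ i, ((x⁻¹).1 *ᵥ ev y) i ∈ (algebraMap R F).range := Iff.rfl

lemma symm_mulVec_single_mem (ev : E ≃ₗ[F] (Fin 2 → F)) (x : GL (Fin 2) F) (j : Fin 2) :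
    ev.symm (x.1 *ᵥ Pi.single j 1) ∈ matrixLattice R ev x := by
  intro i
  rw [LinearEquiv.apply_symm_apply, Matrix.mulVec_mulVec, ← Units.val_mul, inv_mul_cancel,
    Units.val_one, Matrix.one_mulVec]
  rcases eq_or_ne i j with rfl | h
  · rw [Pi.single_eq_same]; exact one_mem _
  · rw [Pi.single_eq_of_ne h]; exact zero_mem _

/-- The matrix is multiplication by `z` read from the basis given by the columns of `x'` to that
given by the columns of `x`, so its integrality can be tested on the standard vectors. -/
lemma isIntegralMatrix_iff_forall_mem (ev : E ≃ₗ[F] (Fin 2 → F)) (x x' : GL (Fin 2) F) (z : E) :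
    IsIntegralMatrix R ((x⁻¹).1 * mulMatrix ev z * x'.1) ↔
      ∀ y ∈ matrixLattice R ev x', z * y ∈ matrixLattice R ev x := by
  constructor
  · intro h y hy
    rw [mem_matrixLattice]
    have : (x⁻¹).1 *ᵥ ev (z * y) = ((x⁻¹).1 * mulMatrix ev z * x'.1) *ᵥ ((x'⁻¹).1 *ᵥ ev y) := by
      rw [Matrix.mulVec_mulVec, mul_assoc, ← Units.val_mul x', mul_inv_cancel, Units.val_one,
        mul_one, ← Matrix.mulVec_mulVec, mulMatrix_mulVec]
    rw [this]
    exact fun i => h.mulVec hy i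
  · intro h i j
    have := h _ (symm_mulVec_single_mem ev x' j) i
    rwa [← mulMatrix_mulVec, LinearEquiv.apply_symm_apply, Matrix.mulVec_mulVec,
      Matrix.mulVec_mulVec, Matrix.mulVec_single_one, Matrix.col_apply] at this

/-- The cosets of `GL(2, R)` correspond to lattices. -/
lemma isIntegralMatrix_and_inv_iff (ev : E ≃ₗ[F] (Fin 2 → F)) (x x' : GL (Fin 2) F) (u : Eˣ)
    {h : GL (Fin 2) F} (hh : h.1 = mulMatrix ev u) :
    (IsIntegralMatrix R (x⁻¹ * (h * x')).1 ∧ IsIntegralMatrix R ((x⁻¹ * (h * x'))⁻¹).1) ↔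
      ∀ y, y ∈ matrixLattice R ev x' ↔ ↑u * y ∈ matrixLattice R ev x := by
  have hh' : (h⁻¹).1 = mulMatrix ev (u⁻¹ : Eˣ) := by
    have e : h = Units.map (mulMatrix ev : E →* Matrix (Fin 2) (Fin 2) F) u := Units.ext hh
    rw [e, ← map_inv]
    rfl
  have e1 : (x⁻¹ * (h * x')).1 = (x⁻¹).1 * mulMatrix ev u * x'.1 := by
    rw [← hh, mul_assoc]; rfl
  have e2 : ((x⁻¹ * (h * x'))⁻¹).1 = (x'⁻¹).1 * mulMatrix ev (u⁻¹ : Eˣ) * x.1 := by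
    rw [← hh', _root_.mul_inv_rev, _root_.mul_inv_rev, inv_inv]; rfl
  rw [e1, e2, isIntegralMatrix_iff_forall_mem, isIntegralMatrix_iff_forall_mem]
  constructor
  · rintro ⟨h1, h2⟩ y
    refine ⟨h1 y, fun hy => ?_⟩
    have := h2 _ hy
    rwa [Units.inv_mul_cancel_left] at this
  · intro h
    refine ⟨fun y hy => (h y).mp hy, fun y hy => (h _).mpr ?_⟩
    rwa [Units.mul_inv_cancel_left]

variable [IsDomain R] [IsDiscreteValuationRing R] [IsFractionRing R F]

lemma exists_pow_mul_mem_range {π : R} (hπ : Irreducible π) {ι : Type*} [Finite ι] (f : ι → F) :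
    ∃ n, ∀ i, algebraMap R F (π ^ n) * f i ∈ (algebraMap R F).range := by
  obtain ⟨b, hb⟩ := IsLocalization.exist_integer_multiples_of_finite (nonZeroDivisors R) f
  obtain ⟨n, u, hu⟩ := IsDiscreteValuationRing.eq_unit_mul_pow_irreducible
    (nonZeroDivisors.coe_ne_zero b) hπ
  refine ⟨n, fun i => ?_⟩
  obtain ⟨r, hr⟩ := hb i
  refine ⟨(u⁻¹ : Rˣ) * r, ?_⟩
  rw [map_mul, hr, Algebra.smul_def, ← mul_assoc, ← map_mul, hu, Units.inv_mul_cancel_left]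

variable (c : QuadCoord R F E)

/-- The classification applies because the lattice is commensurable with O_0: a common denominator
for finitely many coordinates of a basis works in each direction. -/
lemma exists_matrixLattice_eq {π : R} (hπ : Irreducible π) (ev : E ≃ₗ[F] (Fin 2 → F))
    (x : GL (Fin 2) F) :
    ∃ (z : Eˣ) (i : ℕ), ∀ y, y ∈ matrixLattice R ev x ↔ ↑z⁻¹ * y ∈ c.order π i := by
  apply c.exists_eq_smul_order hπ
  · let b : Fin 2 → E := fun j => ev.symm (x.1 *ᵥ Pi.single j 1)
    obtain ⟨n, hn⟩ := exists_pow_mul_mem_range hπ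
      (Sum.elim (fun j => c.re (b j)) (fun j => c.im (b j)))
    refine ⟨n, fun y hy => ?_⟩
    set w := (x⁻¹).1 *ᵥ ev y with hw
    have hxw : ev y = x.1 *ᵥ w := by
      rw [hw, Matrix.mulVec_mulVec, ← Units.val_mul, mul_inv_cancel, Units.val_one,
        Matrix.one_mulVec]
    have hyb : y = ∑ j, w j • b j := by
      apply ev.injective
      simp only [map_sum, map_smul, b, LinearEquiv.apply_symm_apply]
      rw [hxw]
      ext i
      simp [Matrix.mulVec, dotProduct, Fin.sum_univ_two, mul_comm]
    have key : ∀ L : E →ₗ[F] F, (∀ j, algebraMap R F (π ^ n) * L (b j) ∈ (algebraMap R F).range) →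
        L (algebraMap R E (π ^ n) * y) ∈ (algebraMap R F).range := by
      intro L hL
      rw [IsScalarTower.algebraMap_apply R F E, ← Algebra.smul_def, map_smul, hyb, map_sum,
        smul_eq_mul, Finset.mul_sum]
      refine sum_mem fun j _ => ?_
      rw [map_smul, smul_eq_mul, mul_left_comm]
      exact mul_mem (hy j) (hL j)
    obtain ⟨a, ha⟩ := key c.re fun j => hn (Sum.inl j)
    obtain ⟨b, hb⟩ := key c.im fun j => hn (Sum.inr j)
    exact ⟨⟨a, ha⟩, b, by rw [pow_zero, one_mul, hb]⟩
  · obtain ⟨n, hn⟩ := exists_pow_mul_mem_range hπ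
      (Sum.elim ((x⁻¹).1 *ᵥ ev 1) ((x⁻¹).1 *ᵥ ev c.θ))
    refine ⟨n, fun y hy i => ?_⟩
    obtain ⟨⟨a, ha⟩, b, hb⟩ := hy
    have e : algebraMap R E (π ^ n) * y = algebraMap R F (π ^ n) • y := by
      rw [IsScalarTower.algebraMap_apply R F E, ← Algebra.smul_def]
    rw [e, ← c.eq_add y, ← ha, ← hb, Algebra.algebraMap_eq_smul_one (A := E), map_smul, map_add, map_smul, map_smul, Matrix.mulVec_smul,
      Matrix.mulVec_add, Matrix.mulVec_smul, Matrix.mulVec_smul, smul_add]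
    simp only [Pi.add_apply, Pi.smul_apply, smul_eq_mul]
    rw [mul_left_comm, mul_left_comm _ (algebraMap R F (π ^ 0 * b))]
    exact add_mem (mul_mem ⟨a, rfl⟩ (hn (Sum.inl i))) (mul_mem ⟨_, rfl⟩ (hn (Sum.inr i)))

lemma exists_matrixLattice_eq_order {π : R} (hπ : Irreducible π) (ev : E ≃ₗ[F] (Fin 2 → F))
    (i : ℕ) : ∃ x : GL (Fin 2) F, ∀ y, y ∈ matrixLattice R ev x ↔ y ∈ c.order π i := by
  have hp : algebraMap R F (π ^ i) ≠ 0 := by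
    rw [map_ne_zero_iff _ (IsFractionRing.injective R F)]
    exact pow_ne_zero _ hπ.ne_zero
  -- The columns of the required matrix are `ev 1` and `ev (πⁱ θ)`; `S` is the associated map and
  -- `T` its inverse.
  let T : (Fin 2 → F) →ₗ[F] (Fin 2 → F) := LinearMap.pi
    ![c.re.comp ev.symm.toLinearMap, (algebraMap R F (π ^ i))⁻¹ • c.im.comp ev.symm.toLinearMap]
  let S : (Fin 2 → F) →ₗ[F] (Fin 2 → F) := ev.toLinearMap.comp
    ((LinearMap.proj 0).smulRight (1 : E) +
      (LinearMap.proj 1).smulRight (algebraMap R F (π ^ i) • c.θ))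
  have hT : ∀ y, T (ev y) = ![c.re y, (algebraMap R F (π ^ i))⁻¹ * c.im y] := by
    intro y; ext j; fin_cases j <;> simp [T]
  have hTS : T.comp S = LinearMap.id := by
    refine LinearMap.ext fun w => ?_
    change T (ev _) = w
    rw [hT]
    ext j
    fin_cases j
    · simp [c.re_one, c.re_θ]
    · simp only [map_pow] at hp
      simp [c.im_one, c.im_θ]
      field_simp
  have hST : S.comp T = LinearMap.id := (_root_.mul_eq_one_comm (M := Module.End F (Fin 2 → F))).mp hTS
  let x : GL (Fin 2) F := ⟨LinearMap.toMatrix' S, LinearMap.toMatrix' T,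
    by rw [← LinearMap.toMatrix'_comp, hST, LinearMap.toMatrix'_id],
    by rw [← LinearMap.toMatrix'_comp, hTS, LinearMap.toMatrix'_id]⟩
  refine ⟨x, fun y => ?_⟩
  have hx : (x⁻¹).1 *ᵥ ev y = T (ev y) := LinearMap.toMatrix'_mulVec T (ev y)
  rw [mem_matrixLattice, hx, hT, Fin.forall_fin_two]
  simp only [Matrix.cons_val_zero, Matrix.cons_val_one, RingHom.mem_range]
  refine and_congr Iff.rfl (exists_congr fun b => ?_)
  rw [map_mul, eq_inv_mul_iff_mul_eq₀ hp]

end Lattice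

/-! ### The quadratic extension and its scalar extension to K_v -/

section QuadExt

variable {K : Type*} [Field K] [NumberField K] {γ : GL (Fin 2) K}

lemma IsRegularElliptic.eval_ne_zero (hγ : IsRegularElliptic γ) (a : K) :
    γ.1.charpoly.eval a ≠ 0 := by
  intro h
  have hdeg := Polynomial.degree_eq_one_of_irreducible_of_root hγ h
  rw [Matrix.charpoly_degree_eq_dim] at hdeg
  norm_num at hdeg

lemma IsRegularElliptic.apply_one_zero_ne_zero (hγ : IsRegularElliptic γ) : γ.1 1 0 ≠ 0 := by
  intro h
  apply hγ.eval_ne_zero (γ.1 0 0)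
  rw [Matrix.charpoly_fin_two]
  simp [Matrix.trace_fin_two, Matrix.det_fin_two, h]
  ring

lemma IsRegularElliptic.fact (hγ : IsRegularElliptic γ) : Fact (Irreducible γ.1.charpoly) := ⟨hγ⟩

lemma root_mul_root : AdjoinRoot.root γ.1.charpoly * AdjoinRoot.root γ.1.charpoly =
    algebraMap K (quadExt γ) γ.1.trace * AdjoinRoot.root γ.1.charpoly -
      algebraMap K (quadExt γ) γ.1.det := by
  have h := AdjoinRoot.eval₂_root γ.1.charpoly
  have e : ∀ p, p = γ.1.charpoly → Polynomial.eval₂ (AdjoinRoot.of γ.1.charpoly)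
      (AdjoinRoot.root γ.1.charpoly) p = 0 := fun p hp => by rw [hp, h]
  have h := e _ (Matrix.charpoly_fin_two γ.1).symm
  simp only [Polynomial.eval₂_add, Polynomial.eval₂_sub, Polynomial.eval₂_mul, Polynomial.eval₂_C,
    Polynomial.eval₂_X, Polynomial.eval₂_X_pow] at h
  rw [AdjoinRoot.algebraMap_eq]
  linear_combination h

lemma IsRegularElliptic.root_notMem_range (hγ : IsRegularElliptic γ) :
    AdjoinRoot.root γ.1.charpoly ∉ Set.range (algebraMap K (quadExt γ)) := by
  have := hγ.fact
  rintro ⟨a, ha⟩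
  apply hγ.eval_ne_zero a
  apply (algebraMap K (quadExt γ)).injective
  rw [map_zero, ← Polynomial.eval₂_at_apply, ha]
  exact AdjoinRoot.eval₂_root γ.1.charpoly

lemma finrank_quadExt : Module.finrank K (quadExt γ) = 2 := by
  rw [(AdjoinRoot.powerBasis' (Matrix.charpoly_monic γ.1)).finrank, AdjoinRoot.powerBasis'_dim,
    Matrix.charpoly_natDegree_eq_dim, Fintype.card_fin]

lemma linearIndependent_pair {θ : quadExt γ} (hγ : IsRegularElliptic γ)
    (hθ : θ ∉ Set.range (algebraMap K (quadExt γ))) : LinearIndependent K ![1, θ] := by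
  have := hγ.fact
  rw [LinearIndependent.pair_iff]
  intro s t hst
  have ht : t = 0 := by
    by_contra ht
    apply hθ
    refine ⟨-(t⁻¹ * s), ?_⟩
    rw [Algebra.algebraMap_eq_smul_one, neg_smul, mul_smul, eq_neg_of_add_eq_zero_left hst, smul_neg,
      neg_neg, smul_smul, inv_mul_cancel₀ ht, one_smul]
  refine ⟨?_, ht⟩
  rw [ht, zero_smul, add_zero] at hst
  exact (smul_eq_zero.mp hst).resolve_right one_ne_zero

/-- The basis `1, θ` of `K_γ`. -/
noncomputable def pairBasis {θ : quadExt γ} (hγ : IsRegularElliptic γ)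
    (hθ : θ ∉ Set.range (algebraMap K (quadExt γ))) : Module.Basis (Fin 2) K (quadExt γ) :=
  basisOfLinearIndependentOfCardEqFinrank (linearIndependent_pair hγ hθ)
    (by rw [finrank_quadExt, Fintype.card_fin])

lemma pairBasis_eq {θ : quadExt γ} (hγ : IsRegularElliptic γ)
    (hθ : θ ∉ Set.range (algebraMap K (quadExt γ))) : ⇑(pairBasis hγ hθ) = ![1, θ] :=
  coe_basisOfLinearIndependentOfCardEqFinrank _ _

/-- The basis `1, θ` of `K_v ⊗ K_γ`. -/
noncomputable def localBasis {θ : quadExt γ} (hγ : IsRegularElliptic γ)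
    (hθ : θ ∉ Set.range (algebraMap K (quadExt γ))) (v : HeightOneSpectrum (𝓞 K)) :
    Module.Basis (Fin 2) (v.adicCompletion K) (localExt γ v) :=
  Algebra.TensorProduct.basis (v.adicCompletion K) (pairBasis hγ hθ)

lemma localBasis_zero {θ : quadExt γ} (hγ : IsRegularElliptic γ)
    (hθ : θ ∉ Set.range (algebraMap K (quadExt γ))) (v : HeightOneSpectrum (𝓞 K)) :
    localBasis hγ hθ v 0 = 1 := by
  rw [localBasis, Algebra.TensorProduct.basis_apply, pairBasis_eq]
  rfl

lemma localBasis_one {θ : quadExt γ} (hγ : IsRegularElliptic γ)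
    (hθ : θ ∉ Set.range (algebraMap K (quadExt γ))) (v : HeightOneSpectrum (𝓞 K)) :
    localBasis hγ hθ v 1 = 1 ⊗ₜ θ := by
  rw [localBasis, Algebra.TensorProduct.basis_apply, pairBasis_eq]
  rfl

lemma localBasis_repr_add {θ : quadExt γ} (hγ : IsRegularElliptic γ)
    (hθ : θ ∉ Set.range (algebraMap K (quadExt γ))) (v : HeightOneSpectrum (𝓞 K))
    (y : localExt γ v) :
    algebraMap (v.adicCompletion K) (localExt γ v) ((localBasis hγ hθ v).repr y 0) +
      (localBasis hγ hθ v).repr y 1 • ((1 : v.adicCompletion K) ⊗ₜ[K] θ : localExt γ v) = y := by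
  have := (localBasis hγ hθ v).sum_repr y
  rwa [Fin.sum_univ_two, localBasis_zero, localBasis_one, ← Algebra.algebraMap_eq_smul_one] at this

variable (γ) in
/-- The root of the characteristic polynomial in `K_v ⊗ K_γ`. -/
noncomputable abbrev localRoot (v : HeightOneSpectrum (𝓞 K)) : localExt γ v :=
  (1 : v.adicCompletion K) ⊗ₜ[K] AdjoinRoot.root γ.1.charpoly

lemma tmul_algebraMap (v : HeightOneSpectrum (𝓞 K)) (a : K) :
    ((1 : v.adicCompletion K) ⊗ₜ[K] algebraMap K (quadExt γ) a : localExt γ v) =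
      algebraMap (v.adicCompletion K) (localExt γ v) (algebraMap K _ a) := by
  rw [Algebra.TensorProduct.algebraMap_apply, Algebra.algebraMap_self, RingHom.id_apply,
    Algebra.algebraMap_eq_smul_one, Algebra.algebraMap_eq_smul_one, TensorProduct.tmul_smul,
    TensorProduct.smul_tmul']

lemma localRoot_mul_localRoot (v : HeightOneSpectrum (𝓞 K)) : localRoot γ v * localRoot γ v =
    algebraMap K (v.adicCompletion K) γ.1.trace • localRoot γ v -
      algebraMap (v.adicCompletion K) (localExt γ v) (algebraMap K _ γ.1.det) := by
  rw [localRoot, Algebra.TensorProduct.tmul_mul_tmul, root_mul_root, TensorProduct.tmul_sub, mul_one,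
    tmul_algebraMap, Algebra.smul_def, ← tmul_algebraMap v γ.1.trace,
    Algebra.TensorProduct.tmul_mul_tmul, mul_one]

/-- Coordinates on `K_v ⊗ K_γ` in which multiplication by the root is given by `γ`. -/
lemma exists_coordinates (hγ : IsRegularElliptic γ) (v : HeightOneSpectrum (𝓞 K)) :
    ∃ ev : localExt γ v ≃ₗ[v.adicCompletion K] (Fin 2 → v.adicCompletion K),
      (toLocal v γ).1 = mulMatrix ev (localRoot γ v) := by
  set a := algebraMap K (v.adicCompletion K) (γ.1 0 0)
  set b := algebraMap K (v.adicCompletion K) (γ.1 1 0) with hbdef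
  have hb : b ≠ 0 := by
    rw [hbdef, map_ne_zero]
    exact hγ.apply_one_zero_ne_zero
  -- The coordinates send 1 to the first standard vector and the root to its image under γ, the
  -- first column. This is a basis since the lower left entry is nonzero by irreducibility.
  let L : (Fin 2 → v.adicCompletion K) ≃ₗ[v.adicCompletion K] (Fin 2 → v.adicCompletion K) :=
    { toFun := fun w => ![w 0 + w 1 * a, w 1 * b]
      map_add' := fun w w' => by funext i; fin_cases i <;> simp <;> try ring
      map_smul' := fun r w => by funext i; fin_cases i <;> simp <;> try ring
      invFun := fun w => ![w 0 - w 1 / b * a, w 1 / b]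
      left_inv := fun w => by funext i; fin_cases i <;> simp [hb]
      right_inv := fun w => by funext i; fin_cases i <;> simp [hb] }
  let B := localBasis hγ hγ.root_notMem_range v
  let ev := B.equivFun.trans L
  have h1 : ev 1 = ![1, 0] := by
    rw [← localBasis_zero hγ hγ.root_notMem_range v]
    change L (B.equivFun (B 0)) = _
    funext i; fin_cases i <;> simp [L]
  have h2 : ev (localRoot γ v) = ![a, b] := by
    rw [localRoot, ← localBasis_one hγ hγ.root_notMem_range v]
    change L (B.equivFun (B 1)) = _
    funext i; fin_cases i <;> simp [L]
  refine ⟨ev, eq_mulMatrix_of_forall fun y => ?_⟩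
  rw [← localBasis_repr_add hγ hγ.root_notMem_range v y]
  generalize (localBasis hγ hγ.root_notMem_range v).repr y 0 = p
  generalize (localBasis hγ hγ.root_notMem_range v).repr y 1 = q
  rw [Algebra.algebraMap_eq_smul_one, mul_add, mul_smul_comm, mul_smul_comm, mul_one,
    localRoot_mul_localRoot, Algebra.algebraMap_eq_smul_one (A := localExt γ v)]
  simp only [map_add, map_smul, map_sub, h1, h2]
  funext i
  fin_cases i
  · simp [toLocal, Matrix.mulVec, dotProduct, Fin.sum_univ_two, Matrix.trace_fin_two,
      Matrix.det_fin_two, a, b]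
    ring
  · simp [toLocal, Matrix.mulVec, dotProduct, Fin.sum_univ_two, Matrix.trace_fin_two,
      Matrix.det_fin_two, a, b]
    ring

end QuadExt

namespace QuadCoord

variable {R F E : Type*} [CommRing R] [Field F] [Algebra R F]
  [CommRing E] [Algebra F E] [Algebra R E] [IsScalarTower R F E]
  (c : QuadCoord R F E)
variable [IsDomain R] [IsDiscreteValuationRing R] [IsFractionRing R F]
  [Finite (IsLocalRing.ResidueField R)]

/-- The successive indices multiply to (q - χ) qⁱ with χ = r - 1. The identity is stated over ℤ
because χ may be -1. -/
lemma relIndex_unitGroup_zero {π : R} (hπ : Irreducible π) (i : ℕ) :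
    (((c.unitGroup π (i + 1)).relIndex (c.unitGroup π 0) : ℕ) : ℤ) =
      (Nat.card (IsLocalRing.ResidueField R) - (c.residueRoots.ncard - 1)) *
        Nat.card (IsLocalRing.ResidueField R) ^ i := by
  induction i with
  | zero =>
    have := c.relIndex_unitGroup_one hπ
    rw [zero_add, pow_zero, mul_one]
    omega
  | succ i ih =>
    rw [← Subgroup.relIndex_mul_relIndex _ _ _ (c.unitGroup_antitone π (Nat.le_succ (i + 1)))
      (c.unitGroup_antitone π (Nat.zero_le (i + 1))), Nat.cast_mul, ih,
      c.relIndex_unitGroup_succ hπ (Nat.succ_ne_zero i), pow_succ]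
    ring

lemma relIndex_unitGroup_ne_zero {π : R} (hπ : Irreducible π) (i : ℕ) :
    (c.unitGroup π i).relIndex (c.unitGroup π 0) ≠ 0 := by
  rcases i with _ | i
  · rw [Subgroup.relIndex_self]; exact one_ne_zero
  · have h := c.relIndex_unitGroup_zero hπ i
    have hq := one_lt_card_residueField (R := R)
    have hr := c.residueRoots_ncard_le_two
    intro h0
    rw [h0, Nat.cast_zero] at h
    rcases mul_eq_zero.mp h.symm with h1 | h1
    · omega
    · have := pow_ne_zero i (by omega : (Nat.card (IsLocalRing.ResidueField R) : ℤ) ≠ 0)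
      exact this h1

end QuadCoord

/-! ### The local orbital integral -/

section Orbital

variable {K : Type*} [Field K] [NumberField K] {γ : GL (Fin 2) K}

lemma isIntegralMatrix_iff_mem (v : HeightOneSpectrum (𝓞 K))
    {A : Matrix (Fin 2) (Fin 2) (v.adicCompletion K)} :
    IsIntegralMatrix (v.adicCompletionIntegers K) A ↔
      ∀ i j, A i j ∈ v.adicCompletionIntegers K :=
  forall₂_congr fun _ _ => ⟨fun ⟨r, hr⟩ => hr ▸ r.2, fun h => ⟨⟨_, h⟩, rfl⟩⟩

lemma mem_maxCompactGL_iff (v : HeightOneSpectrum (𝓞 K)) {x : GL (Fin 2) (v.adicCompletion K)} :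
    x ∈ maxCompactGL v ↔ IsIntegralMatrix (v.adicCompletionIntegers K) x.1 ∧
      IsIntegralMatrix (v.adicCompletionIntegers K) (x⁻¹).1 := by
  rw [maxCompactGL_eq, Submonoid.mem_units_iff, isIntegralMatrix_iff_mem, isIntegralMatrix_iff_mem]
  rfl

lemma det_toLocal (v : HeightOneSpectrum (𝓞 K)) (x : GL (Fin 2) (v.adicCompletion K)) :
    (x⁻¹ * toLocal v γ * x).1.det = algebraMap K (v.adicCompletion K) γ.1.det := by
  rw [Units.val_mul, Units.val_mul, Matrix.det_mul, Matrix.det_mul, mul_right_comm,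
    ← Matrix.det_mul, ← Units.val_mul, inv_mul_cancel, Units.val_one, Matrix.det_one, one_mul,
    RingHom.map_det]
  rfl

lemma testFunction_conj (k : ℕ) (v : HeightOneSpectrum (𝓞 K))
    (x : GL (Fin 2) (v.adicCompletion K)) :
    testFunction v k (x⁻¹ * toLocal v γ * x) =
      Set.indicator {x : GL (Fin 2) (v.adicCompletion K) |
        IsIntegralMatrix (v.adicCompletionIntegers K) (x⁻¹ * toLocal v γ * x).1 ∧
        v.valuation K γ.1.det = WithZero.exp (-(k : ℤ))} 1 x := by
  classical
  rw [testFunction, Set.indicator_apply, Set.indicator_apply]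
  refine if_congr ?_ rfl rfl
  simp only [Set.mem_ofPred_eq]
  rw [det_toLocal, valued_algebraMap, isIntegralMatrix_iff_mem]

lemma localOrbital_eq_zero (k : HeightOneSpectrum (𝓞 K) → ℕ) (v : HeightOneSpectrum (𝓞 K))
    (h : ∀ x : GL (Fin 2) (v.adicCompletion K),
      ¬ (IsIntegralMatrix (v.adicCompletionIntegers K) (x⁻¹ * toLocal v γ * x).1 ∧
        v.valuation K γ.1.det = WithZero.exp (-(k v : ℤ)))) : localOrbital γ k v = 0 := by
  rw [localOrbital, orbitalIntegral]
  have : orbitFunction (toLocal v γ) (testFunction v (k v)) = 0 := by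
    funext y
    induction y using Quotient.inductionOn with
    | h x =>
      change testFunction v (k v) (x⁻¹ * toLocal v γ * x) = 0
      rw [testFunction_conj]
      classical
      rw [Set.indicator_apply]
      exact if_neg (h x)
  rw [this]
  simp

lemma localOrbital_eq_zero_of_valuation_ne (k : HeightOneSpectrum (𝓞 K) → ℕ)
    (v : HeightOneSpectrum (𝓞 K)) (h : v.valuation K γ.1.det ≠ WithZero.exp (-(k v : ℤ))) :
    localOrbital γ k v = 0 :=
  localOrbital_eq_zero k v fun _ hx => h hx.2

variable {v : HeightOneSpectrum (𝓞 K)}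
  (c : QuadCoord (v.adicCompletionIntegers K) (v.adicCompletion K) (localExt γ v))

/-- A conjugate of `γ` is integral if and only if the order of the lattice contains the root. -/
lemma isIntegralMatrix_conj_iff {π : v.adicCompletionIntegers K}
    {ev : localExt γ v ≃ₗ[v.adicCompletion K] (Fin 2 → v.adicCompletion K)}
    (hev : (toLocal v γ).1 = mulMatrix ev (localRoot γ v)) {x : GL (Fin 2) (v.adicCompletion K)}
    {z : (localExt γ v)ˣ} {i : ℕ}
    (hz : ∀ y, y ∈ matrixLattice (v.adicCompletionIntegers K) ev x ↔ ↑z⁻¹ * y ∈ c.order π i) :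
    IsIntegralMatrix (v.adicCompletionIntegers K) (x⁻¹ * toLocal v γ * x).1 ↔
      localRoot γ v ∈ c.order π i := by
  rw [Units.val_mul, Units.val_mul, hev, isIntegralMatrix_iff_forall_mem]
  constructor
  · intro h
    have h1 := h z ((hz _).mpr (by rw [Units.inv_mul]; exact one_mem _))
    rwa [hz, mul_comm (localRoot γ v), Units.inv_mul_cancel_left] at h1
  · intro h y hy
    rw [hz] at hy ⊢
    rw [mul_left_comm]
    exact mul_mem h hy

lemma localOrbital_eq_zero_of_notMem (hγ : IsRegularElliptic γ) {π : v.adicCompletionIntegers K}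
    (hπ : Irreducible π) (k : HeightOneSpectrum (𝓞 K) → ℕ)
    (h : localRoot γ v ∉ c.order π 0) : localOrbital γ k v = 0 := by
  obtain ⟨ev, hev⟩ := exists_coordinates hγ v
  refine localOrbital_eq_zero k v fun x hx => h ?_
  obtain ⟨z, i, hz⟩ := exists_matrixLattice_eq c hπ ev x
  exact c.order_antitone π (Nat.zero_le i) ((isIntegralMatrix_conj_iff c hev hz).mp hx.1)

/-- The centralizer is Eˣ acting on lattices, so double cosets are classes of lattices up to
homothety by Eˣ, numbered by the multiplier order O_i. The integrand is 1 on the classes whose order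
contains the root, i ≤ n. The stabilizer of O_i is O_iˣ, so its class has volume [O_0ˣ : O_iˣ]. -/
theorem localOrbital_eq_sum (hγ : IsRegularElliptic γ) {π : v.adicCompletionIntegers K}
    (hπ : Irreducible π) (k : HeightOneSpectrum (𝓞 K) → ℕ)
    (hdet : v.valuation K γ.1.det = WithZero.exp (-(k v : ℤ))) {n : ℕ}
    (hn : ∀ i, localRoot γ v ∈ c.order π i ↔ i ≤ n) :
    localOrbital γ k v =
      ∑ i ∈ Finset.range (n + 1), ((c.unitGroup π i).relIndex (c.unitGroup π 0) : ℝ) := by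
  obtain ⟨ev, hev⟩ := exists_coordinates hγ v
  have hgen : ∀ y : localExt γ v, ∃ p q : v.adicCompletion K,
      y = algebraMap _ _ p + q • localRoot γ v := fun y =>
    ⟨_, _, (localBasis_repr_add hγ hγ.root_notMem_range v y).symm⟩
  set g := toLocal v γ with hg
  set H := Subgroup.centralizer {g} with hHdef
  set C := maxCompactGL v with hCdef
  obtain ⟨Φ, hΦ⟩ : ∃ Φ : (localExt γ v)ˣ ≃* H,
      ∀ u, (Φ u).1.1 = mulMatrix ev u :=
    ⟨unitsEquivCentralizer ev hgen hev, fun u => rfl⟩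
  choose x hx using fun i => exists_matrixLattice_eq_order c hπ ev i
  have hcomm : ∀ a b : H, a * b = b * a := fun a b => by
    obtain ⟨a, rfl⟩ := Φ.surjective a
    obtain ⟨b, rfl⟩ := Φ.surjective b
    rw [← map_mul, ← map_mul, mul_comm]
  have hH : IsClosed (H : Set (GL (Fin 2) (v.adicCompletion K))) :=
    Set.isClosed_centralizer _
  have hC : ∀ (i : ℕ) (y : GL (Fin 2) (v.adicCompletion K)) (u : (localExt γ v)ˣ),
      (x i)⁻¹ * ((Φ u : GL (Fin 2) (v.adicCompletion K)) * y) ∈ C ↔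
        ∀ w, w ∈ matrixLattice (v.adicCompletionIntegers K) ev y ↔ ↑u * w ∈ c.order π i := by
    intro i y u
    rw [hCdef, mem_maxCompactGL_iff, isIntegralMatrix_and_inv_iff ev _ _ u (hΦ u)]
    exact forall_congr' fun w => by rw [hx]
  have hStab : ∀ i, cosetStab H C (x i) = (c.unitGroup π i).map Φ.toMonoidHom := by
    intro i
    ext h
    obtain ⟨u, rfl⟩ := Φ.surjective h
    rw [mem_cosetStab, mul_assoc, hC]
    have : Φ u ∈ (c.unitGroup π i).map Φ.toMonoidHom ↔ u ∈ c.unitGroup π i :=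
      Subgroup.mem_map_iff_mem Φ.injective
    have h1 := c.smul_order_eq_iff hπ (i := i) (z := 1) (w := u⁻¹)
    simp only [inv_one, Units.val_one, one_mul, inv_inv, inv_mem_iff] at h1
    rw [this, ← h1]
    exact forall_congr' fun w => by rw [hx]
  -- An element of `E` and its multiplication matrix are integral together, so the normalising
  -- subgroup is O_0ˣ.
  have hU : maxCompactCentralizer v g = ((c.unitGroup π 0).map Φ.toMonoidHom : Set H) := by
    ext h
    obtain ⟨u, rfl⟩ := Φ.surjective h
    have : Φ u ∈ (c.unitGroup π 0).map Φ.toMonoidHom ↔ u ∈ c.unitGroup π 0 :=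
      Subgroup.mem_map_iff_mem Φ.injective
    rw [SetLike.mem_coe, this, c.mem_unitGroup, c.mem_order_zero_iff, c.mem_order_zero_iff]
    rw [maxCompactCentralizer, Set.mem_ofPred_eq, ← map_inv]
    have hint : ∀ w : localExt γ v, IsIntegral (v.adicCompletionIntegers K) (mulMatrix ev w) ↔
        IsIntegral (v.adicCompletionIntegers K) w := fun w =>
      isIntegral_algHom_iff ((mulMatrix ev).restrictScalars (v.adicCompletionIntegers K))
        (mulMatrix_injective ev)
    rw [hΦ, hΦ]
    exact and_congr (hint _) (hint _)
  have hex : ∃ ν, IsQuotientMeasure H (C : Set (GL (Fin 2) (v.adicCompletion K)))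
      (maxCompactCentralizer v g) ν := by
    rw [hU, ← hStab]
    exact exists_isQuotientMeasure hH hcomm (isCompact_maxCompactGL v) (isOpen_maxCompactGL v)
      (isCompact_cosetStab hH (isCompact_maxCompactGL v) _)
      (isOpen_cosetStab (isOpen_maxCompactGL v) _) ⟨1, one_mem _⟩
  have hν : IsQuotientMeasure H (C : Set (GL (Fin 2) (v.adicCompletion K)))
      ((c.unitGroup π 0).map Φ.toMonoidHom : Set H)
      (quotientMeasure H (C : Set (GL (Fin 2) (v.adicCompletion K)))
        (maxCompactCentralizer v g)) := by
    rw [← hU, quotientMeasure, dif_pos hex]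
    exact hex.choose_spec
  let A : Set (Quotient (QuotientGroup.rightRel H)) :=
    {y | orbitFunction g (testFunction v (k v)) y = 1}
  have hfun : ∀ y, orbitFunction g (testFunction v (k v)) (Quotient.mk _ y) =
      Set.indicator {y | IsIntegralMatrix (v.adicCompletionIntegers K) (y⁻¹ * g * y).1} 1 y := by
    classical
    intro y
    change testFunction v (k v) (y⁻¹ * g * y) = _
    rw [hg, testFunction_conj, Set.indicator_apply, Set.indicator_apply]
    refine if_congr ?_ rfl rfl
    simp [hdet]
  have hAiff : ∀ y, Quotient.mk _ y ∈ A ↔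
      IsIntegralMatrix (v.adicCompletionIntegers K) (y⁻¹ * g * y).1 := by
    classical
    intro y
    rw [Set.mem_ofPred_eq, hfun, Set.indicator_apply]
    simp
  have hA : ∀ y, Quotient.mk _ y ∈ A ↔ ∃ i ∈ Finset.range (n + 1), ∃ h : H,
      (x i)⁻¹ * (h * y) ∈ C := by
    intro y
    rw [hAiff]
    obtain ⟨z, i, hz⟩ := exists_matrixLattice_eq c hπ ev y
    rw [isIntegralMatrix_conj_iff c hev hz, hn]
    constructor
    · intro hi
      refine ⟨i, Finset.mem_range.mpr (by omega), Φ z⁻¹, (hC _ _ _).mpr hz⟩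
    · rintro ⟨j, hj, h, hh⟩
      obtain ⟨u, rfl⟩ := Φ.surjective h
      rw [hC] at hh
      have := (c.eq_of_smul_order_eq hπ (i := i) (j := j) (z := z) (w := u⁻¹) fun w => by
        rw [← hz, hh, inv_inv]).1
      have := Finset.mem_range.mp hj
      omega
  have hdisj : ∀ i ∈ Finset.range (n + 1), ∀ j ∈ Finset.range (n + 1), ∀ h : H,
      (x i)⁻¹ * (h * x j) ∈ C → i = j := by
    intro i _ j _ h hh
    obtain ⟨u, rfl⟩ := Φ.surjective h
    rw [hC] at hh
    refine ((c.eq_of_smul_order_eq hπ (i := j) (j := i) (z := 1) (w := u⁻¹) fun w => ?_).1).symm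
    rw [inv_one, Units.val_one, one_mul, inv_inv, ← hh, hx]
  have hrel : ∀ i, (cosetStab H C (x i)).relIndex ((c.unitGroup π 0).map Φ.toMonoidHom) =
      (c.unitGroup π i).relIndex (c.unitGroup π 0) := fun i => by
    rw [hStab, Subgroup.relIndex_map_map_of_injective _ _ Φ.injective]
  have hmeas := hν.measure_eq_sum hcomm (isOpen_maxCompactGL v)
    (n := n + 1) x (fun i _ => by
      rw [hStab]; exact Subgroup.map_mono (c.unitGroup_antitone π (Nat.zero_le i)))
    (fun i _ => by rw [hrel]; exact c.relIndex_unitGroup_ne_zero hπ i) hA hdisj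
  have hAm : MeasurableSet A := by
    change MeasurableSet (Quotient.mk _ ⁻¹' A)
    have : (Quotient.mk (QuotientGroup.rightRel H) ⁻¹' A) =
        (fun y => (y⁻¹ * g * y).1) ⁻¹' (integralMatrices v) := by
      ext y
      rw [Set.mem_preimage, hAiff, isIntegralMatrix_iff_mem]
      rfl
    have hcont : Continuous fun y : GL (Fin 2) (v.adicCompletion K) => (y⁻¹ * g * y).1 :=
      Units.continuous_val.comp ((continuous_inv.mul continuous_const).mul continuous_id)
    rw [this]
    exact ((isOpen_integralMatrices v).preimage hcont).measurableSet
  have hind : orbitFunction g (testFunction v (k v)) = A.indicator 1 := by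
    classical
    funext y
    induction y using Quotient.inductionOn with
    | h y =>
      rw [hfun, Set.indicator_apply, Set.indicator_apply]
      exact if_congr (hAiff y).symm rfl rfl
  rw [localOrbital, orbitalIntegral, hind, integral_indicator_one hAm, Measure.real, hmeas,
    ENNReal.toReal_sum fun i _ => ENNReal.natCast_ne_top _]
  refine Finset.sum_congr rfl fun i _ => ?_
  rw [hrel, ENNReal.toReal_natCast]

end Orbital

/-- An integral element of a quadratic algebra has integral trace and norm. -/
lemma mem_range_of_isIntegral_of_quadratic {R F E : Type*} [CommRing R] [IsDomain R]
    [IsIntegrallyClosed R] [Field F] [Algebra R F] [IsFractionRing R F] [CommRing E] [Algebra F E]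
    [Algebra R E] [IsScalarTower R F E] {y : E} {T N : F}
    (h : y * y = algebraMap F E T * y - algebraMap F E N)
    (hind : ∀ a b : F, algebraMap F E a * y + algebraMap F E b = 0 → a = 0 ∧ b = 0)
    (hy : IsIntegral R y) : T ∈ (algebraMap R F).range ∧ N ∈ (algebraMap R F).range := by
  obtain ⟨p, hp, hpy⟩ := hy
  let Q : Polynomial F := .X ^ 2 + (-.C T * .X + .C N)
  have hQm : Q.Monic := by
    apply Polynomial.monic_X_pow_add
    compute_degree!
  have hQy : Polynomial.aeval y Q = 0 := by
    simp only [Q, map_add, map_mul, map_neg, map_pow, Polynomial.aeval_X, Polynomial.aeval_C]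
    linear_combination h
  have hpy' : Polynomial.aeval y (p.map (algebraMap R F)) = 0 := by
    rw [Polynomial.aeval_map_algebraMap]
    exact hpy
  -- The remainder modulo `Q` is linear and vanishes at `y`, hence is zero by `hind`.
  have hdvd : Q ∣ p.map (algebraMap R F) := by
    rw [← Polynomial.modByMonic_eq_zero_iff_dvd hQm]
    have h1 := Polynomial.aeval_modByMonic_eq_self_of_root hQy (p := p.map (algebraMap R F))
    rw [hpy'] at h1
    have hQd : Q.natDegree = 2 := by
      simp only [Q]
      compute_degree!
    have hdeg : (p.map (algebraMap R F) %ₘ Q).natDegree ≤ 1 := by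
      have := Polynomial.natDegree_modByMonic_lt (p.map (algebraMap R F)) hQm (by
        intro h1; rw [h1, Polynomial.natDegree_one] at hQd; omega)
      omega
    obtain ⟨a, b, hab⟩ := Polynomial.exists_eq_X_add_C_of_natDegree_le_one hdeg
    rw [hab] at h1 ⊢
    simp only [map_add, map_mul, Polynomial.aeval_X, Polynomial.aeval_C] at h1
    obtain ⟨rfl, rfl⟩ := hind a b h1
    simp
  -- Gauss's lemma over an integrally closed domain: a monic factor of a monic integral polynomial
  -- is integral.
  obtain ⟨g, hg⟩ := IsIntegrallyClosed.eq_map_mul_C_of_dvd F hp hdvd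
  rw [hQm.leadingCoeff, map_one, mul_one] at hg
  constructor
  · refine ⟨-g.coeff 1, ?_⟩
    rw [map_neg, ← Polynomial.coeff_map, hg]
    simp [Q, Polynomial.coeff_X_pow, Polynomial.coeff_C]
  · refine ⟨g.coeff 0, ?_⟩
    rw [← Polynomial.coeff_map, hg]
    simp [Q, Polynomial.coeff_X_pow]

/-! ### Discriminants and the choice of a local generator -/

section QuadExt

variable {K : Type*} [Field K] [NumberField K] {γ : GL (Fin 2) K}

/-- Cayley–Hamilton for the 2 × 2 matrix of multiplication by `x`. -/
lemma mul_self_eq_trace_norm (hγ : IsRegularElliptic γ) (x : quadExt γ) :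
    x * x = algebraMap K (quadExt γ) (Algebra.trace K (quadExt γ) x) * x -
      algebraMap K (quadExt γ) (Algebra.norm K x) := by
  let b := pairBasis hγ hγ.root_notMem_range
  apply Algebra.leftMulMatrix_injective b
  rw [Algebra.trace_eq_matrix_trace b, Algebra.norm_eq_matrix_det b, map_sub, map_mul, map_mul,
    AlgHom.commutes, AlgHom.commutes]
  generalize Algebra.leftMulMatrix b x = M
  ext i j
  fin_cases i <;> fin_cases j <;>
  · simp [Matrix.mul_apply, Fin.sum_univ_two, Matrix.trace_fin_two, Matrix.det_fin_two,
      Matrix.algebraMap_matrix_apply]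
    ring

lemma finiteDimensional_quadExt : FiniteDimensional K (quadExt γ) :=
  Module.finite_of_finrank_pos (by rw [finrank_quadExt]; norm_num)

lemma trace_one_quadExt : Algebra.trace K (quadExt γ) 1 = 2 := by
  rw [← map_one (algebraMap K (quadExt γ)), Algebra.trace_algebraMap, finrank_quadExt]
  norm_num

lemma discr_pair (hγ : IsRegularElliptic γ) (θ : quadExt γ) : Algebra.discr K ![1, θ] =
    Algebra.trace K (quadExt γ) θ ^ 2 - 4 * Algebra.norm K θ := by
  have h : Algebra.trace K (quadExt γ) (θ * θ) =
      Algebra.trace K (quadExt γ) θ ^ 2 - 2 * Algebra.norm K θ := by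
    rw [mul_self_eq_trace_norm hγ, map_sub, ← Algebra.smul_def, map_smul,
      Algebra.algebraMap_eq_smul_one (Algebra.norm K θ), map_smul, trace_one_quadExt, smul_eq_mul,
      smul_eq_mul]
    ring
  rw [Algebra.discr_def, Matrix.det_fin_two]
  simp only [Algebra.traceMatrix_apply, Algebra.traceForm_apply, Matrix.cons_val_zero,
    Matrix.cons_val_one, mul_one, one_mul, trace_one_quadExt, h]
  ring

lemma discr_pair_eq (θ : quadExt γ) (p q p' q' : K) :
    Algebra.discr K ![algebraMap K (quadExt γ) p + q • θ, algebraMap K (quadExt γ) p' + q' • θ] =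
      (p * q' - q * p') ^ 2 * Algebra.discr K ![1, θ] := by
  have h := Algebra.discr_of_matrix_vecMul ![1, θ] !![p, p'; q, q']
  rw [Matrix.det_fin_two] at h
  convert h using 2
  · funext i
    fin_cases i <;>
      simp [Matrix.vecMul, dotProduct, Fin.sum_univ_two, Algebra.smul_def, mul_comm]
  · simp
    ring

lemma discr_pair_ne_zero (hγ : IsRegularElliptic γ) {θ : quadExt γ}
    (hθ : θ ∉ Set.range (algebraMap K (quadExt γ))) : Algebra.discr K ![1, θ] ≠ 0 := by
  have := hγ.fact
  have := finiteDimensional_quadExt (γ := γ)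
  rw [← pairBasis_eq hγ hθ]
  exact Algebra.discr_not_zero_of_basis K _

lemma exists_trace_norm_eq (hγ : IsRegularElliptic γ) {θ : quadExt γ} (hθ : IsIntegral (𝓞 K) θ) :
    ∃ t m : 𝓞 K, algebraMap (𝓞 K) K t = Algebra.trace K (quadExt γ) θ ∧
      algebraMap (𝓞 K) K m = Algebra.norm K θ := by
  have := hγ.fact
  have := finiteDimensional_quadExt (γ := γ)
  obtain ⟨t, ht⟩ := IsIntegrallyClosed.isIntegral_iff.mp (Algebra.isIntegral_trace (L := K) hθ)
  obtain ⟨m, hm⟩ := IsIntegrallyClosed.isIntegral_iff.mp (Algebra.isIntegral_norm (K := K) hθ)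
  exact ⟨t, m, ht, hm⟩

lemma exists_eq_add_smul (hγ : IsRegularElliptic γ) {θ : quadExt γ}
    (hθ : θ ∉ Set.range (algebraMap K (quadExt γ))) (x : quadExt γ) :
    ∃ p q : K, x = algebraMap K (quadExt γ) p + q • θ := by
  have := (pairBasis hγ hθ).sum_repr x
  rw [Fin.sum_univ_two, pairBasis_eq] at this
  exact ⟨_, _, by rw [Algebra.algebraMap_eq_smul_one]; exact this.symm⟩

lemma add_smul_notMem_range {θ : quadExt γ} (hθ : θ ∉ Set.range (algebraMap K (quadExt γ)))
    (p : K) {q : K} (hq : q ≠ 0) :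
    algebraMap K (quadExt γ) p + q • θ ∉ Set.range (algebraMap K (quadExt γ)) := by
  rintro ⟨a, ha⟩
  apply hθ
  refine ⟨q⁻¹ * (a - p), ?_⟩
  rw [map_mul, map_sub, ha, add_sub_cancel_left, ← Algebra.smul_def, smul_smul,
    inv_mul_cancel₀ hq, one_smul]

lemma tmul_mul_self (hγ : IsRegularElliptic γ) (v : HeightOneSpectrum (𝓞 K)) (x : quadExt γ) :
    ((1 : v.adicCompletion K) ⊗ₜ[K] x : localExt γ v) * (1 : v.adicCompletion K) ⊗ₜ[K] x =
      algebraMap (v.adicCompletion K) (localExt γ v) (algebraMap K _ (Algebra.trace K _ x)) *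
        (1 : v.adicCompletion K) ⊗ₜ[K] x -
      algebraMap (v.adicCompletion K) (localExt γ v) (algebraMap K _ (Algebra.norm K x)) := by
  rw [← tmul_algebraMap, ← tmul_algebraMap, Algebra.TensorProduct.tmul_mul_tmul,
    Algebra.TensorProduct.tmul_mul_tmul, mul_self_eq_trace_norm hγ, TensorProduct.tmul_sub, mul_one]

lemma valuation_le_one_of_isIntegral_tmul (hγ : IsRegularElliptic γ) {v : HeightOneSpectrum (𝓞 K)}
    {x : quadExt γ} (hx : x ∉ Set.range (algebraMap K (quadExt γ)))
    (h : IsIntegral (v.adicCompletionIntegers K)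
      ((1 : v.adicCompletion K) ⊗ₜ[K] x : localExt γ v)) :
    v.valuation K (Algebra.trace K _ x) ≤ 1 ∧ v.valuation K (Algebra.norm K x) ≤ 1 := by
  have key := mem_range_of_isIntegral_of_quadratic (tmul_mul_self hγ v x) (fun a b hab => by
    have h1 := (localBasis hγ hx v).linearIndependent
    rw [Fintype.linearIndependent_iff] at h1
    have h2 := h1 ![b, a] (by
      rw [Fin.sum_univ_two, localBasis_zero, localBasis_one]
      simp only [Matrix.cons_val_zero, Matrix.cons_val_one]
      rw [← Algebra.algebraMap_eq_smul_one, Algebra.smul_def, add_comm]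
      exact hab)
    exact ⟨h2 1, h2 0⟩) h
  rw [← valued_algebraMap, ← valued_algebraMap]
  obtain ⟨⟨a, ha⟩, b, hb⟩ := key
  rw [← ha, ← hb]
  exact ⟨a.2, b.2⟩

lemma isIntegral_tmul_of_valuation_le_one (hγ : IsRegularElliptic γ) {v : HeightOneSpectrum (𝓞 K)}
    {x : quadExt γ} (h1 : v.valuation K (Algebra.trace K _ x) ≤ 1)
    (h2 : v.valuation K (Algebra.norm K x) ≤ 1) : IsIntegral (v.adicCompletionIntegers K)
      ((1 : v.adicCompletion K) ⊗ₜ[K] x : localExt γ v) := by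
  rw [← valued_algebraMap] at h1 h2
  exact isIntegral_of_quadratic ⟨_, h1⟩ ⟨_, h2⟩ (tmul_mul_self hγ v x)

lemma valuation_le_one_of_eq (v : HeightOneSpectrum (𝓞 K)) {x : K} {r : 𝓞 K}
    (h : algebraMap (𝓞 K) K r = x) : v.valuation K x ≤ 1 := by
  rw [← h]; exact v.valuation_le_one r

lemma isIntegral_tmul (hγ : IsRegularElliptic γ) (v : HeightOneSpectrum (𝓞 K))
    {x : quadExt γ} (hx : IsIntegral (𝓞 K) x) : IsIntegral (v.adicCompletionIntegers K)
      ((1 : v.adicCompletion K) ⊗ₜ[K] x : localExt γ v) := by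
  obtain ⟨t, m, ht, hm⟩ := exists_trace_norm_eq hγ hx
  exact isIntegral_tmul_of_valuation_le_one hγ (valuation_le_one_of_eq v ht)
    (valuation_le_one_of_eq v hm)

lemma exists_mul_eq_of_valuation_le_one {v : HeightOneSpectrum (𝓞 K)} {x y : K}
    (hx : v.valuation K x ≤ 1) (hy : v.valuation K y ≤ 1) :
    ∃ s : 𝓞 K, s ∉ v.asIdeal ∧ ∃ a b : 𝓞 K, algebraMap (𝓞 K) K s * x = algebraMap _ _ a ∧
      algebraMap (𝓞 K) K s * y = algebraMap _ _ b := by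
  obtain ⟨a, s, hs⟩ := v.exists_primeCompl_mul_eq_of_integer x hx
  obtain ⟨b, s', hs'⟩ := v.exists_primeCompl_mul_eq_of_integer y hy
  refine ⟨s * s', (s * s').2, s' * a, s * b, ?_, ?_⟩
  · rw [map_mul, map_mul, ← hs]; ring
  · rw [map_mul, map_mul, ← hs']; ring

/-- s x has trace a and norm s b. Used with s prime to v, it turns integrality at v into global
integrality. -/
lemma isIntegral_smul_of_trace_norm (hγ : IsRegularElliptic γ) {x : quadExt γ} {s a b : 𝓞 K}
    (ha : algebraMap (𝓞 K) K s * Algebra.trace K _ x = algebraMap _ _ a)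
    (hb : algebraMap (𝓞 K) K s * Algebra.norm K x = algebraMap _ _ b) :
    IsIntegral (𝓞 K) (algebraMap (𝓞 K) K s • x) := by
  refine isIntegral_of_quadratic a (s * b) ?_
  rw [IsScalarTower.algebraMap_apply (𝓞 K) K (quadExt γ), IsScalarTower.algebraMap_apply (𝓞 K) K
    (quadExt γ), map_mul, ← ha, ← hb, Algebra.smul_def]
  simp only [map_mul]
  linear_combination (algebraMap K (quadExt γ) (algebraMap (𝓞 K) K s)) ^ 2 *
    mul_self_eq_trace_norm hγ x

lemma exists_isIntegral_notMem_range (hγ : IsRegularElliptic γ) :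
    ∃ θ : quadExt γ, IsIntegral (𝓞 K) θ ∧ θ ∉ Set.range (algebraMap K (quadExt γ)) := by
  obtain ⟨s, hs⟩ := IsLocalization.exist_integer_multiples_of_finite (nonZeroDivisors (𝓞 K))
    ![Algebra.trace K _ (AdjoinRoot.root γ.1.charpoly), Algebra.norm K
      (AdjoinRoot.root γ.1.charpoly)]
  obtain ⟨a, ha⟩ := hs 0
  obtain ⟨b, hb⟩ := hs 1
  rw [Algebra.smul_def] at ha hb
  refine ⟨_, isIntegral_smul_of_trace_norm hγ ha.symm hb.symm, ?_⟩
  have := add_smul_notMem_range hγ.root_notMem_range 0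
    (q := algebraMap (𝓞 K) K s) (by
      rw [map_ne_zero_iff _ (IsFractionRing.injective (𝓞 K) K)]
      exact nonZeroDivisors.coe_ne_zero s)
  rwa [map_zero, zero_add] at this

/-- An integral element whose discriminant has maximal absolute value at `v`. -/
lemma exists_localGenerator (hγ : IsRegularElliptic γ) (v : HeightOneSpectrum (𝓞 K)) :
    ∃ θ : quadExt γ, (IsIntegral (𝓞 K) θ ∧ θ ∉ Set.range (algebraMap K (quadExt γ))) ∧
      ∀ θ' : quadExt γ, IsIntegral (𝓞 K) θ' →
        v.valuation K (Algebra.discr K ![1, θ']) ≤ v.valuation K (Algebra.discr K ![1, θ]) := by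
  have hval : ∀ θ : quadExt γ, IsIntegral (𝓞 K) θ →
      v.valuation K (Algebra.discr K ![1, θ]) ≤ 1 := by
    intro θ hθ
    obtain ⟨t, m, ht, hm⟩ := exists_trace_norm_eq hγ hθ
    rw [discr_pair hγ]
    refine valuation_le_one_of_eq v (r := t ^ 2 - 4 * m) ?_
    rw [map_sub, map_pow, map_mul, ht, hm, map_ofNat]
  -- The truncation loses nothing, because the discriminant of an integral element is integral.
  -- Elements of `K` are excluded from the minimisation: their discriminant is 0, and `log 0 = 0`
  -- would make them minimal.
  let f : quadExt γ → ℕ := fun θ => (-WithZero.log (v.valuation K (Algebra.discr K ![1, θ]))).toNat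
  obtain ⟨θ, hθ, hmin⟩ := exists_minimalFor_of_wellFoundedLT
    (fun θ : quadExt γ => IsIntegral (𝓞 K) θ ∧ θ ∉ Set.range (algebraMap K (quadExt γ))) f
    (exists_isIntegral_notMem_range hγ)
  refine ⟨θ, hθ, fun θ' hθ' => ?_⟩
  by_cases hK : θ' ∈ Set.range (algebraMap K (quadExt γ))
  · obtain ⟨a, rfl⟩ := hK
    have h0 : Algebra.discr K ![1, algebraMap K (quadExt γ) a] = 0 := by
      have := discr_pair_eq θ 1 0 a 0
      simpa using this
    rw [h0, map_zero]
    exact zero_le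
  · have h1 := (Valuation.ne_zero_iff (v.valuation K)).mpr (discr_pair_ne_zero hγ hθ.2)
    have h2 := (Valuation.ne_zero_iff (v.valuation K)).mpr (discr_pair_ne_zero hγ hK)
    have h3 := hval θ hθ.1
    have h4 := hval θ' hθ'
    have h5 : f θ ≤ f θ' := by
      rcases le_total (f θ) (f θ') with h | h
      · exact h
      · exact hmin ⟨hθ', hK⟩ h
    simp only [f] at h5
    rw [← WithZero.exp_log h1, ← WithZero.exp_zero, WithZero.exp_le_exp] at h3
    rw [← WithZero.exp_log h2, ← WithZero.exp_zero, WithZero.exp_le_exp] at h4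
    rw [← WithZero.exp_log h1, ← WithZero.exp_log h2, WithZero.exp_le_exp]
    omega

end QuadExt

/-! ### Coordinates at `v` and the local index -/

section LocalCoord

variable {K : Type*} [Field K] [NumberField K] {γ : GL (Fin 2) K}

/-- A generator of `K_γ` that generates the maximal order at `v`. -/
noncomputable def localGen (hγ : IsRegularElliptic γ) (v : HeightOneSpectrum (𝓞 K)) : quadExt γ :=
  (exists_localGenerator hγ v).choose

variable (hγ : IsRegularElliptic γ) (v : HeightOneSpectrum (𝓞 K))

lemma isIntegral_localGen : IsIntegral (𝓞 K) (localGen hγ v) :=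
  (exists_localGenerator hγ v).choose_spec.1.1

lemma localGen_notMem_range : localGen hγ v ∉ Set.range (algebraMap K (quadExt γ)) :=
  (exists_localGenerator hγ v).choose_spec.1.2

lemma valuation_discr_le {θ : quadExt γ} (hθ : IsIntegral (𝓞 K) θ) :
    v.valuation K (Algebra.discr K ![1, θ]) ≤
      v.valuation K (Algebra.discr K ![1, localGen hγ v]) :=
  (exists_localGenerator hγ v).choose_spec.2 θ hθ

lemma tmul_add_smul (θ : quadExt γ) (p q : K) :
    ((1 : v.adicCompletion K) ⊗ₜ[K] (algebraMap K (quadExt γ) p + q • θ) : localExt γ v) =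
      algebraMap (v.adicCompletion K) (localExt γ v) (algebraMap K _ p) +
        algebraMap K (v.adicCompletion K) q • ((1 : v.adicCompletion K) ⊗ₜ[K] θ : localExt γ v) := by
  rw [TensorProduct.tmul_add, tmul_algebraMap, Algebra.smul_def q, Algebra.smul_def,
    ← tmul_algebraMap v q, Algebra.TensorProduct.tmul_mul_tmul, mul_one]

/-- Some multiple s(p + qθ) with s prime to v is integral over 𝓞 K, and its discriminant is s²q²
disc θ. Maximality of |disc θ| at v forces |q| ≤ 1. -/
lemma valuation_im_le_one {p q : K}
    (h : IsIntegral (v.adicCompletionIntegers K) ((1 : v.adicCompletion K) ⊗ₜ[K]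
      (algebraMap K (quadExt γ) p + q • localGen hγ v) : localExt γ v)) :
    v.valuation K q ≤ 1 := by
  rcases eq_or_ne q 0 with rfl | hq
  · simp
  have hx := add_smul_notMem_range (localGen_notMem_range hγ v) p hq
  obtain ⟨h1, h2⟩ := valuation_le_one_of_isIntegral_tmul hγ hx h
  obtain ⟨s, hs, a, b, ha, hb⟩ := exists_mul_eq_of_valuation_le_one h1 h2
  have h3 := valuation_discr_le hγ v (isIntegral_smul_of_trace_norm hγ ha hb)
  have h4 := discr_pair_eq (localGen hγ v) 1 0 (algebraMap (𝓞 K) K s * p)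
    (algebraMap (𝓞 K) K s * q)
  rw [zero_smul, add_zero, map_one, map_mul, mul_smul, ← Algebra.smul_def, ← smul_add] at h4
  rw [h4, map_mul] at h3
  have h5 := (Valuation.ne_zero_iff (v.valuation K)).mpr
    (discr_pair_ne_zero hγ (localGen_notMem_range hγ v))
  have hs1 : v.valuation K (algebraMap (𝓞 K) K s) = 1 := v.valuation_eq_one_iff_notMem.mpr hs
  have h6 : v.valuation K q ^ 2 ≤ 1 := by
    have := le_of_mul_le_mul_right (h3.trans_eq (one_mul _).symm) (zero_lt_iff.mpr h5)
    simpa [hs1] using this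
  by_contra hlt
  exact absurd h6 (not_le.mpr (one_lt_pow₀ (not_le.mp hlt) two_ne_zero))

/-- Density of `K` in its completion: modulo integral coordinates, y comes from an element of K_γ,
and `valuation_im_le_one` bounds its second coordinate. The first coordinate is then y minus an
integral element, and an integral element of K_v lies in 𝓞_v. -/
lemma integral_localBasis (y : localExt γ v) (hy : IsIntegral (v.adicCompletionIntegers K) y) :
    (∃ a, algebraMap (v.adicCompletionIntegers K) (v.adicCompletion K) a =
      (localBasis hγ (localGen_notMem_range hγ v) v).coord 0 y) ∧
    ∃ b, algebraMap (v.adicCompletionIntegers K) (v.adicCompletion K) b =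
      (localBasis hγ (localGen_notMem_range hγ v) v).coord 1 y := by
  have hrepr := localBasis_repr_add hγ (localGen_notMem_range hγ v) v y
  set a := (localBasis hγ (localGen_notMem_range hγ v) v).repr y 0 with ha
  set b := (localBasis hγ (localGen_notMem_range hγ v) v).repr y 1 with hb
  change (∃ a', _ = a) ∧ ∃ b', _ = b
  have hθ := isIntegral_tmul hγ v (isIntegral_localGen hγ v)
  set Θ : localExt γ v := (1 : v.adicCompletion K) ⊗ₜ[K] localGen hγ v with hΘ
  have hint : ∀ z : v.adicCompletionIntegers K, IsIntegral (v.adicCompletionIntegers K)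
      (algebraMap (v.adicCompletion K) (localExt γ v) (z : v.adicCompletion K)) := fun z =>
    isIntegral_algebraMap (A := localExt γ v) (x := z)
  obtain ⟨p, z, hz⟩ := exists_sub_algebraMap_eq_mul v a one_ne_zero
  obtain ⟨q, w, hw⟩ := exists_sub_algebraMap_eq_mul v b one_ne_zero
  rw [one_mul] at hz hw
  have hq : v.valuation K q ≤ 1 := by
    refine valuation_im_le_one hγ v (p := p) ?_
    have e : ((1 : v.adicCompletion K) ⊗ₜ[K] (algebraMap K (quadExt γ) p + q • localGen hγ v) :
        localExt γ v) = y - algebraMap (v.adicCompletion K) (localExt γ v) z -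
          algebraMap (v.adicCompletion K) (localExt γ v) w * Θ := by
      rw [tmul_add_smul, ← hz, ← hw, ← hrepr, Algebra.smul_def, Algebra.smul_def, map_sub, map_sub]
      ring
    rw [e]
    exact (hy.sub (hint z)).sub ((hint w).mul hθ)
  have hbmem : b ∈ v.adicCompletionIntegers K := by
    have e : b = w + algebraMap K (v.adicCompletion K) q := by rw [← hw]; ring
    rw [e]
    refine add_mem w.2 ?_
    rw [HeightOneSpectrum.mem_adicCompletionIntegers, valued_algebraMap]
    exact hq
  refine ⟨?_, ⟨b, hbmem⟩, rfl⟩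
  have hai : IsIntegral (v.adicCompletionIntegers K)
      (algebraMap (v.adicCompletion K) (localExt γ v) a) := by
    have e : algebraMap (v.adicCompletion K) (localExt γ v) a =
        y - algebraMap (v.adicCompletion K) (localExt γ v) b * Θ := by
      rw [← hrepr, Algebra.smul_def]; ring
    rw [e]
    exact hy.sub ((hint ⟨b, hbmem⟩).mul hθ)
  have : Nontrivial (localExt γ v) := 
    nontrivial_of_ne _ 0 ((localBasis hγ (localGen_notMem_range hγ v) v).ne_zero 0)
  have hinj : Function.Injective (algebraMap (v.adicCompletion K) (localExt γ v)) :=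
    (algebraMap (v.adicCompletion K) (localExt γ v)).injective
  exact IsIntegrallyClosed.isIntegral_iff.mp ((isIntegral_algebraMap_iff hinj).mp hai)

/-- The trace of the local generator, in `𝓞 K`. -/
noncomputable def genTrace : 𝓞 K := (exists_trace_norm_eq hγ (isIntegral_localGen hγ v)).choose

/-- The norm of the local generator, in `𝓞 K`. -/
noncomputable def genNorm : 𝓞 K :=
  (exists_trace_norm_eq hγ (isIntegral_localGen hγ v)).choose_spec.choose

lemma algebraMap_genTrace : algebraMap (𝓞 K) K (genTrace hγ v) =
    Algebra.trace K (quadExt γ) (localGen hγ v) :=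
  (exists_trace_norm_eq hγ (isIntegral_localGen hγ v)).choose_spec.choose_spec.1

lemma algebraMap_genNorm : algebraMap (𝓞 K) K (genNorm hγ v) =
    Algebra.norm K (localGen hγ v) :=
  (exists_trace_norm_eq hγ (isIntegral_localGen hγ v)).choose_spec.choose_spec.2

/-- The coordinates on `K_v ⊗ K_γ` that belong to the local generator. -/
noncomputable def localCoord :
    QuadCoord (v.adicCompletionIntegers K) (v.adicCompletion K) (localExt γ v) where
  θ := (1 : v.adicCompletion K) ⊗ₜ[K] localGen hγ v
  t := algebraMap (𝓞 K) _ (genTrace hγ v)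
  m := algebraMap (𝓞 K) _ (genNorm hγ v)
  re := (localBasis hγ (localGen_notMem_range hγ v) v).coord 0
  im := (localBasis hγ (localGen_notMem_range hγ v) v).coord 1
  eq_add := localBasis_repr_add hγ (localGen_notMem_range hγ v) v
  re_one := by
    rw [← localBasis_zero hγ (localGen_notMem_range hγ v) v]; simp
  im_one := by
    rw [← localBasis_zero hγ (localGen_notMem_range hγ v) v]; simp
  re_θ := by
    rw [← localBasis_one hγ (localGen_notMem_range hγ v) v]; simp
  im_θ := by
    rw [← localBasis_one hγ (localGen_notMem_range hγ v) v]; simp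
  θ_mul := by
    have h := tmul_mul_self hγ v (localGen hγ v)
    rw [← algebraMap_genTrace, ← algebraMap_genNorm] at h
    exact h
  integral := integral_localBasis hγ v

lemma re_localCoord_tmul (p q : K) : (localCoord hγ v).re ((1 : v.adicCompletion K) ⊗ₜ[K]
    (algebraMap K (quadExt γ) p + q • localGen hγ v)) = algebraMap K _ p := by
  rw [tmul_add_smul]
  exact (localCoord hγ v).re_elt _ _

lemma im_localCoord_tmul (p q : K) : (localCoord hγ v).im ((1 : v.adicCompletion K) ⊗ₜ[K]
    (algebraMap K (quadExt γ) p + q • localGen hγ v)) = algebraMap K _ q := by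
  rw [tmul_add_smul]
  exact (localCoord hγ v).im_elt _ _

lemma exists_algebraMap_mul_eq_iff {π : v.adicCompletionIntegers K} (hπ : Irreducible π) (i : ℕ)
    (x : v.adicCompletion K) :
    (∃ b : v.adicCompletionIntegers K, algebraMap _ (v.adicCompletion K) (π ^ i * b) = x) ↔
      Valued.v x ≤ WithZero.exp (-i : ℤ) := by
  have hπ0 : (π : v.adicCompletion K) ≠ 0 := fun h => hπ.ne_zero (Subtype.ext h)
  rw [← valuation_irreducible_pow v hπ]
  constructor
  · rintro ⟨b, rfl⟩
    rw [map_mul, map_mul, map_pow]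
    exact mul_le_of_le_one_right' b.2
  · intro h
    have hne : Valued.v ((π : v.adicCompletion K) ^ i) ≠ 0 :=
      (Valuation.ne_zero_iff _).mpr (pow_ne_zero _ hπ0)
    refine ⟨⟨x / (π : v.adicCompletion K) ^ i, ?_⟩, ?_⟩
    · rw [HeightOneSpectrum.mem_adicCompletionIntegers, map_div₀]
      exact div_le_one_of_le₀ h zero_le
    · rw [map_mul, map_pow]
      exact mul_div_cancel₀ _ (pow_ne_zero _ hπ0)

lemma tmul_mem_order_iff {π : v.adicCompletionIntegers K} (hπ : Irreducible π) (i : ℕ) (p q : K) :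
    ((1 : v.adicCompletion K) ⊗ₜ[K] (algebraMap K (quadExt γ) p + q • localGen hγ v) :
      localExt γ v) ∈ (localCoord hγ v).order π i ↔
      v.valuation K p ≤ 1 ∧ v.valuation K q ≤ WithZero.exp (-i : ℤ) := by
  rw [QuadCoord.mem_order, re_localCoord_tmul, im_localCoord_tmul, exists_algebraMap_mul_eq_iff v hπ,
    valued_algebraMap, ← valued_algebraMap v p]
  refine and_congr ⟨?_, fun h => ⟨⟨_, h⟩, rfl⟩⟩ Iff.rfl
  rintro ⟨a, ha⟩
  rw [← ha]
  exact a.2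

lemma valuation_coord_le_one {p q : K}
    (h : IsIntegral (𝓞 K) (algebraMap K (quadExt γ) p + q • localGen hγ v)) :
    v.valuation K p ≤ 1 ∧ v.valuation K q ≤ 1 := by
  obtain ⟨π, hπ⟩ := IsDiscreteValuationRing.exists_irreducible (v.adicCompletionIntegers K)
  have := (tmul_mem_order_iff hγ v hπ 0 p q).mp
    (((localCoord hγ v).mem_order_zero_iff π).mpr (isIntegral_tmul hγ v h))
  simpa using this

/-- The first coordinate of the root. -/
noncomputable def rootRe : K :=
  (exists_eq_add_smul hγ (localGen_notMem_range hγ v) (AdjoinRoot.root γ.1.charpoly)).choose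

/-- The second coordinate of the root. -/
noncomputable def rootIm : K :=
  (exists_eq_add_smul hγ (localGen_notMem_range hγ v)
    (AdjoinRoot.root γ.1.charpoly)).choose_spec.choose

lemma root_eq : AdjoinRoot.root γ.1.charpoly =
    algebraMap K (quadExt γ) (rootRe hγ v) + rootIm hγ v • localGen hγ v :=
  (exists_eq_add_smul hγ (localGen_notMem_range hγ v)
    (AdjoinRoot.root γ.1.charpoly)).choose_spec.choose_spec

lemma rootIm_ne_zero : rootIm hγ v ≠ 0 := by
  intro h
  have := root_eq hγ v
  rw [h, zero_smul, add_zero] at this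
  exact hγ.root_notMem_range ⟨_, this.symm⟩

lemma elemDiscr_eq : elemDiscr γ =
    rootIm hγ v ^ 2 * Algebra.discr K ![1, localGen hγ v] := by
  have h := discr_pair_eq (localGen hγ v) 1 0 (rootRe hγ v) (rootIm hγ v)
  rw [← root_eq, zero_smul, add_zero, map_one] at h
  rw [elemDiscr, h]
  ring

/-- The exponent of `v` in the index ideal. -/
noncomputable def localIndex : ℕ := (-WithZero.log (v.valuation K (rootIm hγ v))).toNat

lemma localRoot_mem_order_zero_iff {π : v.adicCompletionIntegers K} (hπ : Irreducible π) :
    localRoot γ v ∈ (localCoord hγ v).order π 0 ↔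
      v.valuation K (rootRe hγ v) ≤ 1 ∧ v.valuation K (rootIm hγ v) ≤ 1 := by
  rw [localRoot, root_eq hγ v, tmul_mem_order_iff hγ v hπ]
  simp

/-- The truncation in `localIndex` is harmless as soon as the coordinate is integral. -/
lemma valuation_rootIm (h : v.valuation K (rootIm hγ v) ≤ 1) :
    v.valuation K (rootIm hγ v) = WithZero.exp (-(localIndex hγ v : ℤ)) := by
  have h1 := (Valuation.ne_zero_iff (v.valuation K)).mpr (rootIm_ne_zero hγ v)
  rw [← WithZero.exp_log h1, ← WithZero.exp_zero, WithZero.exp_le_exp] at h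
  conv_lhs => rw [← WithZero.exp_log h1]
  rw [localIndex]
  congr 1
  omega

lemma localRoot_mem_order_iff {π : v.adicCompletionIntegers K} (hπ : Irreducible π)
    (h : localRoot γ v ∈ (localCoord hγ v).order π 0) (i : ℕ) :
    localRoot γ v ∈ (localCoord hγ v).order π i ↔ i ≤ localIndex hγ v := by
  rw [localRoot_mem_order_zero_iff hγ v hπ] at h
  rw [localRoot, root_eq hγ v, tmul_mem_order_iff hγ v hπ, and_iff_right h.1,
    valuation_rootIm hγ v h.2, WithZero.exp_le_exp]
  omega

/-- The root is p + qθ with p integral and q of valuation exactly n = `localIndex`, so any multiple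
of πⁿθ is an integral multiple of root - p. -/
lemma localOrder_eq {π : v.adicCompletionIntegers K} (hπ : Irreducible π)
    (h : localRoot γ v ∈ (localCoord hγ v).order π 0) :
    localOrder γ v = (localCoord hγ v).order π (localIndex hγ v) := by
  apply le_antisymm
  · rw [localOrder, Algebra.adjoin_le_iff, Set.singleton_subset_iff]
    exact (localRoot_mem_order_iff hγ v hπ h _).mpr le_rfl
  · intro x hx
    have hmem : localRoot γ v ∈ localOrder γ v := Algebra.subset_adjoin rfl
    obtain ⟨a, b, rfl⟩ := (localCoord hγ v).exists_of_mem_order hx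
    rw [localRoot_mem_order_zero_iff hγ v hπ] at h
    have h1 := rootIm_ne_zero hγ v
    have h1' : algebraMap K (v.adicCompletion K) (rootIm hγ v) ≠ 0 := by rwa [map_ne_zero]
    have hp : algebraMap K (v.adicCompletion K) (rootRe hγ v) ∈ v.adicCompletionIntegers K := by
      rw [HeightOneSpectrum.mem_adicCompletionIntegers, valued_algebraMap]
      exact h.1
    set d := algebraMap (v.adicCompletionIntegers K) (v.adicCompletion K)
      (π ^ localIndex hγ v * b) / algebraMap K (v.adicCompletion K) (rootIm hγ v) with hd
    have hdm : d ∈ v.adicCompletionIntegers K := by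
      rw [HeightOneSpectrum.mem_adicCompletionIntegers, hd, map_div₀, valued_algebraMap,
        valuation_rootIm hγ v h.2]
      refine div_le_one_of_le₀ ?_ zero_le
      exact (exists_algebraMap_mul_eq_iff v hπ _ _).mp ⟨b, rfl⟩
    have e : (localCoord hγ v).elt (algebraMap _ _ a) (algebraMap _ _ (π ^ localIndex hγ v * b)) =
        algebraMap (v.adicCompletionIntegers K) (localExt γ v) a +
          algebraMap (v.adicCompletionIntegers K) (localExt γ v) ⟨d, hdm⟩ *
            (localRoot γ v - algebraMap (v.adicCompletionIntegers K) (localExt γ v) ⟨_, hp⟩) := by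
      apply (localCoord hγ v).ext_re_im
      · rw [QuadCoord.re_elt, map_add, QuadCoord.re_algebraMap_R, QuadCoord.re_algebraMap_mul,
          map_sub, QuadCoord.re_algebraMap_R, localRoot, root_eq hγ v, re_localCoord_tmul]
        change _ = _ + _ * (_ - algebraMap K (v.adicCompletion K) (rootRe hγ v))
        ring
      · rw [QuadCoord.im_elt, map_add, QuadCoord.im_algebraMap_R, QuadCoord.im_algebraMap_mul,
          map_sub, QuadCoord.im_algebraMap_R, localRoot, root_eq hγ v, im_localCoord_tmul, zero_add,
          sub_zero]
        exact (div_mul_cancel₀ _ h1').symm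
    rw [e]
    exact add_mem (Subalgebra.algebraMap_mem _ _) (mul_mem (Subalgebra.algebraMap_mem _ _)
      (sub_mem hmem (Subalgebra.algebraMap_mem _ _)))

end LocalCoord

/-! ### Decomposition of `v` and roots in the residue field -/

section QuadChar

variable {K : Type*} [Field K] [NumberField K] {γ : GL (Fin 2) K}
variable (hγ : IsRegularElliptic γ) (v : HeightOneSpectrum (𝓞 K))

/-- The local generator as an element of the ring of integers. -/
noncomputable def intGen : quadInt γ := ⟨localGen hγ v, isIntegral_localGen hγ v⟩

/-- The embedding of the ring of integers of `K_γ` in the maximal order at `v`. -/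
noncomputable def toLocalInt :
    quadInt γ →+* integralClosure (v.adicCompletionIntegers K) (localExt γ v) :=
  ((Algebra.TensorProduct.includeRight : quadExt γ →ₐ[K] localExt γ v).toRingHom.comp
    (quadInt γ).val.toRingHom).codRestrict _ fun x => isIntegral_tmul hγ v x.2

lemma coe_toLocalInt (x : quadInt γ) :
    (toLocalInt hγ v x : localExt γ v) = (1 : v.adicCompletion K) ⊗ₜ[K] (x : quadExt γ) := rfl

lemma toLocalInt_algebraMap (r : 𝓞 K) : toLocalInt hγ v (algebraMap (𝓞 K) (quadInt γ) r) =
    algebraMap (v.adicCompletionIntegers K) _ (algebraMap (𝓞 K) _ r) := by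
  apply Subtype.ext
  rw [coe_toLocalInt]
  exact tmul_algebraMap v (algebraMap (𝓞 K) K r)

lemma toLocalInt_intGen : toLocalInt hγ v (intGen hγ v) =
    ⟨(localCoord hγ v).θ, (localCoord hγ v).θ_mem_integralClosure⟩ := rfl

/-- Away from `v`, integers are combinations of `1` and the local generator. -/
lemma exists_mul_eq_add_mul_intGen (x : quadInt γ) :
    ∃ s : 𝓞 K, s ∉ v.asIdeal ∧ ∃ a b : 𝓞 K, algebraMap (𝓞 K) (quadInt γ) s * x =
      algebraMap (𝓞 K) (quadInt γ) a + algebraMap (𝓞 K) (quadInt γ) b * intGen hγ v := by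
  obtain ⟨p, q, hx⟩ := exists_eq_add_smul hγ (localGen_notMem_range hγ v) (x : quadExt γ)
  have hint : IsIntegral (𝓞 K) (x : quadExt γ) := x.2
  rw [hx] at hint
  obtain ⟨hp, hq⟩ := valuation_coord_le_one hγ v hint
  obtain ⟨s, hs, a, b, ha, hb⟩ := exists_mul_eq_of_valuation_le_one hp hq
  refine ⟨s, hs, a, b, Subtype.ext ?_⟩
  change algebraMap K (quadExt γ) (algebraMap (𝓞 K) K s) * (x : quadExt γ) =
    algebraMap K (quadExt γ) (algebraMap (𝓞 K) K a) +
      algebraMap K (quadExt γ) (algebraMap (𝓞 K) K b) * localGen hγ v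
  rw [hx, ← ha, ← hb, Algebra.smul_def]
  simp only [map_mul]
  ring

variable {π : v.adicCompletionIntegers K} (hπ : Irreducible π)
  {ρ : IsLocalRing.ResidueField (v.adicCompletionIntegers K)}

/-- Reduction of the ring of integers at a root in the residue field. -/
noncomputable def intEval (hρ : ρ ∈ (localCoord hγ v).residueRoots) :
    quadInt γ →+* IsLocalRing.ResidueField (v.adicCompletionIntegers K) :=
  ((localCoord hγ v).evalHom hπ hρ).comp (toLocalInt hγ v)

lemma intEval_algebraMap (hρ : ρ ∈ (localCoord hγ v).residueRoots) (r : 𝓞 K) :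
    intEval hγ v hπ hρ (algebraMap (𝓞 K) (quadInt γ) r) =
      IsLocalRing.residue _ (algebraMap (𝓞 K) (v.adicCompletionIntegers K) r) := by
  rw [intEval, RingHom.comp_apply, toLocalInt_algebraMap, QuadCoord.evalHom_algebraMap]

lemma intEval_intGen (hρ : ρ ∈ (localCoord hγ v).residueRoots) :
    intEval hγ v hπ hρ (intGen hγ v) = ρ := by
  rw [intEval, RingHom.comp_apply, toLocalInt_intGen, QuadCoord.evalHom_θ]

lemma intEval_surjective (hρ : ρ ∈ (localCoord hγ v).residueRoots) :
    Function.Surjective (intEval hγ v hπ hρ) := by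
  intro y
  obtain ⟨y, rfl⟩ := IsLocalRing.residue_surjective y
  obtain ⟨r, hr⟩ := exists_residue_algebraMap v y
  exact ⟨algebraMap _ _ r, by rw [intEval_algebraMap, hr]⟩

lemma ker_intEval_mem_primesOver (hρ : ρ ∈ (localCoord hγ v).residueRoots) :
    RingHom.ker (intEval hγ v hπ hρ) ∈ v.asIdeal.primesOver (quadInt γ) := by
  refine ⟨RingHom.ker_isPrime _, ⟨?_⟩⟩
  ext r
  rw [Ideal.under_def, Ideal.mem_comap, RingHom.mem_ker, intEval_algebraMap,
    residue_algebraMap_eq_zero_iff]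

/-- The kernel is maximal, so one inclusion is enough. For x in it, a multiple s x with s prime to v
is (a' + b'a) + b'(θ - a). Both terms lie in P, and s does not. -/
lemma ker_intEval_eq (hρ : ρ ∈ (localCoord hγ v).residueRoots) {P : Ideal (quadInt γ)}
    (hP : P ∈ v.asIdeal.primesOver (quadInt γ)) {a : 𝓞 K}
    (ha : IsLocalRing.residue _ (algebraMap (𝓞 K) (v.adicCompletionIntegers K) a) = ρ)
    (haP : intGen hγ v - algebraMap (𝓞 K) (quadInt γ) a ∈ P) :
    RingHom.ker (intEval hγ v hπ hρ) = P := by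
  obtain ⟨hprime, hover⟩ := hP
  have hmem : ∀ r : 𝓞 K, r ∈ v.asIdeal ↔ algebraMap (𝓞 K) (quadInt γ) r ∈ P := fun r =>
    Ideal.mem_of_liesOver P v.asIdeal r
  refine (RingHom.ker_isMaximal_of_surjective _
    (intEval_surjective hγ v hπ hρ)).eq_of_le hprime.ne_top fun x hx => ?_
  obtain ⟨s, hs, a', b', h⟩ := exists_mul_eq_add_mul_intGen hγ v x
  have h1 := congrArg (intEval hγ v hπ hρ) h
  rw [map_mul, RingHom.mem_ker.mp hx, mul_zero, map_add, map_mul, intEval_algebraMap,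
    intEval_algebraMap, intEval_intGen, ← ha, ← map_mul, ← map_add, ← map_mul, ← map_add] at h1
  have h2 : algebraMap (𝓞 K) (quadInt γ) (a' + b' * a) ∈ P :=
    (hmem _).mp ((residue_algebraMap_eq_zero_iff v).mp h1.symm)
  have h3 : algebraMap (𝓞 K) (quadInt γ) s * x ∈ P := by
    have e : algebraMap (𝓞 K) (quadInt γ) s * x = algebraMap (𝓞 K) (quadInt γ) (a' + b' * a) +
        algebraMap (𝓞 K) (quadInt γ) b' *
          (intGen hγ v - algebraMap (𝓞 K) (quadInt γ) a) := by
      rw [h, map_add, map_mul]; ring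
    rw [e]
    exact P.add_mem h2 (P.mul_mem_left _ haP)
  exact (hprime.mem_or_mem h3).resolve_left fun h => hs ((hmem s).mpr h)

lemma intGen_mul_intGen : intGen hγ v * intGen hγ v =
    algebraMap (𝓞 K) (quadInt γ) (genTrace hγ v) * intGen hγ v -
      algebraMap (𝓞 K) (quadInt γ) (genNorm hγ v) := by
  apply Subtype.ext
  have h := mul_self_eq_trace_norm hγ (localGen hγ v)
  rw [← algebraMap_genTrace, ← algebraMap_genNorm] at h
  exact h

lemma map_le_of_mem_primesOver {v : HeightOneSpectrum (𝓞 K)} {P : Ideal (quadInt γ)}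
    (hP : P ∈ v.asIdeal.primesOver (quadInt γ)) :
    v.asIdeal.map (algebraMap (𝓞 K) (quadInt γ)) ≤ P := by
  have := hP.2
  rw [Ideal.map_le_iff_le_comap]
  exact fun r hr => (Ideal.mem_of_liesOver P v.asIdeal r).mp hr

/-- The factorisation of the minimal polynomial of the generator modulo `v`. -/
lemma intGen_sub_mul_mem_map {r : 𝓞 K}
    (hr : IsLocalRing.residue _ (algebraMap (𝓞 K) (v.adicCompletionIntegers K) r) ∈
      (localCoord hγ v).residueRoots) :
    (intGen hγ v - algebraMap (𝓞 K) (quadInt γ) r) *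
      (intGen hγ v - algebraMap (𝓞 K) (quadInt γ) (genTrace hγ v - r)) ∈
        v.asIdeal.map (algebraMap (𝓞 K) (quadInt γ)) := by
  have e : (intGen hγ v - algebraMap (𝓞 K) (quadInt γ) r) *
      (intGen hγ v - algebraMap (𝓞 K) (quadInt γ) (genTrace hγ v - r)) =
      algebraMap (𝓞 K) (quadInt γ) (-(r ^ 2 - genTrace hγ v * r + genNorm hγ v)) := by
    simp only [map_sub, map_add, map_mul, map_pow, map_neg]
    linear_combination intGen_mul_intGen hγ v
  rw [e]
  refine Ideal.mem_map_of_mem _ ?_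
  rw [neg_mem_iff, ← residue_algebraMap_eq_zero_iff]
  simp only [map_sub, map_add, map_mul, map_pow]
  exact hr

-- A prime over v contains (θ - r)(θ - (t - r)) for a lifted root r, hence one of the factors, and
-- this determines the prime as the kernel of an evaluation.
include hπ in
lemma ncard_primesOver (hne : (localCoord hγ v).residueRoots.Nonempty) :
    (v.asIdeal.primesOver (quadInt γ)).ncard = (localCoord hγ v).residueRoots.ncard := by
  have hbij : Function.Bijective (fun ρ : (localCoord hγ v).residueRoots =>
      (⟨_, ker_intEval_mem_primesOver hγ v hπ ρ.2⟩ : v.asIdeal.primesOver (quadInt γ))) := by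
    constructor
    · rintro ⟨ρ, hρ⟩ ⟨σ, hσ⟩ h
      have h1 : RingHom.ker (intEval hγ v hπ hρ) = RingHom.ker (intEval hγ v hπ hσ) :=
        congrArg Subtype.val h
      obtain ⟨y, rfl⟩ := IsLocalRing.residue_surjective ρ
      obtain ⟨r, hr⟩ := exists_residue_algebraMap v y
      have h2 : intGen hγ v - algebraMap (𝓞 K) (quadInt γ) r ∈ RingHom.ker (intEval hγ v hπ hσ) := by
        rw [← h1, RingHom.mem_ker, map_sub, intEval_intGen, intEval_algebraMap, hr, sub_self]
      rw [RingHom.mem_ker, map_sub, intEval_intGen, intEval_algebraMap, sub_eq_zero, hr] at h2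
      exact Subtype.ext h2.symm
    · rintro ⟨P, hP⟩
      obtain ⟨ρ, hρ⟩ := hne
      obtain ⟨y, rfl⟩ := IsLocalRing.residue_surjective ρ
      obtain ⟨r, hr⟩ := exists_residue_algebraMap v y
      have hρ' := (localCoord hγ v).sub_mem_residueRoots hρ
      have hr' : IsLocalRing.residue _ (algebraMap (𝓞 K) (v.adicCompletionIntegers K)
          (genTrace hγ v - r)) = IsLocalRing.residue _ (localCoord hγ v).t -
            IsLocalRing.residue _ y := by
        rw [map_sub, map_sub, hr]
        rfl
      have hmul : (intGen hγ v - algebraMap (𝓞 K) (quadInt γ) r) *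
          (intGen hγ v - algebraMap (𝓞 K) (quadInt γ) (genTrace hγ v - r)) ∈ P :=
        map_le_of_mem_primesOver hP (intGen_sub_mul_mem_map hγ v (by rw [hr]; exact hρ))
      rcases hP.1.mem_or_mem hmul with h | h
      · exact ⟨⟨_, hρ⟩, Subtype.ext (ker_intEval_eq hγ v hπ hρ hP hr h)⟩
      · exact ⟨⟨_, hρ'⟩, Subtype.ext (ker_intEval_eq hγ v hπ hρ' hP hr' h)⟩
  exact (Nat.card_eq_of_bijective _ hbij).symm

include hπ in
/-- An integer that is divisible by `v` locally is divisible by `v`. -/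
lemma mem_map_of_toLocalInt_mem {x : quadInt γ} (hx : toLocalInt hγ v x ∈
    Ideal.span {algebraMap (v.adicCompletionIntegers K)
      (integralClosure (v.adicCompletionIntegers K) (localExt γ v)) π}) :
    x ∈ v.asIdeal.map (algebraMap (𝓞 K) (quadInt γ)) := by
  obtain ⟨s, hs, a, b, h⟩ := exists_mul_eq_add_mul_intGen hγ v x
  rw [Ideal.mem_span_singleton] at hx
  obtain ⟨y, hy⟩ := hx
  have h1 := congrArg (fun z => (toLocalInt hγ v z : localExt γ v)) h
  simp only [map_mul, map_add, toLocalInt_algebraMap, toLocalInt_intGen, hy] at h1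
  have hy' := (localCoord hγ v).mem_order_of_integralClosure π y
  have h2 : algebraMap (v.adicCompletionIntegers K) (localExt γ v)
      (algebraMap (𝓞 K) (v.adicCompletionIntegers K) s) *
      (algebraMap (v.adicCompletionIntegers K) (localExt γ v) π * y) =
      algebraMap (v.adicCompletionIntegers K) (localExt γ v)
        (algebraMap (𝓞 K) (v.adicCompletionIntegers K) a) +
      algebraMap (v.adicCompletionIntegers K) (localExt γ v)
        (algebraMap (𝓞 K) (v.adicCompletionIntegers K) b) * (localCoord hγ v).θ := h1
  have hre := congrArg (localCoord hγ v).re h2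
  have him := congrArg (localCoord hγ v).im h2
  rw [map_add, QuadCoord.re_algebraMap_mul, QuadCoord.re_algebraMap_mul,
    QuadCoord.re_algebraMap_mul, QuadCoord.re_algebraMap_R, (localCoord hγ v).re_θ,
    ← QuadCoord.algebraMap_intRe _ hy', mul_zero, add_zero, ← map_mul, ← map_mul] at hre
  rw [map_add, QuadCoord.im_algebraMap_mul, QuadCoord.im_algebraMap_mul,
    QuadCoord.im_algebraMap_mul, QuadCoord.im_algebraMap_R, (localCoord hγ v).im_θ,
    ← QuadCoord.algebraMap_intIm _ hy', mul_one, zero_add, ← map_mul, ← map_mul] at him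
  have ha : a ∈ v.asIdeal := by
    rw [← residue_algebraMap_eq_zero_iff, ← FaithfulSMul.algebraMap_injective _ _ hre,
      residue_eq_zero_iff_dvd hπ]
    exact ⟨_, mul_left_comm _ _ _⟩
  have hb : b ∈ v.asIdeal := by
    rw [← residue_algebraMap_eq_zero_iff, ← FaithfulSMul.algebraMap_injective _ _ him,
      residue_eq_zero_iff_dvd hπ]
    exact ⟨_, mul_left_comm _ _ _⟩
  have hsx : algebraMap (𝓞 K) (quadInt γ) s * x ∈
      v.asIdeal.map (algebraMap (𝓞 K) (quadInt γ)) := by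
    rw [h]
    exact Ideal.add_mem _ (Ideal.mem_map_of_mem _ ha)
      (Ideal.mul_mem_right _ _ (Ideal.mem_map_of_mem _ hb))
  -- The denominator s is invertible modulo v, so it can be removed from s x.
  obtain ⟨s', hs'⟩ : ∃ s', 1 - s' * s ∈ v.asIdeal := by
    have hmax : v.asIdeal.IsMaximal := v.isMaximal
    obtain ⟨s', i, hi, hs'⟩ := hmax.exists_inv hs
    exact ⟨s', by rw [← hs', add_sub_cancel_left]; exact hi⟩
  have e : x = algebraMap (𝓞 K) (quadInt γ) s' * (algebraMap (𝓞 K) (quadInt γ) s * x) +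
      algebraMap (𝓞 K) (quadInt γ) (1 - s' * s) * x := by
    simp only [map_sub, map_mul, map_one]; ring
  rw [e]
  exact Ideal.add_mem _ (Ideal.mul_mem_left _ _ hsx)
    (Ideal.mul_mem_right _ _ (Ideal.mem_map_of_mem _ hs'))

include hπ in
lemma map_le_comap_toLocalInt : v.asIdeal.map (algebraMap (𝓞 K) (quadInt γ)) ≤
    (Ideal.span {algebraMap (v.adicCompletionIntegers K)
      (integralClosure (v.adicCompletionIntegers K) (localExt γ v)) π}).comap
      (toLocalInt hγ v) := by
  rw [Ideal.map_le_iff_le_comap]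
  intro r hr
  rw [Ideal.mem_comap, Ideal.mem_comap, toLocalInt_algebraMap, Ideal.mem_span_singleton]
  exact map_dvd _ ((residue_eq_zero_iff_dvd hπ).mp ((residue_algebraMap_eq_zero_iff v).mpr hr))

/-- The quadratic character counts the roots in the residue field. -/
theorem quadChar_eq : quadChar γ v = ((localCoord hγ v).residueRoots.ncard : ℤ) - 1 := by
  obtain ⟨π, hπ⟩ := IsDiscreteValuationRing.exists_irreducible (v.adicCompletionIntegers K)
  rcases (localCoord hγ v).residueRoots.eq_empty_or_nonempty with h0 | hne
  · have hmax := (localCoord hγ v).isMaximal_span_of_residueRoots_empty hπ h0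
    have heq : v.asIdeal.map (algebraMap (𝓞 K) (quadInt γ)) =
        (Ideal.span {algebraMap (v.adicCompletionIntegers K)
          (integralClosure (v.adicCompletionIntegers K) (localExt γ v)) π}).comap
          (toLocalInt hγ v) :=
      le_antisymm (map_le_comap_toLocalInt hγ v hπ)
        fun x hx => mem_map_of_toLocalInt_mem hγ v hπ hx
    have hprime : (v.asIdeal.map (algebraMap (𝓞 K) (quadInt γ))).IsPrime := by
      rw [heq]; exact Ideal.comap_isPrime _ _
    have hcomap : ((v.asIdeal.map (algebraMap (𝓞 K) (quadInt γ))).comap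
        (algebraMap (𝓞 K) (quadInt γ))).IsMaximal := by
      have h1 : v.asIdeal = (v.asIdeal.map (algebraMap (𝓞 K) (quadInt γ))).comap
          (algebraMap (𝓞 K) (quadInt γ)) :=
        v.isMaximal.eq_of_le (Ideal.comap_isPrime _ _).ne_top Ideal.le_comap_map
      rw [← h1]
      exact v.isMaximal
    have hM : (v.asIdeal.map (algebraMap (𝓞 K) (quadInt γ))).IsMaximal :=
      Ideal.isMaximal_of_isIntegral_of_isMaximal_comap _ hcomap
    have hone : (v.asIdeal.primesOver (quadInt γ)).ncard ≤ 1 := by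
      rw [← Set.ncard_singleton (v.asIdeal.map (algebraMap (𝓞 K) (quadInt γ)))]
      refine Set.ncard_le_ncard (fun P hP => ?_) (Set.finite_singleton _)
      exact (hM.eq_of_le hP.1.ne_top (map_le_of_mem_primesOver hP)).symm
    rw [quadChar, if_neg (by omega), if_pos hprime, h0, Set.ncard_empty]
    norm_num
  -- If v generated a prime, it would contain one of the two linear factors θ - a; but such an
  -- element has second coordinate 1 and is not divisible by π.
  · have hnp : ¬ (v.asIdeal.map (algebraMap (𝓞 K) (quadInt γ))).IsPrime := by
      intro hp
      obtain ⟨ρ, hρ⟩ := hne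
      obtain ⟨y, rfl⟩ := IsLocalRing.residue_surjective ρ
      obtain ⟨r, hr⟩ := exists_residue_algebraMap v y
      have key : ∀ a : 𝓞 K, intGen hγ v - algebraMap (𝓞 K) (quadInt γ) a ∉
          v.asIdeal.map (algebraMap (𝓞 K) (quadInt γ)) := by
        intro a ha
        have h1 := map_le_comap_toLocalInt hγ v hπ ha
        rw [Ideal.mem_comap, Ideal.mem_span_singleton, map_sub, toLocalInt_algebraMap,
          toLocalInt_intGen] at h1
        obtain ⟨z, hz⟩ := h1
        have h2 : (localCoord hγ v).θ - algebraMap (v.adicCompletionIntegers K) (localExt γ v)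
            (algebraMap (𝓞 K) _ a) =
            algebraMap (v.adicCompletionIntegers K) (localExt γ v) π * z :=
          congrArg Subtype.val hz
        have him := congrArg (localCoord hγ v).im h2
        rw [map_sub, (localCoord hγ v).im_θ, QuadCoord.im_algebraMap_R, sub_zero,
          QuadCoord.im_algebraMap_mul, ← QuadCoord.algebraMap_intIm _
          ((localCoord hγ v).mem_order_of_integralClosure π z), ← map_mul, ← map_one
          (algebraMap (v.adicCompletionIntegers K) (v.adicCompletion K))] at him
        have h3 := FaithfulSMul.algebraMap_injective _ _ him
        rw [pow_zero, one_mul] at h3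
        exact hπ.not_isUnit (IsUnit.of_mul_eq_one _ h3.symm)
      rcases hp.mem_or_mem (intGen_sub_mul_mem_map hγ v (r := r) (by rw [hr]; exact hρ)) with h | h
      · exact key _ h
      · exact key _ h
    rw [quadChar, ncard_primesOver hγ v hπ hne, if_neg hnp]
    have h2 := (localCoord hγ v).residueRoots_ncard_le_two
    have h1 := (Set.ncard_pos (Set.toFinite _)).mpr hne
    split_ifs with h
    · omega
    · omega

end QuadChar

/-! ### Ideals through multiplicities; sums over divisors as products -/

section DivisorSum

variable {A : Type*} [CommRing A] [IsDedekindDomain A]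

lemma multiplicity_ideal_mul (v : HeightOneSpectrum A) {I J : Ideal A} (hI : I ≠ 0) (hJ : J ≠ 0) :
    multiplicity v.asIdeal (I * J) = multiplicity v.asIdeal I + multiplicity v.asIdeal J :=
  multiplicity_mul v.prime (.of_prime_left v.prime (mul_ne_zero hI hJ))

lemma pow_dvd_ideal_iff (v : HeightOneSpectrum A) {I : Ideal A} (hI : I ≠ 0) (n : ℕ) :
    v.asIdeal ^ n ∣ I ↔ n ≤ multiplicity v.asIdeal I :=
  (FiniteMultiplicity.of_prime_left v.prime hI).pow_dvd_iff_le_multiplicity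

lemma dvd_ideal_iff (v : HeightOneSpectrum A) {I : Ideal A} (hI : I ≠ 0) :
    v.asIdeal ∣ I ↔ multiplicity v.asIdeal I ≠ 0 := by
  rw [← pow_one v.asIdeal, pow_dvd_ideal_iff v hI, pow_one]
  omega

lemma ideal_dvd_of_multiplicity_le {I J : Ideal A} (hI : I ≠ 0)
    (h : ∀ v : HeightOneSpectrum A, multiplicity v.asIdeal I ≤ multiplicity v.asIdeal J) : I ∣ J := by
  rcases eq_or_ne J 0 with rfl | hJ
  · exact dvd_zero I
  refine (UniqueFactorizationMonoid.dvd_iff_emultiplicity_le hI).mpr fun p hp => ?_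
  rw [(FiniteMultiplicity.of_prime_left hp hI).emultiplicity_eq_multiplicity,
    (FiniteMultiplicity.of_prime_left hp hJ).emultiplicity_eq_multiplicity]
  exact_mod_cast h ⟨p, Ideal.isPrime_of_prime hp, hp.ne_zero⟩

lemma ideal_eq_of_multiplicity_eq {I J : Ideal A} (hI : I ≠ 0) (hJ : J ≠ 0)
    (h : ∀ v : HeightOneSpectrum A, multiplicity v.asIdeal I = multiplicity v.asIdeal J) : I = J :=
  dvd_antisymm (ideal_dvd_of_multiplicity_le hI fun v => (h v).le)
    (ideal_dvd_of_multiplicity_le hJ fun v => (h v).ge)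

lemma multiplicity_le_of_ideal_dvd (v : HeightOneSpectrum A) {I J : Ideal A} (hI : I ≠ 0)
    (hJ : J ≠ 0) (h : I ∣ J) : multiplicity v.asIdeal I ≤ multiplicity v.asIdeal J :=
  (pow_dvd_ideal_iff v hJ _).mp (((pow_dvd_ideal_iff v hI _).mpr le_rfl).trans h)

lemma prod_pow_ne_zero (T : Finset (HeightOneSpectrum A)) (e : HeightOneSpectrum A → ℕ) :
    ∏ w ∈ T, w.asIdeal ^ e w ≠ 0 :=
  Finset.prod_ne_zero_iff.mpr fun w _ => pow_ne_zero _ w.ne_bot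

open Classical in
lemma multiplicity_prod_pow (v : HeightOneSpectrum A) (T : Finset (HeightOneSpectrum A))
    (e : HeightOneSpectrum A → ℕ) :
    multiplicity v.asIdeal (∏ w ∈ T, w.asIdeal ^ e w) = if v ∈ T then e v else 0 := by
  induction T using Finset.induction_on with
  | empty =>
    rw [Finset.prod_empty, if_neg (Finset.notMem_empty v)]
    exact multiplicity_eq_zero.mpr fun h => v.prime.not_isUnit (isUnit_of_dvd_one h)
  | insert w T hw ih =>
    rw [Finset.prod_insert hw, multiplicity_ideal_mul v (pow_ne_zero _ w.ne_bot)
      (prod_pow_ne_zero T e), ih]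
    rcases eq_or_ne v w with rfl | hvw
    · rw [multiplicity_pow_self v.ne_bot v.prime.not_isUnit, if_neg hw,
        if_pos (Finset.mem_insert_self _ _), add_zero]
    · have h0 : multiplicity v.asIdeal (w.asIdeal ^ e w) = 0 := by
        refine multiplicity_eq_zero.mpr fun h => hvw ?_
        exact HeightOneSpectrum.ext (associated_iff_eq.mp
          (v.prime.associated_of_dvd w.prime (v.prime.dvd_of_dvd_pow h)))
      simp only [h0, zero_add, Finset.mem_insert, hvw, false_or]

lemma ideal_eq_prod_pow {I : Ideal A} (hI : I ≠ 0) {T : Finset (HeightOneSpectrum A)}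
    (hT : ∀ v ∉ T, multiplicity v.asIdeal I = 0) :
    I = ∏ v ∈ T, v.asIdeal ^ multiplicity v.asIdeal I := by
  classical
  refine ideal_eq_of_multiplicity_eq hI (prod_pow_ne_zero _ _) fun v => ?_
  rw [multiplicity_prod_pow v T fun w => multiplicity w.asIdeal I]
  split_ifs with h
  · rfl
  · exact hT v h

/-- A sum over the divisors of an ideal of a function that is multiplicative in the exponents. -/
theorem finsum_divisors_eq_prod {M : Type*} [CommSemiring M] {S : Ideal A} (hS : S ≠ 0)
    {T : Finset (HeightOneSpectrum A)} (hT : ∀ v ∉ T, multiplicity v.asIdeal S = 0)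
    (f : HeightOneSpectrum A → ℕ → M) (F : Ideal A → M)
    (hF : ∀ d, d ∣ S → F d = ∏ v ∈ T, f v (multiplicity v.asIdeal d)) :
    ∑ᶠ (d : Ideal A) (_ : d ∣ S), F d =
      ∏ v ∈ T, ∑ j ∈ Finset.range (multiplicity v.asIdeal S + 1), f v j := by
  classical
  have hne : ∀ d, d ∣ S → d ≠ 0 := fun d hd h0 => hS (zero_dvd_iff.mp (h0 ▸ hd))
  have hdT : ∀ d, d ∣ S → ∀ v ∉ T, multiplicity v.asIdeal d = 0 := fun d hd v hv =>
    Nat.le_zero.mp ((multiplicity_le_of_ideal_dvd v (hne d hd) hS hd).trans_eq (hT v hv))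
  -- The expanded product is a sum over a box of exponent vectors. Divisors of S correspond to the
  -- points of that box, as primes outside `T` do not divide S.
  rw [← Finset.prod_coe_sort, Finset.prod_univ_sum, ← finsum_mem_coe_finset]
  refine finsum_mem_eq_of_bijOn (s := {d | d ∣ S})
    (fun d (v : T) => multiplicity v.1.asIdeal d) ⟨?_, ?_, ?_⟩ ?_
  · intro d hd
    rw [Finset.mem_coe, Fintype.mem_piFinset]
    intro v
    rw [Finset.mem_range, Nat.lt_succ_iff]
    exact multiplicity_le_of_ideal_dvd v.1 (hne d hd) hS hd
  · intro d hd d' hd' h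
    refine ideal_eq_of_multiplicity_eq (hne d hd) (hne d' hd') fun v => ?_
    by_cases hv : v ∈ T
    · exact congrFun h ⟨v, hv⟩
    · rw [hdT d hd v hv, hdT d' hd' v hv]
  · intro x hx
    rw [Finset.mem_coe, Fintype.mem_piFinset] at hx
    set e : HeightOneSpectrum A → ℕ := fun v => if h : v ∈ T then x ⟨v, h⟩ else 0 with he
    refine ⟨∏ w ∈ T, w.asIdeal ^ e w, ?_, ?_⟩
    · refine ideal_dvd_of_multiplicity_le (prod_pow_ne_zero T e) fun v => ?_
      rw [multiplicity_prod_pow]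
      split_ifs with h
      · rw [he]
        simp only [dif_pos h]
        exact Nat.lt_succ_iff.mp (Finset.mem_range.mp (hx ⟨v, h⟩))
      · exact Nat.zero_le _
    · funext v
      change multiplicity v.1.asIdeal _ = _
      rw [multiplicity_prod_pow, if_pos v.2, he]
      simp only [dif_pos v.2]
  · intro d hd
    rw [hF d hd, ← Finset.prod_coe_sort]

/-- A sum over the factorizations of an ideal into two factors. -/
theorem finsum_factorizations_eq_prod {M : Type*} [CommSemiring M] {S : Ideal A} (hS : S ≠ 0)
    {T : Finset (HeightOneSpectrum A)} (hT : ∀ v ∉ T, multiplicity v.asIdeal S = 0)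
    (f : HeightOneSpectrum A → ℕ → M) (F : Ideal A × Ideal A → M)
    (hF : ∀ d, d.1 * d.2 = S → F d = ∏ v ∈ T, f v (multiplicity v.asIdeal d.1)) :
    ∑ᶠ (d : Ideal A × Ideal A) (_ : d.1 * d.2 = S), F d =
      ∏ v ∈ T, ∑ j ∈ Finset.range (multiplicity v.asIdeal S + 1), f v j := by
  rw [← finsum_divisors_eq_prod hS hT f (fun d => ∏ v ∈ T, f v (multiplicity v.asIdeal d))
    fun _ _ => rfl]
  refine finsum_mem_eq_of_bijOn (s := {d : Ideal A × Ideal A | d.1 * d.2 = S}) (t := {d | d ∣ S})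
    Prod.fst ⟨?_, ?_, ?_⟩ hF
  · rintro d rfl
    exact dvd_mul_right _ _
  · rintro ⟨a, b⟩ h ⟨a', b'⟩ h' (e : a = a')
    subst e
    have h : a * b = S := h
    have h' : a * b' = S := h'
    have ha : a ≠ 0 := fun h0 => hS (by rw [← h, h0, zero_mul])
    rw [mul_left_cancel₀ ha (h.trans h'.symm)]
  · rintro d ⟨d', rfl⟩
    exact ⟨(d, d'), rfl, rfl⟩

lemma finprod_dvd_eq_prod {M : Type*} [CommMonoid M] {I : Ideal A} (hI : I ≠ 0)
    {T : Finset (HeightOneSpectrum A)} (hT : ∀ v ∉ T, multiplicity v.asIdeal I = 0)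
    (f : HeightOneSpectrum A → M) :
    ∏ᶠ (v : HeightOneSpectrum A) (_ : v.asIdeal ∣ I), f v =
      ∏ v ∈ T, if multiplicity v.asIdeal I = 0 then 1 else f v := by
  classical
  have h : ∀ v : HeightOneSpectrum A, (∏ᶠ (_ : v.asIdeal ∣ I), f v) =
      if multiplicity v.asIdeal I = 0 then 1 else f v := by
    intro v
    simp only [finprod_eq_if, dvd_ideal_iff v hI, ne_eq, ite_not]
  simp_rw [h]
  refine finprod_eq_prod_of_mulSupport_subset _ fun v hv => ?_
  by_contra hvT
  exact hv (if_pos (hT v hvT))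

lemma intValuation_eq_exp_iff (v : HeightOneSpectrum A) {r : A} (hr : r ≠ 0) (n : ℕ) :
    v.intValuation r = WithZero.exp (-(n : ℤ)) ↔ multiplicity v.asIdeal (Ideal.span {r}) = n := by
  rw [v.intValuation_eq_exp_neg_multiplicity hr, WithZero.exp_inj]
  omega

end DivisorSum

section Norm

variable {K : Type*} [Field K] [NumberField K]

lemma absNorm_eq_prod {I : Ideal (𝓞 K)} (hI : I ≠ 0) {T : Finset (HeightOneSpectrum (𝓞 K))}
    (hT : ∀ v ∉ T, multiplicity v.asIdeal I = 0) :
    Ideal.absNorm I = ∏ v ∈ T, Ideal.absNorm v.asIdeal ^ multiplicity v.asIdeal I := by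
  conv_lhs => rw [ideal_eq_prod_pow hI hT]
  rw [map_prod]
  simp_rw [map_pow]

lemma natCast_prod_cpow {ι : Type*} (T : Finset ι) (a e : ι → ℕ) (s : ℂ) :
    ((∏ i ∈ T, a i ^ e i : ℕ) : ℂ) ^ s = ∏ i ∈ T, ((a i : ℂ) ^ s) ^ e i := by
  classical
  induction T using Finset.induction_on with
  | empty => simp
  | insert i T hi ih =>
    rw [Finset.prod_insert hi, Finset.prod_insert hi, Nat.cast_mul, Complex.natCast_mul_natCast_cpow,
      ih, Nat.cast_pow, ← Complex.natCast_cpow_natCast_mul, mul_comm (e i : ℂ),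
      Complex.cpow_mul_nat]

end Norm

/-! ### The index ideal -/

section IndexIdeal

variable {K : Type*} [Field K] [NumberField K] {γ : GL (Fin 2) K}

lemma exists_algebraMap_eq_discr (hγ : IsRegularElliptic γ) {θ : quadExt γ}
    (hθ : IsIntegral (𝓞 K) θ) : ∃ d : 𝓞 K, algebraMap (𝓞 K) K d = Algebra.discr K ![1, θ] := by
  obtain ⟨t, m, ht, hm⟩ := exists_trace_norm_eq hγ hθ
  exact ⟨t ^ 2 - 4 * m, by rw [discr_pair hγ, ← ht, ← hm, map_sub, map_mul, map_pow, map_ofNat]⟩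

/-- The discriminant of the local generator, in `𝓞 K`. -/
noncomputable def genDiscr (hγ : IsRegularElliptic γ) (v : HeightOneSpectrum (𝓞 K)) : 𝓞 K :=
  (exists_algebraMap_eq_discr hγ (isIntegral_localGen hγ v)).choose

lemma algebraMap_genDiscr (hγ : IsRegularElliptic γ) (v : HeightOneSpectrum (𝓞 K)) :
    algebraMap (𝓞 K) K (genDiscr hγ v) = Algebra.discr K ![1, localGen hγ v] :=
  (exists_algebraMap_eq_discr hγ (isIntegral_localGen hγ v)).choose_spec

lemma genDiscr_ne_zero (hγ : IsRegularElliptic γ) (v : HeightOneSpectrum (𝓞 K)) :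
    genDiscr hγ v ≠ 0 := by
  intro h
  have := algebraMap_genDiscr hγ v
  rw [h, map_zero] at this
  exact discr_pair_ne_zero hγ (localGen_notMem_range hγ v) this.symm

lemma mem_relDiscr (hγ : IsRegularElliptic γ) {θ : quadExt γ} (hθ : IsIntegral (𝓞 K) θ)
    (hθ' : θ ∉ Set.range (algebraMap K (quadExt γ))) {d : 𝓞 K}
    (hd : algebraMap (𝓞 K) K d = Algebra.discr K ![1, θ]) : d ∈ relDiscr γ := by
  refine Ideal.subset_span ⟨pairBasis hγ hθ', ?_, ?_⟩
  · rw [pairBasis_eq]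
    intro i
    fin_cases i
    · exact isIntegral_one
    · exact hθ
  · rw [pairBasis_eq]
    exact hd

lemma genDiscr_mem_relDiscr (hγ : IsRegularElliptic γ) (v : HeightOneSpectrum (𝓞 K)) :
    genDiscr hγ v ∈ relDiscr γ :=
  mem_relDiscr hγ (isIntegral_localGen hγ v) (localGen_notMem_range hγ v) (algebraMap_genDiscr hγ v)

lemma relDiscr_ne_zero (hγ : IsRegularElliptic γ) : relDiscr γ ≠ 0 := by
  intro h
  obtain ⟨θ, hθ, hθ'⟩ := exists_isIntegral_notMem_range hγ
  obtain ⟨d, hd⟩ := exists_algebraMap_eq_discr hγ hθ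
  have := mem_relDiscr hγ hθ hθ' hd
  rw [h] at this
  have h0 : d = 0 := this
  rw [h0, map_zero] at hd
  exact discr_pair_ne_zero hγ hθ' hd.symm

lemma valuation_discr_basis_le (hγ : IsRegularElliptic γ) (v : HeightOneSpectrum (𝓞 K))
    (b : Module.Basis (Fin 2) K (quadExt γ)) (hb : ∀ i, IsIntegral (𝓞 K) (b i)) :
    v.valuation K (Algebra.discr K b) ≤ v.valuation K (algebraMap (𝓞 K) K (genDiscr hγ v)) := by
  obtain ⟨p, q, h0⟩ := exists_eq_add_smul hγ (localGen_notMem_range hγ v) (b 0)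
  obtain ⟨p', q', h1⟩ := exists_eq_add_smul hγ (localGen_notMem_range hγ v) (b 1)
  have hb' : (b : Fin 2 → quadExt γ) = ![algebraMap K (quadExt γ) p + q • localGen hγ v,
      algebraMap K (quadExt γ) p' + q' • localGen hγ v] := by
    funext i
    fin_cases i
    · exact h0
    · exact h1
  have v0 := valuation_coord_le_one hγ v (h0 ▸ hb 0)
  have v1 := valuation_coord_le_one hγ v (h1 ▸ hb 1)
  rw [hb', discr_pair_eq, map_mul, map_pow, algebraMap_genDiscr]
  refine mul_le_of_le_one_left' (pow_le_one' ?_ 2)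
  refine (Valuation.map_sub _ _ _).trans (max_le ?_ ?_)
  · rw [map_mul]
    exact mul_le_one' v0.1 v1.2
  · rw [map_mul]
    exact mul_le_one' v0.2 v1.1

/-- The discriminant of the local generator belongs to the relative discriminant. Conversely an
integral basis has v-integral coordinates in 1, θ, so its discriminant is disc θ times the square of
a v-integral determinant. -/
lemma multiplicity_relDiscr (hγ : IsRegularElliptic γ) (v : HeightOneSpectrum (𝓞 K)) :
    multiplicity v.asIdeal (relDiscr γ) = multiplicity v.asIdeal (Ideal.span {genDiscr hγ v}) := by
  have h0 := genDiscr_ne_zero hγ v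
  have h1 : Ideal.span {genDiscr hγ v} ≠ 0 := fun h => h0 (Ideal.span_singleton_eq_bot.mp h)
  apply le_antisymm
  · refine multiplicity_le_of_ideal_dvd v (relDiscr_ne_zero hγ) h1 (Ideal.dvd_iff_le.mpr ?_)
    exact (Ideal.span_singleton_le_iff_mem _).mpr (genDiscr_mem_relDiscr hγ v)
  · rw [← pow_dvd_ideal_iff v (relDiscr_ne_zero hγ), Ideal.dvd_iff_le, relDiscr, Ideal.span_le]
    rintro d ⟨b, hb, hd⟩
    have h := valuation_discr_basis_le hγ v b hb
    rw [← hd, v.valuation_of_algebraMap, v.valuation_of_algebraMap,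
      v.intValuation_eq_exp_neg_multiplicity h0] at h
    exact (v.intValuation_le_pow_iff_mem d _).mp h

lemma elemDiscr_ne_zero (hγ : IsRegularElliptic γ) : elemDiscr γ ≠ 0 :=
  discr_pair_ne_zero hγ hγ.root_notMem_range

/-- The root is integral at `v`. -/
def IsIntegralAt (hγ : IsRegularElliptic γ) (v : HeightOneSpectrum (𝓞 K)) : Prop :=
  v.valuation K (rootRe hγ v) ≤ 1 ∧ v.valuation K (rootIm hγ v) ≤ 1

/-- disc(γ) is q² disc θ, where q is the second coordinate of the root. -/
lemma valuation_elemDiscr (hγ : IsRegularElliptic γ) {v : HeightOneSpectrum (𝓞 K)}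
    (h : IsIntegralAt hγ v) : v.valuation K (elemDiscr γ) =
      WithZero.exp (-((2 * localIndex hγ v + multiplicity v.asIdeal (relDiscr γ) : ℕ) : ℤ)) := by
  rw [elemDiscr_eq hγ v, map_mul, map_pow, valuation_rootIm hγ v h.2, ← algebraMap_genDiscr,
    v.valuation_of_algebraMap, v.intValuation_eq_exp_neg_multiplicity (genDiscr_ne_zero hγ v),
    multiplicity_relDiscr hγ v, ← WithZero.exp_nsmul, ← WithZero.exp_add]
  congr 1
  push_cast
  ring

lemma exists_algebraMap_eq_elemDiscr (hγ : IsRegularElliptic γ)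
    (h : ∀ v, IsIntegralAt hγ v) : ∃ δ : 𝓞 K, algebraMap (𝓞 K) K δ = elemDiscr γ :=
  HeightOneSpectrum.mem_integers_of_valuation_le_one K _ fun v => by
    rw [valuation_elemDiscr hγ (h v), ← WithZero.exp_zero, WithZero.exp_le_exp]
    omega

lemma isIndexIdeal_iff {δ : 𝓞 K} (hδ : algebraMap (𝓞 K) K δ = elemDiscr γ) (S : Ideal (𝓞 K)) :
    IsIndexIdeal γ S ↔ S ^ 2 * relDiscr γ = Ideal.span {δ} := by
  rw [IsIndexIdeal, ← hδ, ← FractionalIdeal.coeIdeal_span_singleton,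
    FractionalIdeal.coeIdeal_inj]

lemma finite_setOf_valuation_ne_one {x : K} (hx : x ≠ 0) :
    {v : HeightOneSpectrum (𝓞 K) | v.valuation K x ≠ 1}.Finite := by
  have key : ∀ {a : 𝓞 K}, a ≠ 0 →
      {v : HeightOneSpectrum (𝓞 K) | v.valuation K (algebraMap (𝓞 K) K a) ≠ 1}.Finite := by
    intro a ha
    refine (Ideal.finite_factors (I := Ideal.span {a})
      fun h => ha (Ideal.span_singleton_eq_bot.mp h)).subset fun v hv => ?_
    rw [Set.mem_ofPred_eq, ← v.valuation_lt_one_iff_dvd (K := K)]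
    exact lt_of_le_of_ne (v.valuation_le_one a) hv
  obtain ⟨a, b, hb, rfl⟩ := IsFractionRing.div_surjective (𝓞 K) x
  have ha : a ≠ 0 := by rintro rfl; simp at hx
  refine ((key ha).union (key (nonZeroDivisors.ne_zero hb))).subset fun v hv => ?_
  by_contra hcon
  rw [Set.mem_union, not_or] at hcon
  simp only [Set.mem_ofPred_eq, not_not] at hcon
  exact hv (by rw [map_div₀, hcon.1, hcon.2, div_one])

lemma localIndex_eq_zero_of_valuation (hγ : IsRegularElliptic γ) {v : HeightOneSpectrum (𝓞 K)}
    (h : IsIntegralAt hγ v) (hd : v.valuation K (elemDiscr γ) = 1) : localIndex hγ v = 0 := by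
  rw [valuation_elemDiscr hγ h, ← WithZero.exp_zero, WithZero.exp_inj] at hd
  omega

lemma finite_localIndex_ne_zero (hγ : IsRegularElliptic γ) (h : ∀ v, IsIntegralAt hγ v) :
    {v | localIndex hγ v ≠ 0}.Finite :=
  (finite_setOf_valuation_ne_one (elemDiscr_ne_zero hγ)).subset fun v hv hd =>
    hv (localIndex_eq_zero_of_valuation hγ (h v) hd)

lemma multiplicity_span_elemDiscr (hγ : IsRegularElliptic γ) {δ : 𝓞 K}
    (hδ : algebraMap (𝓞 K) K δ = elemDiscr γ) {v : HeightOneSpectrum (𝓞 K)}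
    (h : IsIntegralAt hγ v) : multiplicity v.asIdeal (Ideal.span {δ}) =
      2 * localIndex hγ v + multiplicity v.asIdeal (relDiscr γ) := by
  have hδ0 : δ ≠ 0 := by
    rintro rfl
    exact elemDiscr_ne_zero hγ (by rw [← hδ, map_zero])
  rw [← intValuation_eq_exp_iff v hδ0, ← v.valuation_of_algebraMap (K := K)]
  exact (congrArg _ hδ).trans (valuation_elemDiscr hγ h)

theorem isIndexIdeal_prod (hγ : IsRegularElliptic γ) (h : ∀ v, IsIntegralAt hγ v) :
    IsIndexIdeal γ (∏ v ∈ (finite_localIndex_ne_zero hγ h).toFinset,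
      v.asIdeal ^ localIndex hγ v) := by
  classical
  obtain ⟨δ, hδ⟩ := exists_algebraMap_eq_elemDiscr hγ h
  have hδ0 : Ideal.span {δ} ≠ 0 := by
    intro hs
    rw [Ideal.zero_eq_bot, Ideal.span_singleton_eq_bot] at hs
    exact elemDiscr_ne_zero hγ (by rw [← hδ, hs, map_zero])
  rw [isIndexIdeal_iff hδ]
  have h1 := relDiscr_ne_zero hγ
  have h2 := prod_pow_ne_zero (finite_localIndex_ne_zero hγ h).toFinset (localIndex hγ)
  refine ideal_eq_of_multiplicity_eq (mul_ne_zero (pow_ne_zero 2 h2) h1) hδ0 fun v => ?_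
  rw [multiplicity_ideal_mul v (pow_ne_zero 2 h2) h1, multiplicity_span_elemDiscr hγ hδ (h v),
    pow_two, multiplicity_ideal_mul v h2 h2, multiplicity_prod_pow]
  congr 1
  rw [← two_mul]
  congr 1
  split_ifs with hv
  · rfl
  · simpa [eq_comm] using hv

theorem isIndexIdeal_indexIdeal (hγ : IsRegularElliptic γ) (h : ∀ v, IsIntegralAt hγ v) :
    IsIndexIdeal γ (indexIdeal γ) :=
  Classical.epsilon_spec ⟨_, isIndexIdeal_prod hγ h⟩

theorem indexIdeal_ne_zero (hγ : IsRegularElliptic γ) (h : ∀ v, IsIntegralAt hγ v) :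
    indexIdeal γ ≠ 0 := by
  obtain ⟨δ, hδ⟩ := exists_algebraMap_eq_elemDiscr hγ h
  have h1 := (isIndexIdeal_iff hδ _).mp (isIndexIdeal_indexIdeal hγ h)
  intro h0
  rw [h0, zero_pow two_ne_zero, zero_mul, eq_comm, Ideal.zero_eq_bot,
    Ideal.span_singleton_eq_bot] at h1
  exact elemDiscr_ne_zero hγ (by rw [← hδ, h1, map_zero])

/-- Taking multiplicities in S² Disc = (disc γ) determines those of S, so the choice made by
`Classical.epsilon` does not matter. -/
theorem multiplicity_indexIdeal (hγ : IsRegularElliptic γ) (h : ∀ v, IsIntegralAt hγ v)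
    (v : HeightOneSpectrum (𝓞 K)) : multiplicity v.asIdeal (indexIdeal γ) = localIndex hγ v := by
  obtain ⟨δ, hδ⟩ := exists_algebraMap_eq_elemDiscr hγ h
  have h1 := congrArg (multiplicity v.asIdeal)
    ((isIndexIdeal_iff hδ _).mp (isIndexIdeal_indexIdeal hγ h))
  have h2 := indexIdeal_ne_zero hγ h
  rw [multiplicity_ideal_mul v (pow_ne_zero 2 h2) (relDiscr_ne_zero hγ),
    multiplicity_span_elemDiscr hγ hδ (h v), pow_two, multiplicity_ideal_mul v h2 h2] at h1
  omega

end IndexIdeal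

/-! ### Symmetry and special value of the local factor -/

section LocalFactor

lemma localFactor_zero (q : ℕ) (χ s : ℂ) : localFactor q 0 χ s = 1 := by
  simp [localFactor]

/-- The local factor as a symmetric function of `q^s` and `q^(1-s)`. -/
lemma localFactor_eq_geom_sum {q : ℕ} (hq : q ≠ 0) (n : ℕ) (χ s : ℂ) :
    localFactor q (n + 1) χ s =
      ∑ i ∈ Finset.range (n + 2), ((q : ℂ) ^ s) ^ i * ((q : ℂ) ^ (1 - s)) ^ (n + 2 - 1 - i) -
        χ * ∑ i ∈ Finset.range (n + 1), ((q : ℂ) ^ s) ^ i * ((q : ℂ) ^ (1 - s)) ^ (n + 1 - 1 - i) := by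
  have hq' : (q : ℂ) ≠ 0 := Nat.cast_ne_zero.mpr hq
  have hQ : (q : ℂ) ^ s ≠ 0 := by simp [Complex.cpow_eq_zero_iff, hq']
  have hd : (q : ℂ) ^ (1 - 2 * s) = (q : ℂ) ^ (1 - s) * ((q : ℂ) ^ s)⁻¹ := by
    rw [← Complex.cpow_neg, ← Complex.cpow_add _ _ hq']
    congr 1
    ring
  rw [localFactor, hd, Complex.cpow_nat_mul, Complex.cpow_neg]
  set Q := (q : ℂ) ^ s
  set Q' := (q : ℂ) ^ (1 - s)
  have hA : ∀ m : ℕ, ∑ i ∈ Finset.range (m + 1), Q ^ i * Q' ^ (m + 1 - 1 - i) =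
      Q ^ m * ∑ j ∈ Finset.range (m + 1), (Q' * Q⁻¹) ^ j := by
    intro m
    rw [← Finset.sum_range_reflect, Finset.mul_sum]
    refine Finset.sum_congr rfl fun j hj => ?_
    have hj : j ≤ m := Nat.lt_succ_iff.mp (Finset.mem_range.mp hj)
    rw [Nat.add_sub_cancel, Nat.sub_sub_self hj, mul_pow, inv_pow, ← mul_assoc, mul_right_comm,
      ← pow_sub₀ _ hQ hj]
  rw [hA, hA, Finset.sum_range_succ, if_pos rfl, Finset.sum_range_succ (fun j => (Q' * Q⁻¹) ^ j)]
  have hB : ∑ j ∈ Finset.range (n + 1), (Q' * Q⁻¹) ^ j * (if j = n + 1 then 1 else 1 - χ * Q⁻¹) =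
      (∑ j ∈ Finset.range (n + 1), (Q' * Q⁻¹) ^ j) * (1 - χ * Q⁻¹) := by
    rw [Finset.sum_mul]
    refine Finset.sum_congr rfl fun j hj => ?_
    rw [if_neg (Finset.mem_range.mp hj).ne]
  rw [hB, pow_succ Q n]
  field_simp
  ring

/-- The substitution exchanges q^s and q^(1-s), and the two geometric sums are symmetric in them.
The case n = 0 is apart, since the second sum has degree n - 1. -/
theorem localFactor_one_sub {q : ℕ} (hq : q ≠ 0) (n : ℕ) (χ s : ℂ) :
    localFactor q n χ (1 - s) = localFactor q n χ s := by
  rcases n with _ | n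
  · rw [localFactor_zero, localFactor_zero]
  · rw [localFactor_eq_geom_sum hq, localFactor_eq_geom_sum hq, sub_sub_cancel,
      Commute.geom_sum₂_comm (n + 2) (Commute.all _ _),
      Commute.geom_sum₂_comm (n + 1) (Commute.all _ _)]

/-- At s = 1 the j-th term is q^(n-j); reversing the sum moves the exceptional term from j = n to j
= 0. -/
lemma localFactor_one {q : ℕ} (hq : q ≠ 0) (n : ℕ) (χ : ℂ) :
    localFactor q n χ 1 =
      ∑ j ∈ Finset.range (n + 1), (q : ℂ) ^ j * (if j = 0 then 1 else 1 - χ / q) := by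
  have hq' : (q : ℂ) ≠ 0 := Nat.cast_ne_zero.mpr hq
  rw [localFactor, ← Finset.sum_range_reflect, Finset.mul_sum]
  refine Finset.sum_congr rfl fun j hj => ?_
  have hj : j ≤ n := Nat.lt_succ_iff.mp (Finset.mem_range.mp hj)
  rw [mul_one, Complex.cpow_natCast, Nat.add_sub_cancel, ← mul_assoc]
  have e : (1 - 2 * 1 : ℂ) = -1 := by norm_num
  rw [e, Complex.cpow_neg_one, inv_pow, ← pow_sub₀ _ hq' (Nat.sub_le n j), Nat.sub_sub_self hj,
    div_eq_mul_inv]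
  congr 1
  have : n - j = n ↔ j = 0 := by omega
  simp only [this]

end LocalFactor

/-! ### Evaluation at a prime and the role of contributing elements -/

section LocalEvaluation

variable {K : Type*} [Field K] [NumberField K] {γ : GL (Fin 2) K}

lemma absNorm_ne_zero (v : HeightOneSpectrum (𝓞 K)) : Ideal.absNorm v.asIdeal ≠ 0 :=
  Ideal.absNorm_eq_zero_iff.not.mpr v.ne_bot

lemma isNormalizedZeta_localFactor (hγ : IsRegularElliptic γ) {v : HeightOneSpectrum (𝓞 K)}
    (h : IsIntegralAt hγ v) : IsNormalizedZeta (Ideal.absNorm v.asIdeal) (localOrder γ v)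
      (localFactor (Ideal.absNorm v.asIdeal) (localIndex hγ v) (quadChar γ v)) := by
  obtain ⟨π, hπ⟩ := IsDiscreteValuationRing.exists_irreducible (v.adicCompletionIntegers K)
  have h1 := (localCoord hγ v).isNormalizedZeta_order hπ (localIndex hγ v)
  rw [card_residueField, ← localOrder_eq hγ v hπ ((localRoot_mem_order_zero_iff hγ v hπ).mpr h)] at h1
  rw [quadChar_eq hγ v]
  push_cast
  exact h1

lemma localJ_eq (hγ : IsRegularElliptic γ) {v : HeightOneSpectrum (𝓞 K)}
    (h : IsIntegralAt hγ v) : localJ γ v =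
      localFactor (Ideal.absNorm v.asIdeal) (localIndex hγ v) (quadChar γ v) :=
  (isNormalizedZeta_localFactor hγ h).normalizedZeta_eq

lemma localOrbital_eq (hγ : IsRegularElliptic γ) {v : HeightOneSpectrum (𝓞 K)}
    (h : IsIntegralAt hγ v) (k : HeightOneSpectrum (𝓞 K) → ℕ)
    (hdet : v.valuation K γ.1.det = WithZero.exp (-(k v : ℤ))) :
    localOrbital γ k v = ∑ j ∈ Finset.range (localIndex hγ v + 1),
      (Ideal.absNorm v.asIdeal : ℝ) ^ j *
        (if j = 0 then 1 else 1 - (quadChar γ v : ℝ) / (Ideal.absNorm v.asIdeal : ℝ)) := by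
  obtain ⟨π, hπ⟩ := IsDiscreteValuationRing.exists_irreducible (v.adicCompletionIntegers K)
  have hq : (Ideal.absNorm v.asIdeal : ℝ) ≠ 0 := Nat.cast_ne_zero.mpr (absNorm_ne_zero v)
  rw [localOrbital_eq_sum (localCoord hγ v) hγ hπ k hdet (localRoot_mem_order_iff hγ v hπ
    ((localRoot_mem_order_zero_iff hγ v hπ).mpr h))]
  refine Finset.sum_congr rfl fun j _ => ?_
  rcases j with _ | j
  · simp
  · have := (localCoord hγ v).relIndex_unitGroup_zero hπ j
    rw [← quadChar_eq hγ v, card_residueField] at this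
    rw [← Int.cast_natCast (R := ℝ), this, if_neg (Nat.succ_ne_zero j), pow_succ]
    push_cast
    field_simp

lemma ofReal_localOrbital (hγ : IsRegularElliptic γ) {v : HeightOneSpectrum (𝓞 K)}
    (h : IsIntegralAt hγ v) (k : HeightOneSpectrum (𝓞 K) → ℕ)
    (hdet : v.valuation K γ.1.det = WithZero.exp (-(k v : ℤ))) :
    ((localOrbital γ k v : ℝ) : ℂ) = localJ γ v 1 := by
  rw [localOrbital_eq hγ h k hdet, localJ_eq hγ h, localFactor_one (absNorm_ne_zero v)]
  push_cast
  refine Finset.sum_congr rfl fun j _ => ?_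
  split_ifs <;> simp

lemma isIntegralAt_of_valuation_le_one (hγ : IsRegularElliptic γ) {v : HeightOneSpectrum (𝓞 K)}
    (h1 : v.valuation K (Algebra.trace K (quadExt γ) (AdjoinRoot.root γ.1.charpoly)) ≤ 1)
    (h2 : v.valuation K (Algebra.norm K (AdjoinRoot.root γ.1.charpoly)) ≤ 1) :
    IsIntegralAt hγ v := by
  obtain ⟨π, hπ⟩ := IsDiscreteValuationRing.exists_irreducible (v.adicCompletionIntegers K)
  exact (localRoot_mem_order_zero_iff hγ v hπ).mp (((localCoord hγ v).mem_order_zero_iff π).mpr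
    (isIntegral_tmul_of_valuation_le_one hγ h1 h2))

lemma finite_setOf_not_valuation_le_one (x : K) :
    {v : HeightOneSpectrum (𝓞 K) | ¬ v.valuation K x ≤ 1}.Finite := by
  rcases eq_or_ne x 0 with rfl | hx
  · simp
  · exact (finite_setOf_valuation_ne_one hx).subset fun v hv h => hv h.le

/-- Almost all local orbital integrals are `1`. -/
theorem finite_localOrbital_ne_one (hγ : IsRegularElliptic γ) {k : HeightOneSpectrum (𝓞 K) → ℕ}
    (hk : (Function.support k).Finite) : {v | localOrbital γ k v ≠ 1}.Finite := by
  have hdet : γ.1.det ≠ 0 := ((Matrix.isUnit_iff_isUnit_det _).mp γ.isUnit).ne_zero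
  -- Outside the support of k and the primes where the determinant or discriminant is not a unit, or
  -- the trace or norm is not integral, the local index is 0 and the integral is 1.
  refine ((((hk.union (finite_setOf_valuation_ne_one hdet)).union
    (finite_setOf_valuation_ne_one (elemDiscr_ne_zero hγ))).union
    (finite_setOf_not_valuation_le_one (Algebra.trace K (quadExt γ)
      (AdjoinRoot.root γ.1.charpoly)))).union (finite_setOf_not_valuation_le_one
      (Algebra.norm K (AdjoinRoot.root γ.1.charpoly)))).subset fun v hv => ?_
  by_contra hcon
  simp only [Set.mem_union, not_or, Set.mem_ofPred_eq, not_not, Function.mem_support] at hcon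
  obtain ⟨⟨⟨⟨hkv, hd⟩, he⟩, ht⟩, hn⟩ := hcon
  have hi := isIntegralAt_of_valuation_le_one hγ ht hn
  refine hv ?_
  rw [localOrbital_eq hγ hi k (by rw [hd, hkv]; simp), localIndex_eq_zero_of_valuation hγ hi he]
  simp

/-- If `γ` contributes, then it is integral at every prime, with determinant of the right
valuation. -/
theorem IsContributing.isIntegralAt (hγ : IsRegularElliptic γ) {k : HeightOneSpectrum (𝓞 K) → ℕ}
    (hk : (Function.support k).Finite) (hc : IsContributing γ k) (v : HeightOneSpectrum (𝓞 K)) :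
    IsIntegralAt hγ v ∧ v.valuation K γ.1.det = WithZero.exp (-(k v : ℤ)) := by
  -- A zero factor annihilates `∏ᶠ` only because almost all factors are 1; otherwise the product
  -- would be 1 by convention.
  have hv : localOrbital γ k v ≠ 0 := fun h0 =>
    hc (finprod_eq_zero _ v h0 (finite_localOrbital_ne_one hγ hk))
  obtain ⟨π, hπ⟩ := IsDiscreteValuationRing.exists_irreducible (v.adicCompletionIntegers K)
  constructor
  · rw [IsIntegralAt, ← localRoot_mem_order_zero_iff hγ v hπ]
    by_contra h
    exact hv (localOrbital_eq_zero_of_notMem (localCoord hγ v) hγ hπ k h)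
  · by_contra h
    exact hv (localOrbital_eq_zero_of_valuation_ne k v h)

end LocalEvaluation

/-! ### Global products and divisor sums -/

section Global

variable {K : Type*} [Field K] [NumberField K] {γ : GL (Fin 2) K}

lemma globalJ_eq_prod (hγ : IsRegularElliptic γ) (h : ∀ v, IsIntegralAt hγ v)
    {T : Finset (HeightOneSpectrum (𝓞 K))} (hT : ∀ v ∉ T, localIndex hγ v = 0) (s : ℂ) :
    globalJ γ s = ∏ v ∈ T,
      localFactor (Ideal.absNorm v.asIdeal) (localIndex hγ v) (quadChar γ v) s := by
  rw [globalJ]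
  simp_rw [fun v => localJ_eq hγ (h v)]
  refine finprod_eq_prod_of_mulSupport_subset _ fun v hv => ?_
  by_contra hvT
  rw [Function.mem_mulSupport, hT v hvT, localFactor_zero] at hv
  exact hv rfl

lemma eulerProd_eq_prod {I : Ideal (𝓞 K)} (hI : I ≠ 0) {T : Finset (HeightOneSpectrum (𝓞 K))}
    (hT : ∀ v ∉ T, multiplicity v.asIdeal I = 0) (s : ℂ) :
    eulerProd γ I s = ∏ v ∈ T, if multiplicity v.asIdeal I = 0 then 1 else
      1 - (quadChar γ v : ℂ) * (Ideal.absNorm v.asIdeal : ℂ) ^ (-s) :=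
  finprod_dvd_eq_prod hI hT _

/-- For d d' = S, a prime divides d' exactly when its exponent in d is not the full exponent in S.
The summand is therefore multiplicative in the exponents of d, with the exceptional term of
`localFactor` at j = n. -/
lemma divisorSum_eq_prod (hγ : IsRegularElliptic γ) (h : ∀ v, IsIntegralAt hγ v)
    {T : Finset (HeightOneSpectrum (𝓞 K))} (hT : ∀ v ∉ T, localIndex hγ v = 0) (s : ℂ) :
    divisorSum γ s = ∏ v ∈ T,
      localFactor (Ideal.absNorm v.asIdeal) (localIndex hγ v) (quadChar γ v) s := by
  have hS := indexIdeal_ne_zero hγ h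
  have hm := multiplicity_indexIdeal hγ h
  have hT' : ∀ v ∉ T, multiplicity v.asIdeal (indexIdeal γ) = 0 := fun v hv => by
    rw [hm, hT v hv]
  rw [divisorSum, finsum_factorizations_eq_prod hS hT' (fun v j =>
    ((Ideal.absNorm v.asIdeal : ℂ) ^ (1 - 2 * s)) ^ j * (if j = localIndex hγ v then 1 else
      1 - (quadChar γ v : ℂ) * (Ideal.absNorm v.asIdeal : ℂ) ^ (-s)))]
  · rw [absNorm_eq_prod hS hT', natCast_prod_cpow, ← Finset.prod_mul_distrib]
    refine Finset.prod_congr rfl fun v _ => ?_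
    rw [hm, localFactor, Complex.cpow_nat_mul]
  · rintro ⟨a, b⟩ (hab : a * b = indexIdeal γ)
    have ha : a ≠ 0 := fun h0 => hS (by rw [← hab, h0, zero_mul])
    have hb : b ≠ 0 := fun h0 => hS (by rw [← hab, h0, mul_zero])
    have hadd : ∀ v : HeightOneSpectrum (𝓞 K),
        multiplicity v.asIdeal a + multiplicity v.asIdeal b = localIndex hγ v := fun v => by
      rw [← multiplicity_ideal_mul v ha hb, hab, hm]
    have haT : ∀ v ∉ T, multiplicity v.asIdeal a = 0 := fun v hv => by
      have := hadd v; rw [hT v hv] at this; omega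
    have hbT : ∀ v ∉ T, multiplicity v.asIdeal b = 0 := fun v hv => by
      have := hadd v; rw [hT v hv] at this; omega
    change (Ideal.absNorm a : ℂ) ^ (1 - 2 * s) * eulerProd γ b s = _
    rw [absNorm_eq_prod ha haT, natCast_prod_cpow, eulerProd_eq_prod hb hbT,
      ← Finset.prod_mul_distrib]
    refine Finset.prod_congr rfl fun v _ => ?_
    have : multiplicity v.asIdeal b = 0 ↔ multiplicity v.asIdeal a = localIndex hγ v := by
      have := hadd v; omega
    simp only [this]

/-- Here the Euler factors run over the primes of d itself, so the exceptional exponent is j = 0. -/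
lemma orbital_divisorSum_eq_prod (hγ : IsRegularElliptic γ) (h : ∀ v, IsIntegralAt hγ v)
    {T : Finset (HeightOneSpectrum (𝓞 K))} (hT : ∀ v ∉ T, localIndex hγ v = 0) :
    ∑ᶠ (d : Ideal (𝓞 K)) (_ : d ∣ indexIdeal γ), (Ideal.absNorm d : ℝ) *
        ∏ᶠ (p : HeightOneSpectrum (𝓞 K)) (_ : p.asIdeal ∣ d),
          (1 - (quadChar γ p : ℝ) / (Ideal.absNorm p.asIdeal : ℝ)) =
      ∏ v ∈ T, ∑ j ∈ Finset.range (localIndex hγ v + 1), (Ideal.absNorm v.asIdeal : ℝ) ^ j *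
        (if j = 0 then 1 else 1 - (quadChar γ v : ℝ) / (Ideal.absNorm v.asIdeal : ℝ)) := by
  have hS := indexIdeal_ne_zero hγ h
  have hm := multiplicity_indexIdeal hγ h
  have hT' : ∀ v ∉ T, multiplicity v.asIdeal (indexIdeal γ) = 0 := fun v hv => by
    rw [hm, hT v hv]
  rw [finsum_divisors_eq_prod hS hT' (fun v j => (Ideal.absNorm v.asIdeal : ℝ) ^ j *
    (if j = 0 then 1 else 1 - (quadChar γ v : ℝ) / (Ideal.absNorm v.asIdeal : ℝ)))]
  · simp_rw [hm]
  · intro d hd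
    have hd0 : d ≠ 0 := fun h0 => hS (zero_dvd_iff.mp (h0 ▸ hd))
    have hdT : ∀ v ∉ T, multiplicity v.asIdeal d = 0 := fun v hv =>
      Nat.le_zero.mp ((multiplicity_le_of_ideal_dvd v hd0 hS hd).trans_eq (hT' v hv))
    rw [absNorm_eq_prod hd0 hdT, finprod_dvd_eq_prod hd0 hdT, Nat.cast_prod,
      ← Finset.prod_mul_distrib]
    simp_rw [Nat.cast_pow]

end Global

end OrbitalGL2

theorem theorem3 {K : Type*} [Field K] [NumberField K]
    (k : HeightOneSpectrum (𝓞 K) → ℕ) (hk : (Function.support k).Finite)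
    (γ : GL (Fin 2) K) (hγ : IsRegularElliptic γ) (hc : IsContributing γ k) :
    -- the objects in the formulas are the intended ones, and the products are finite
    IsIndexIdeal γ (indexIdeal γ) ∧
    (∀ v, IsNormalizedZeta (Ideal.absNorm v.asIdeal) (localOrder γ v) (localJ γ v)) ∧
    {v | localJ γ v ≠ 1}.Finite ∧
    {v | localOrbital γ k v ≠ 1}.Finite ∧
    -- the expansion, entireness and the functional equation
    (∀ s, globalJ γ s = divisorSum γ s) ∧
    Differentiable ℂ (globalJ γ) ∧
    (∀ s, globalJ γ (1 - s) = globalJ γ s) ∧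
    -- the value at `s = 1`
    ((∏ᶠ v, localOrbital γ k v : ℝ) : ℂ) = globalJ γ 1 ∧
    ∏ᶠ v, localOrbital γ k v =
      ∏ᶠ (v : HeightOneSpectrum (𝓞 K)) (_ : v.asIdeal ∣ indexIdeal γ), localOrbital γ k v ∧
    ∏ᶠ v, localOrbital γ k v =
      ∑ᶠ (d : Ideal (𝓞 K)) (_ : d ∣ indexIdeal γ), (Ideal.absNorm d : ℝ) *
        ∏ᶠ (p : HeightOneSpectrum (𝓞 K)) (_ : p.asIdeal ∣ d),
          (1 - (quadChar γ p : ℝ) / (Ideal.absNorm p.asIdeal : ℝ)) := by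
  have h : ∀ v, IsIntegralAt hγ v := fun v => (hc.isIntegralAt hγ hk v).1
  have hdet := fun v => (hc.isIntegralAt hγ hk v).2
  -- These are the prime divisors of S_γ. Outside of them all local factors are 1, so every product
  -- and sum reduces to `T`.
  set T := (finite_localIndex_ne_zero hγ h).toFinset with hTdef
  have hT : ∀ v ∉ T, localIndex hγ v = 0 := fun v hv => by simpa [hTdef] using hv
  have horb : ∀ v ∉ T, localOrbital γ k v = 1 := fun v hv => by
    rw [localOrbital_eq hγ (h v) k (hdet v), hT v hv]
    simp
  have hprod : ∏ᶠ v, localOrbital γ k v = ∏ v ∈ T, localOrbital γ k v :=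
    finprod_eq_prod_of_mulSupport_subset _ fun v hv => by
      by_contra hvT
      exact hv (horb v hvT)
  have hJ := globalJ_eq_prod hγ h hT
  refine ⟨isIndexIdeal_indexIdeal hγ h, fun v => ?_, ?_, finite_localOrbital_ne_one hγ hk,
    fun s => ?_, ?_, fun s => ?_, ?_, ?_, ?_⟩
  · rw [localJ_eq hγ (h v)]
    exact isNormalizedZeta_localFactor hγ (h v)
  · refine T.finite_toSet.subset fun v hv => ?_
    by_contra hvT
    refine hv (funext fun s => ?_)
    rw [localJ_eq hγ (h v), hT v hvT, localFactor_zero, Pi.one_apply]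
  · rw [hJ, divisorSum_eq_prod hγ h hT]
  · rw [funext hJ]
    exact Differentiable.fun_finsetProd fun v _ => differentiable_localFactor (absNorm_ne_zero v) _ _
  · rw [hJ, hJ]
    exact Finset.prod_congr rfl fun v _ => localFactor_one_sub (absNorm_ne_zero v) _ _ _
  · rw [hprod, hJ, Complex.ofReal_prod]
    refine Finset.prod_congr rfl fun v _ => ?_
    rw [ofReal_localOrbital hγ (h v) k (hdet v), localJ_eq hγ (h v)]
  · rw [hprod, finprod_dvd_eq_prod (indexIdeal_ne_zero hγ h)
      (fun v hv => by rw [multiplicity_indexIdeal hγ h, hT v hv])]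
    refine Finset.prod_congr rfl fun v hv => ?_
    rw [multiplicity_indexIdeal hγ h, if_neg (by simpa [hTdef] using hv)]
  · rw [hprod, orbital_divisorSum_eq_prod hγ h hT]
    exact Finset.prod_congr rfl fun v _ => localOrbital_eq hγ (h v) k (hdet v)
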